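/- Let $S(\mathbb R)$ be the Schwartz space of complex-valued functions on the line, regarded as a real vector space. For $\psi\in S(\mathbb R)$ and $\lambda\in\mathbb C$ put $$V=V_2=-\tfrac{i\lambda}{2}\sigma_3+Y_0,\quad Y_0=\begin{pmatrix}0&\bar\psi\\ \psi&0\end{pmatrix},\quad \sigma_1=\begin{pmatrix}0&1\\1&0\end{pmatrix},\quad \sigma_3=\begin{pmatrix}1&0\\0&-1\end{pmatrix},\quad J=\begin{pmatrix}0&1\\-1&0\end{pmatrix}.$$ The Jost columns $j^{(1)}_\pm,j^{(2)}_\pm$ are the solutions of $j'=Vj$ with $e^{i\lambda x/2}j^{(1)}_\pm\to(1,0)^T$ and $e^{-i\lambda x/2}j^{(2)}_\pm\to(0,1)^T$ as $x\to\pm\infty$; $j^{(1)}_-,j^{(2)}_+$ are used for $\operatorname{Im}\lambda>0$ and $j^{(1)}_+,j^{(2)}_-$ for $\operatorname{Im}\lambda<0$. Put $H_+=[j^{(1)}_-,j^{(2)}_+]$, $H_-=[j^{(1)}_+,j^{(2)}_-]$, $a(\lambda)=j_-^{(1)T}Jj_+^{(2)}$ for $\operatorname{Im}\lambda>0$, $a^*(\lambda)=\overline{a(\bar\lambda)}$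 for $\operatorname{Im}\lambda<0$, $H_+^*=-\frac{\sigma_3}{a}\sigma_1H_+^T$ and $H_-^*=-\frac{\sigma_3}{a^*}\sigma_1H_-^T$. Let $\delta$ denote the variation with respect to $\psi$ at fixed $x$ and $\lambda$, so that $\delta V=\begin{pmatrix}0&\delta\bar\psi\\ \delta\psi&0\end{pmatrix}$, let $\langle\,\cdot\,\rangle=\int_{-\infty}^{\infty}dx$, and let $(\alpha\wedge\beta)(u,v)=\alpha(u)\beta(v)-\alpha(v)\beta(u)$. In the formula for $\omega_0$ below the trace is taken under the integral, and $\operatorname{res}$ is the coefficient of $1/\lambda$ in the asymptotic expansion as $\lambda\to\infty$ in the sectors $\delta_0\le\arg\lambda\le\pi-\delta_0$, $\delta_0>0$ (first term) or $-\pi+\delta_0\le\arg\lambda\le-\delta_0$, $\delta_0>0$ (second term). Let $p_\infty$ be the analytic function on $\operatorname{Im}\lambda>0$ with $a=e^{-2ip_\infty}$ and $p_\infty(\lambda)\to0$ as $|\lambda|\to\infty$, and let $H_1,H_2,\dots$ be the functions of $\psi$ given by the asymptotic expansion $p_\infty(\lambda)\sim-\sum_{m\ge1}H_m(\psi)\lambda^{-m}$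 in the sectors $\delta_0\le\arg\lambda\le\pi-\delta_0$. Let $Q=\sum_{k\ge0}Q_k\lambda^{-k}$ be the formal solution of $Q'=[V,Q]$, $Q^2=-\frac14I$, $Q_0=-\frac i2\sigma_3$, whose coefficients are matrices with entries polynomial in $\psi,\bar\psi$ and their $x$-derivatives, and for $m\ge1$ put $V_m=(-1)^m\sum_{k=0}^{m-1}\lambda^{m-1-k}Q_k$; in particular $V_1=\frac i2\sigma_3$, $V_2=V$ and $V_3=\frac{\lambda^2}{2}i\sigma_3-\lambda Y_0+|\psi|^2i\sigma_3-i\sigma_3Y_0'$. **Theorem.** (i) The Jost columns above exist and are unique, $a$ and $a^*$ have no zeros in their open half-planes, the variations and integrals below exist, the residues exist, and the formula $$\omega_0=\operatorname{trace}\,\operatorname{res}\,\tfrac12\bigl[\langle H_+^*J\,\delta V\wedge\delta H_+\rangle+\langle H_-^*J\,\delta V\wedge\delta H_-\rangle\bigr]\,d\lambda$$ defines a closed continuous 2-form on $S(\mathbb R)$, i.e. on the space of operators $\partial_x-V_2$ with Schwartz potential. Explicitly, $\omega_0=2i\int_{-\infty}^{\infty}\delta\bar\psi\wedge\delta\psi\,dx$.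 (ii) The functions $p_\infty$ and $H_m$ ($m\ge 1$) exist, and the $H_m$ are real-valued. For every $m\ge1$ and $\psi\in S(\mathbb R)$ the equation $[\partial_{\tau_m}-V_m,\partial_x-V_2]=0$ (for all $\lambda$ and $x$) determines a unique velocity $X_m(\psi)=\partial\psi/\partial\tau_m\in S(\mathbb R)$. The flow of $X_m$ is Hamiltonian for $\omega_0$ with Hamiltonian $H_m$ up to a constant factor: there is a real constant $c_m\neq0$, depending only on $m$, such that for all $\psi,v\in S(\mathbb R)$ the function $H_m$ is differentiable at $\psi$ in the direction $v$ and $\omega_0(X_m(\psi),v)=-c_m\,\delta H_m(\psi)[v]$. -/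

import Mathlib

open scoped SchwartzMap ComplexConjugate
open Filter Topology

noncomputable section

namespace NLSScattering

/-! ### The auxiliary linear problem `f' = V f` -/

/-- Complex `2 × 2` matrices. -/
abbrev Mat := Matrix (Fin 2) (Fin 2) ℂ

/-- The Pauli matrix `σ₁`. -/
def sigma1 : Mat := !![0, 1; 1, 0]

/-- The Pauli matrix `σ₃`. -/
def sigma3 : Mat := !![1, 0; 0, -1]

/-- `J = i σ₂`. -/
def matJ : Mat := !![0, 1; -1, 0]

/-- The off-diagonal potential matrix `Y₀`. -/
def matY (ψ : 𝓢(ℝ, ℂ)) (x : ℝ) : Mat := !![0, conj (ψ x); ψ x, 0]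

/-- `V = V₂ = -(iλ/2) σ₃ + Y₀`. -/
def matV (ψ : 𝓢(ℝ, ℂ)) (lam : ℂ) (x : ℝ) : Mat :=
  -(Complex.I * lam / 2) • sigma3 + matY ψ x

/-- The variation `δV` of `V` (at fixed `λ`) for the variation `δψ = u` of the potential.
It depends neither on `λ` nor on the potential. -/
def deltaV (u : 𝓢(ℝ, ℂ)) (x : ℝ) : Mat := matY u x

/-! ### Jost solutions -/

/-- The diagonal entries of `E(λx/2) = exp(-(iλx/2) σ₃)`. -/
def freeExp (k : Fin 2) (lam : ℂ) (x : ℝ) : ℂ :=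
  if k = 0 then Complex.exp (-(Complex.I * lam * x / 2))
  else Complex.exp (Complex.I * lam * x / 2)

/-- `j` is the `k`-th column (`k = 0, 1`) of the Jost solution normalized at the end `l` of the
line (`l = atTop` for `J₊`, `l = atBot` for `J₋`): it solves `j' = V j`, and
`j(x) = E(λx/2)ₖₖ (eₖ + o(1))` as `x → l`. -/
def IsJostColumn (l : Filter ℝ) (k : Fin 2) (ψ : 𝓢(ℝ, ℂ)) (lam : ℂ)
    (j : ℝ → Fin 2 → ℂ) : Prop :=
  (∀ x, HasDerivAt j ((matV ψ lam x).mulVec (j x)) x) ∧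
    Tendsto (fun x => (freeExp k lam x)⁻¹ • j x) l (𝓝 (Pi.single k 1))

/-- The column of the Jost solution; it is meaningful where `IsJostColumn` has exactly one
solution. -/
def jostColumn (l : Filter ℝ) (k : Fin 2) (ψ : 𝓢(ℝ, ℂ)) (lam : ℂ) : ℝ → Fin 2 → ℂ :=
  Classical.epsilon (IsJostColumn l k ψ lam)

/-- The matrix with columns `f` and `g`. -/
def ofColumns (f g : Fin 2 → ℂ) : Mat := !![f 0, g 0; f 1, g 1]

/-- `H₊ = [j₋⁽¹⁾, j₊⁽²⁾]`, for `Im λ > 0`. -/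
def Hplus (lam : ℂ) (ψ : 𝓢(ℝ, ℂ)) (x : ℝ) : Mat :=
  ofColumns (jostColumn atBot 0 ψ lam x) (jostColumn atTop 1 ψ lam x)

/-- `H₋ = [j₊⁽¹⁾, j₋⁽²⁾]`, for `Im λ < 0`. -/
def Hminus (lam : ℂ) (ψ : 𝓢(ℝ, ℂ)) (x : ℝ) : Mat :=
  ofColumns (jostColumn atTop 0 ψ lam x) (jostColumn atBot 1 ψ lam x)

/-- The coefficient `a(λ) = (j₋⁽¹⁾)ᵀ J j₊⁽²⁾`, for `Im λ > 0`. This Wronskian of two solutions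
does not depend on `x`; it is evaluated at `x = 0`. -/
def coeffA (lam : ℂ) (ψ : 𝓢(ℝ, ℂ)) : ℂ :=
  dotProduct (jostColumn atBot 0 ψ lam 0) (matJ.mulVec (jostColumn atTop 1 ψ lam 0))

/-- The extension `a*(λ)`, the conjugate of `a` at the conjugate point, for `Im λ < 0`. -/
def coeffAStar (lam : ℂ) (ψ : 𝓢(ℝ, ℂ)) : ℂ := conj (coeffA (conj lam) ψ)

/-! ### The Krichever–Phong formula -/

/-- `H* = -(σ₃/α) σ₁ Hᵀ`. With `α = a`, `H = H₊` this is `H₊*`; with `α = a*`, `H = H₋` it is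
`H₋*`. -/
def dualMat (α : ℂ) (H : Mat) : Mat := -(α⁻¹ • (sigma3 * (sigma1 * H.transpose)))

/-- The variation `δH(x)` at `ψ` in the direction `v`: entrywise, the derivative at `t = 0` of
`H` for the potential `ψ + t v`, with `x` and `λ` fixed. -/
def deltaH (H : 𝓢(ℝ, ℂ) → ℝ → Mat) (ψ v : 𝓢(ℝ, ℂ)) (x : ℝ) : Mat :=
  Matrix.of fun i k => lineDeriv ℝ (fun φ => H φ x i k) ψ v

/-- The value on `(u, v)` of the two-form `trace (H* J δV ∧ δH)` at the point `x`, with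
`(α ∧ β)(u, v) = α(u) β(v) - α(v) β(u)`. -/
def kpDensity (α : 𝓢(ℝ, ℂ) → ℂ) (H : 𝓢(ℝ, ℂ) → ℝ → Mat) (ψ u v : 𝓢(ℝ, ℂ)) (x : ℝ) : ℂ :=
  Matrix.trace
    (dualMat (α ψ) (H ψ x) * matJ * deltaV u x * deltaH H ψ v x
      - dualMat (α ψ) (H ψ x) * matJ * deltaV v x * deltaH H ψ u x)

/-- `trace ⟨H₊* J δV ∧ δH₊⟩(u, v)` as a function of `λ`, `Im λ > 0`. -/
def kpPlus (ψ u v : 𝓢(ℝ, ℂ)) (lam : ℂ) : ℂ :=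
  ∫ x, kpDensity (coeffA lam) (Hplus lam) ψ u v x

/-- `trace ⟨H₋* J δV ∧ δH₋⟩(u, v)` as a function of `λ`, `Im λ < 0`. -/
def kpMinus (ψ u v : 𝓢(ℝ, ℂ)) (lam : ℂ) : ℂ :=
  ∫ x, kpDensity (coeffAStar lam) (Hminus lam) ψ u v x

/-- The closed sector `δ ≤ arg λ ≤ π - δ` of the upper half-plane. -/
def upperSector (δ : ℝ) : Set ℂ := {z | δ ≤ z.arg ∧ z.arg ≤ Real.pi - δ}

/-- The closed sector `-π + δ ≤ arg λ ≤ -δ` of the lower half-plane. -/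
def lowerSector (δ : ℝ) : Set ℂ := {z | -Real.pi + δ ≤ z.arg ∧ z.arg ≤ -δ}

/-- `F(λ) = c₀ + c₁ λ⁻¹ + ⋯ + c_N λ⁻ᴺ + o(λ⁻ᴺ)` as `λ → ∞` in each of the sectors `S δ`,
`δ > 0`. -/
def HasExpansion (S : ℝ → Set ℂ) (F : ℂ → ℂ) (c : ℕ → ℂ) (N : ℕ) : Prop :=
  ∀ δ : ℝ, 0 < δ →
    (fun z : ℂ => F z - ∑ s ∈ Finset.range (N + 1), c s * z⁻¹ ^ s)
      =o[Bornology.cobounded ℂ ⊓ 𝓟 (S δ)] fun z : ℂ => z⁻¹ ^ N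

/-- `r` is the coefficient of `1/λ` in the asymptotic expansion of `F` at infinity in the
sectors `S δ`. -/
def IsResidue (S : ℝ → Set ℂ) (F : ℂ → ℂ) (r : ℂ) : Prop :=
  ∃ c : ℕ → ℂ, HasExpansion S F c 1 ∧ c 1 = r

/-- `w` is the value on `(u, v)`, at the potential `ψ`, of
`trace res ½ [⟨H₊* J δV ∧ δH₊⟩ + ⟨H₋* J δV ∧ δH₋⟩] dλ`. -/
def IsKricheverPhongValue (ψ u v : 𝓢(ℝ, ℂ)) (w : ℂ) : Prop :=
  ∃ rp rm : ℂ, IsResidue upperSector (kpPlus ψ u v) rp ∧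
    IsResidue lowerSector (kpMinus ψ u v) rm ∧ w = (1 / 2) * (rp + rm)

/-- All the ingredients of the formula exist for `H = H₊` or `H₋` at the parameter `λ`: the
scalar `α` in the denominator does not vanish, the entries of `H` can be varied, and the integral
over the line converges. -/
def KricheverPhongMeaningful (α : 𝓢(ℝ, ℂ) → ℂ) (H : 𝓢(ℝ, ℂ) → ℝ → Mat) : Prop :=
  ∀ ψ : 𝓢(ℝ, ℂ), α ψ ≠ 0 ∧
    (∀ (v : 𝓢(ℝ, ℂ)) (x : ℝ) (i k : Fin 2),
      LineDifferentiableAt ℝ (fun φ => H φ x i k) ψ v) ∧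
    ∀ u v : 𝓢(ℝ, ℂ), MeasureTheory.Integrable (kpDensity α H ψ u v)

/-- A two-form `ω` on a topological vector space is closed: the coefficients
`φ ↦ ω_φ(v, w)` have directional derivatives, and
`dω(u, v, w) = ∂_u ω(v, w) - ∂_v ω(u, w) + ∂_w ω(u, v)` vanishes. -/
def IsClosedTwoForm {E : Type*} [AddCommGroup E] [Module ℝ E] [TopologicalSpace E]
    (ω : E → E [⋀^Fin 2]→L[ℝ] ℂ) : Prop :=
  (∀ p u v w : E, LineDifferentiableAt ℝ (fun q => ω q ![v, w]) p u) ∧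
    ∀ p u v w : E,
      lineDeriv ℝ (fun q => ω q ![v, w]) p u - lineDeriv ℝ (fun q => ω q ![u, w]) p v
        + lineDeriv ℝ (fun q => ω q ![u, v]) p w = 0

/-! ### The Hamiltonians -/

/-- `p` is the quasimomentum `p_∞`: analytic in the upper half-plane, with
`a(λ) = exp(-2 i p(λ))` there and `p(λ) = o(1)` as `|λ| → ∞`. -/
def IsQuasimomentum (ψ : 𝓢(ℝ, ℂ)) (p : ℂ → ℂ) : Prop :=
  DifferentiableOn ℂ p {z | 0 < z.im} ∧
    (∀ z : ℂ, 0 < z.im → coeffA z ψ = Complex.exp (-2 * Complex.I * p z)) ∧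
    Tendsto p (Bornology.cobounded ℂ ⊓ 𝓟 {z | 0 < z.im}) (𝓝 0)

/-- The numbers `h 1, h 2, …` are the values at `ψ` of the NLS integrals of motion: the
coefficients of `p_∞(λ) = -h₁/λ - h₂/λ² - h₃/λ³ - ⋯`, an expansion to all orders in the sectors
`δ ≤ arg λ ≤ π - δ`. -/
def AreIntegralsOfMotion (ψ : 𝓢(ℝ, ℂ)) (h : ℕ → ℝ) : Prop :=
  ∃ p : ℂ → ℂ, IsQuasimomentum ψ p ∧
    ∀ N : ℕ, HasExpansion upperSector p (fun s => if s = 0 then 0 else -(h s : ℂ)) N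

/-! ### The NLS hierarchy -/

/-- The coefficients of the formal series `Q = Q₀ + Q₁ λ⁻¹ + Q₂ λ⁻² + ⋯` that satisfies
`Q' = [V, Q]`, `Q² = -1/4` and `Q₀ = -(i/2) σ₃`. They are traceless with entries that are
polynomials in `ψ`, its conjugate and their `x`-derivatives: the off-diagonal entries of `Qₙ₊₁`
come from the order `λ⁻ⁿ` of `Q' = [V, Q]`, the diagonal ones from the order `λ⁻ⁿ⁻¹` of
`Q² = -1/4`. -/
def laxCoeff (ψ : 𝓢(ℝ, ℂ)) : ℕ → ℝ → Mat
  | 0 => fun _ => -(Complex.I / 2) • sigma3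
  | n + 1 => fun x =>
      let d : ℂ := -Complex.I *
        ∑ j : Fin n, (laxCoeff ψ (j.val + 1) x * laxCoeff ψ (n - j.val) x) 0 0
      !![d, Complex.I * (deriv (fun y => laxCoeff ψ n y 0 1) x
              + 2 * conj (ψ x) * laxCoeff ψ n x 0 0);
         -Complex.I * (deriv (fun y => laxCoeff ψ n y 1 0) x
              - 2 * ψ x * laxCoeff ψ n x 0 0), -d]
  termination_by n => n
  decreasing_by all_goals omega

/-- The matrices `V_m`, `m ≥ 1`, of the NLS hierarchy:
`V_m = (-1)ᵐ (λᵐ⁻¹ Q₀ + λᵐ⁻² Q₁ + ⋯ + Q_{m-1})`. Thus `V₁ = (i/2) σ₃`, `V₂ = V` and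
`V₃ = (λ²/2) i σ₃ - λ Y₀ + |ψ|² i σ₃ - i σ₃ Y₀'`. -/
def hierarchyV (m : ℕ) (ψ : 𝓢(ℝ, ℂ)) (lam : ℂ) (x : ℝ) : Mat :=
  (-1 : ℂ) ^ m • ∑ k ∈ Finset.range m, lam ^ (m - 1 - k) • laxCoeff ψ k x

/-- `X` is the velocity `∂ψ/∂τ_m` at `ψ` of the `m`-th flow: for all `λ` and `x`,
`[∂_{τ_m} - V_m, ∂_x - V₂] = -∂V₂/∂τ_m + ∂V_m/∂x + [V_m, V₂] = 0`. -/
def IsFlowVelocity (m : ℕ) (ψ X : 𝓢(ℝ, ℂ)) : Prop :=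
  ∀ (lam : ℂ) (x : ℝ),
    -deltaV X x + Matrix.of (fun i k => deriv (fun y => hierarchyV m ψ lam y i k) x)
      + (hierarchyV m ψ lam x * matV ψ lam x - matV ψ lam x * hierarchyV m ψ lam x) = 0

end NLSScattering

end

/-!
The argument replaces the linear problem `j' = V j` by Riccati equations. For `Im λ > 0` the column
`j₋⁽¹⁾` is `e^{-iλx/2} (f₁, f₂)` with `(f₁, f₂) → (1, 0)` at `-∞`. A Volterra equation, contracting in
a weighted sup norm, gives existence (`exists_isNormalized`). The quantity
`e^{x Im λ} (|f₁|² - |f₂|²)` increases (this is the defocusing sign of the potential), so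
`|f₂| < |f₁|`, and the ratio `r = f₂ / f₁`, called `ric`, is a bounded solution of
`r' = iλ r + ψ - ψ̄ r²`. The reflection `x ↦ -x` turns `j₊⁽²⁾` into such a column for another
potential, with ratio `s`, and the symmetry `λ ↦ λ̄` reaches the lower half-plane. Constancy of the
Wronskian gives `a = exp (∫ ψ̄ r)` (`coeffA_eq`), which has no zeros and a logarithm that is explicit
in `r`.

Every further question is about a difference `e` of two Riccati solutions, or of a solution and an
approximation to it; such an `e` is bounded and solves a linear equation `e' = (iλ + b) e + R`. For
`Im λ > 0` a bounded solution is unique and given by an integral (`eq_linSol`), which is bounded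
either by `∫ |R|` or by `sup |R| / Im λ`. The derivatives of `r` in `ψ` and in `λ`
(`ric_difference_quotient`) and all asymptotics as `λ → ∞` come from these estimates.

*The form.* The density `tr (H* J δV ∧ δH)` is `tr (δV ∧ δH H⁻¹)`, in which only the off-diagonal
entries of `δH H⁻¹` enter. To leading order these are `iδψ / λ` and `-iδψ̄ / λ`
(`exists_var_le`), so that the residue is `2i ∫ δψ̄ ∧ δψ` in both half-planes. This form does not
depend on `ψ`, hence is closed.

*The Hamiltonians.* `r` has an expansion `∑ r_k λ⁻ᵏ` whose coefficients satisfy a recursion in the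
differential algebra `ℂ + 𝓢(ℝ)`, and so `log a = ∫ ψ̄ r` expands with the coefficients
`I_k = ∫ ψ̄ r_k` (`exists_norm_logA_sub_le`). Over formal power series in `1/λ`, the
formal counterpart of `-(i/2) H₊ σ₃ H₊⁻¹`, rational in the formal `r` and `s`, is the resolvent
`Q = ∑ Q_k λ⁻ᵏ` (`laxCoeff_eq`), and a purely algebraic identity shows that the variation of `ψ̄ r` is
`i (δψ̄ Q₂₁ + δψ Q₁₂)` up to an `x`-derivative (`variation_eq_add_deriv`). Along a straight line
`ψ + t v` the coefficient `r_k` is a polynomial in `t`, so that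
this identity computes the derivative of `I_k` (`hasLineDerivAt_logCoeff`). It is purely imaginary,
since `Q₁₂ = conj Q₂₁`; therefore so is `I_k`, and `H_k = -(i/2) I_k` is real.

*The flows.* The recursion for `Q` makes `V_m' + [V_m, V]` telescope to the commutator of `σ₃` and
`Q_m` (`zero_curvature_sum`), whence `X_m = (-1)ᵐ i (Q_m)₂₁`. Comparison with the gradient of `H_m`
gives `ω₀(X_m, v) = 4 (-1)ᵐ δH_m[v]` (`omegaVal_flow`).
-/

noncomputable section

namespace NLSScattering

open MeasureTheory Set

/-! ### First-order linear equations on the line -/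

/-- The primitive `∫_{-∞}^x b`, for a function `b` that is integrable at `-∞`. -/
def prim (b : ℝ → ℂ) (x : ℝ) : ℂ := ∫ y in Iic x, b y

lemma hasDerivAt_prim {b : ℝ → ℂ} (hb : Continuous b) (hi : ∀ x, IntegrableOn b (Iic x)) (x : ℝ) :
    HasDerivAt (prim b) (b x) x := by
  have h : prim b = fun x => prim b 0 + ∫ y in (0 : ℝ)..x, b y := by
    ext x
    rw [← intervalIntegral.integral_Iic_sub_Iic (hi 0) (hi x)]
    simp [prim]
  rw [h]
  exact ((hb.integral_hasStrictDerivAt 0 x).hasDerivAt).const_add _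

lemma continuous_prim {b : ℝ → ℂ} (hb : Continuous b) (hi : Integrable b) :
    Continuous (prim b) :=
  continuous_iff_continuousAt.2 fun x =>
    (hasDerivAt_prim hb (fun _ => hi.integrableOn) x).continuousAt

lemma tendsto_integral_Iic_atBot {E : Type*} [NormedAddCommGroup E] [NormedSpace ℝ E]
    {b : ℝ → E} (hi : Integrable b) : Tendsto (fun x => ∫ y in Iic x, b y) atBot (𝓝 0) := by
  have h := (aecover_Ioi (μ := (volume : Measure ℝ)) (tendsto_id (α := ℝ) (x := atBot)))
    |>.integral_tendsto_of_countably_generated hi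
  have h2 : (fun x => ∫ y in Iic x, b y) = fun x => (∫ y, b y) - ∫ y in Ioi x, b y := by
    ext x
    rw [← intervalIntegral.integral_Iic_add_Ioi (b := x) hi.integrableOn hi.integrableOn]
    simp
  rw [h2]
  simpa using h.const_sub (∫ y, b y)

lemma tendsto_prim_atBot {b : ℝ → ℂ} (hi : Integrable b) : Tendsto (prim b) atBot (𝓝 0) :=
  tendsto_integral_Iic_atBot hi

lemma tendsto_prim_atTop {b : ℝ → ℂ} (hi : Integrable b) :
    Tendsto (prim b) atTop (𝓝 (∫ y, b y)) :=
  (aecover_Iic (μ := (volume : Measure ℝ)) (tendsto_id (α := ℝ) (x := atTop)))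
    |>.integral_tendsto_of_countably_generated hi

lemma setIntegral_norm_le {b : ℝ → ℂ} (hi : Integrable b) (s : Set ℝ) :
    ∫ y in s, ‖b y‖ ≤ ∫ y, ‖b y‖ :=
  setIntegral_le_integral hi.norm (Eventually.of_forall fun _ => norm_nonneg _)

lemma norm_prim_le {b : ℝ → ℂ} (hi : Integrable b) (x : ℝ) : ‖prim b x‖ ≤ ∫ y, ‖b y‖ :=
  (norm_integral_le_integral_norm _).trans (setIntegral_norm_le hi _)

lemma norm_prim_sub_le {b : ℝ → ℂ} (hi : Integrable b) {x y : ℝ} (h : y ≤ x) :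
    ‖prim b x - prim b y‖ ≤ ∫ y, ‖b y‖ := by
  rw [prim, prim, intervalIntegral.integral_Iic_sub_Iic hi.integrableOn hi.integrableOn,
    intervalIntegral.integral_of_le h]
  exact (norm_integral_le_integral_norm _).trans (setIntegral_norm_le hi _)

/-- The kernel `exp(iλ(x-y) + ∫_y^x b)` of the equation `e' = (iλ + b) e + R`. -/
def kern (lam : ℂ) (b : ℝ → ℂ) (x y : ℝ) : ℂ :=
  Complex.exp (Complex.I * lam * (x - y) + (prim b x - prim b y))

/-- The solution `∫_{-∞}^x exp(iλ(x-y) + ∫_y^x b) R(y) dy` of `e' = (iλ + b) e + R`. -/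
def linSol (lam : ℂ) (b R : ℝ → ℂ) (x : ℝ) : ℂ := ∫ y in Iic x, kern lam b x y * R y

lemma norm_kern_le {lam : ℂ} {b : ℝ → ℂ} {B : ℝ} (hi : Integrable b)
    (hB : ∫ y, ‖b y‖ ≤ B) {x y : ℝ} (h : y ≤ x) :
    ‖kern lam b x y‖ ≤ Real.exp B * Real.exp (-lam.im * (x - y)) := by
  rw [kern, Complex.norm_exp, ← Real.exp_add]
  apply Real.exp_le_exp.2
  have h1 : (Complex.I * lam * (x - y)).re = -lam.im * (x - y) := by
    simp [Complex.mul_re]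
  have h2 : (prim b x - prim b y).re ≤ B :=
    (Complex.re_le_norm _).trans ((norm_prim_sub_le hi h).trans hB)
  rw [Complex.add_re, h1]
  linarith

lemma kern_eq (lam : ℂ) (b : ℝ → ℂ) (x y : ℝ) : kern lam b x y =
    Complex.exp (Complex.I * lam * x + prim b x) * Complex.exp (-(Complex.I * lam * y + prim b y)) := by
  rw [kern, ← Complex.exp_add]
  congr 1
  ring

lemma continuous_kern_right {lam : ℂ} {b : ℝ → ℂ} (hb : Continuous b) (hi : Integrable b) (x : ℝ) :
    Continuous (kern lam b x) := by
  have := continuous_prim hb hi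
  unfold kern
  fun_prop

lemma integrableOn_exp_decay {μ : ℝ} (hμ : 0 < μ) (x : ℝ) :
    IntegrableOn (fun y => Real.exp (-μ * (x - y))) (Iic x) := by
  have h := (integrableOn_exp_mul_Iic hμ x).const_mul (Real.exp (-μ * x))
  refine (integrableOn_congr_fun (fun y _ => ?_) measurableSet_Iic).1 h
  simp only [← Real.exp_add]
  congr 1
  ring

lemma integral_exp_decay {μ : ℝ} (hμ : 0 < μ) (x : ℝ) :
    ∫ y in Iic x, Real.exp (-μ * (x - y)) = 1 / μ := by
  have h : ∀ y, Real.exp (-μ * (x - y)) = Real.exp (-μ * x) * Real.exp (μ * y) := fun y => by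
    rw [← Real.exp_add]
    congr 1
    ring
  simp_rw [h]
  rw [integral_const_mul, integral_exp_mul_Iic hμ, ← mul_div_assoc, ← Real.exp_add]
  simp

/-- The two situations in which `linSol` converges: `R` is bounded and `Im λ > 0`, or `R` is
integrable and `Im λ ≥ 0`. -/
def Admissible (lam : ℂ) (R : ℝ → ℂ) : Prop :=
  Continuous R ∧ ((0 < lam.im ∧ ∃ M, ∀ x, ‖R x‖ ≤ M) ∨ (0 ≤ lam.im ∧ Integrable R))

lemma integrableOn_kern_mul {lam : ℂ} {b R : ℝ → ℂ} (hb : Continuous b) (hi : Integrable b)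
    (hR : Admissible lam R) (x : ℝ) : IntegrableOn (fun y => kern lam b x y * R y) (Iic x) := by
  have hm : AEStronglyMeasurable (fun y => kern lam b x y * R y) (volume.restrict (Iic x)) :=
    ((continuous_kern_right hb hi x).mul hR.1).aestronglyMeasurable
  rcases hR.2 with ⟨hl, M, hM⟩ | ⟨hl, hRi⟩
  · refine ((integrableOn_exp_decay hl x).const_mul (Real.exp (∫ y, ‖b y‖) * M)).mono' hm ?_
    refine (ae_restrict_iff' measurableSet_Iic).2 (Eventually.of_forall fun y hy => ?_)
    rw [norm_mul]
    calc _ ≤ (Real.exp (∫ y, ‖b y‖) * Real.exp (-lam.im * (x - y))) * M :=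
          mul_le_mul (norm_kern_le hi le_rfl hy) (hM y) (norm_nonneg _) (by positivity)
      _ = _ := by ring
  · refine (hRi.norm.integrableOn.const_mul (Real.exp (∫ y, ‖b y‖))).mono' hm ?_
    refine (ae_restrict_iff' measurableSet_Iic).2 (Eventually.of_forall fun y hy => ?_)
    rw [norm_mul]
    refine mul_le_mul_of_nonneg_right ?_ (norm_nonneg _)
    refine (norm_kern_le hi le_rfl hy).trans (mul_le_of_le_one_right (by positivity) ?_)
    rw [Real.exp_le_one_iff]
    nlinarith [sub_nonneg.2 (mem_Iic.1 hy)]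

lemma linSol_eq (lam : ℂ) (b R : ℝ → ℂ) (x : ℝ) : linSol lam b R x =
    Complex.exp (Complex.I * lam * x + prim b x) *
      prim (fun y => Complex.exp (-(Complex.I * lam * y + prim b y)) * R y) x := by
  simp_rw [linSol, prim, ← integral_const_mul, kern_eq, mul_assoc, prim]

lemma integrableOn_integratingFactor {lam : ℂ} {b R : ℝ → ℂ} (hb : Continuous b)
    (hi : Integrable b) (hR : Admissible lam R) (x : ℝ) :
    IntegrableOn (fun y => Complex.exp (-(Complex.I * lam * y + prim b y)) * R y) (Iic x) := by
  have h := (integrableOn_kern_mul hb hi hR x).const_mul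
    (Complex.exp (-(Complex.I * lam * x + prim b x)))
  refine (integrableOn_congr_fun (fun y _ => ?_) measurableSet_Iic).1 h
  simp only [kern, ← mul_assoc, ← Complex.exp_add]
  congr 2
  ring

lemma hasDerivAt_phase {lam : ℂ} {b : ℝ → ℂ} (hb : Continuous b) (hi : Integrable b) (x : ℝ) :
    HasDerivAt (fun x : ℝ => Complex.I * lam * x + prim b x) (Complex.I * lam + b x) x := by
  refine (((hasDerivAt_id x).ofReal_comp.const_mul (Complex.I * lam)).add
    (hasDerivAt_prim hb (fun _ => hi.integrableOn) x)).congr_deriv ?_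
  simp

lemma hasDerivAt_linSol {lam : ℂ} {b R : ℝ → ℂ} (hb : Continuous b) (hi : Integrable b)
    (hR : Admissible lam R) (x : ℝ) :
    HasDerivAt (linSol lam b R) ((Complex.I * lam + b x) * linSol lam b R x + R x) x := by
  have hp := continuous_prim hb hi
  have hRc := hR.1
  have h1 := hasDerivAt_prim (b := fun y => Complex.exp (-(Complex.I * lam * y + prim b y)) * R y)
    (by fun_prop) (integrableOn_integratingFactor hb hi hR) x
  have h2 := ((hasDerivAt_phase (lam := lam) hb hi x).cexp).mul h1
  rw [show linSol lam b R = _ from funext (linSol_eq lam b R)]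
  refine h2.congr_deriv ?_
  rw [Complex.exp_neg]
  field_simp [Complex.exp_ne_zero]

lemma continuous_linSol {lam : ℂ} {b R : ℝ → ℂ} (hb : Continuous b) (hi : Integrable b)
    (hR : Admissible lam R) : Continuous (linSol lam b R) :=
  continuous_iff_continuousAt.2 fun x => (hasDerivAt_linSol hb hi hR x).continuousAt

/-- A bounded solution of `e' = (iλ + b) e + R`, `Im λ > 0`, is given by `linSol`: the
homogeneous solutions are unbounded at `-∞`. -/
lemma eq_linSol {lam : ℂ} {b R e : ℝ → ℂ} (hl : 0 < lam.im) (hb : Continuous b)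
    (hi : Integrable b) (hR : Admissible lam R)
    (he : ∀ x, HasDerivAt e ((Complex.I * lam + b x) * e x + R x) x)
    (M : ℝ) (hM : ∀ x, ‖e x‖ ≤ M) : e = linSol lam b R := by
  ext x
  have hd : ∀ y ∈ Iic x, HasDerivAt (fun y : ℝ => Complex.exp (-(Complex.I * lam * y + prim b y)) * e y)
      (Complex.exp (-(Complex.I * lam * y + prim b y)) * R y) y := fun y _ => by
    refine (((hasDerivAt_phase (lam := lam) hb hi y).neg.cexp).mul (he y)).congr_deriv ?_
    simp only [Pi.neg_apply]
    ring
  have ht : Tendsto (fun y : ℝ => Complex.exp (-(Complex.I * lam * y + prim b y)) * e y) atBot (𝓝 0) := by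
    have h0 : Tendsto (fun y : ℝ => Real.exp (lam.im * y) * (Real.exp (∫ y, ‖b y‖) * M))
        atBot (𝓝 0) := by
      have := (Real.tendsto_exp_atBot.comp (tendsto_id.const_mul_atBot hl)).mul_const
        (Real.exp (∫ y, ‖b y‖) * M)
      simpa using this
    refine squeeze_zero_norm (fun y => ?_) h0
    rw [norm_mul, Complex.norm_exp, ← mul_assoc, ← Real.exp_add]
    refine mul_le_mul (Real.exp_le_exp.2 ?_) (hM y) (norm_nonneg _) (Real.exp_pos _).le
    have h1 : (-(Complex.I * lam * y + prim b y)).re = lam.im * y - (prim b y).re := by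
      simp [Complex.mul_re]
      ring
    have h2 := (Complex.abs_re_le_norm (prim b y)).trans (norm_prim_le hi y)
    rw [h1]
    linarith [neg_le_abs (prim b y).re]
  have h := integral_Iic_of_hasDerivAt_of_tendsto' hd (integrableOn_integratingFactor hb hi hR x) ht
  have h' : prim (fun y => Complex.exp (-(Complex.I * lam * y + prim b y)) * R y) x = _ := h
  rw [linSol_eq, h', sub_zero, ← mul_assoc, ← Complex.exp_add]
  simp

lemma norm_linSol_le_prim {lam : ℂ} {b R : ℝ → ℂ} {B : ℝ} (hl : 0 ≤ lam.im)
    (hi : Integrable b) (hB : ∫ y, ‖b y‖ ≤ B) {m : ℝ → ℝ} (hm : Integrable m)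
    (hRm : ∀ x, ‖R x‖ ≤ m x) (x : ℝ) :
    ‖linSol lam b R x‖ ≤ Real.exp B * ∫ y in Iic x, m y := by
  rw [← integral_const_mul]
  refine norm_integral_le_of_norm_le (hm.integrableOn.const_mul _) ?_
  refine (ae_restrict_iff' measurableSet_Iic).2 (Eventually.of_forall fun y hy => ?_)
  rw [norm_mul]
  refine mul_le_mul ?_ (hRm y) (norm_nonneg _) (by positivity)
  refine (norm_kern_le hi hB hy).trans (mul_le_of_le_one_right (by positivity) ?_)
  rw [Real.exp_le_one_iff]
  nlinarith [sub_nonneg.2 (mem_Iic.1 hy)]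

/-- The bound of `linSol` for an integrable source, uniform in `Im λ ≥ 0`. -/
lemma norm_linSol_le_integral {lam : ℂ} {b R : ℝ → ℂ} {B : ℝ} (hl : 0 ≤ lam.im)
    (hi : Integrable b) (hB : ∫ y, ‖b y‖ ≤ B) {m : ℝ → ℝ} (hm : Integrable m)
    (hRm : ∀ x, ‖R x‖ ≤ m x) (x : ℝ) :
    ‖linSol lam b R x‖ ≤ Real.exp B * ∫ y, m y :=
  (norm_linSol_le_prim hl hi hB hm hRm x).trans <| mul_le_mul_of_nonneg_left
    (setIntegral_le_integral hm (Eventually.of_forall fun y => (norm_nonneg _).trans (hRm y)))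
    (Real.exp_pos _).le

/-- The bound of `linSol` for a bounded source; the factor `1 / Im λ` gives decay in sectors. -/
lemma norm_linSol_le_div {lam : ℂ} {b R : ℝ → ℂ} {B M : ℝ} (hl : 0 < lam.im)
    (hi : Integrable b) (hB : ∫ y, ‖b y‖ ≤ B) (hRM : ∀ x, ‖R x‖ ≤ M) (x : ℝ) :
    ‖linSol lam b R x‖ ≤ Real.exp B * M / lam.im := by
  have h : Real.exp B * M / lam.im =
      ∫ y in Iic x, (Real.exp B * M) * Real.exp (-lam.im * (x - y)) := by
    rw [integral_const_mul, integral_exp_decay hl]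
    ring
  rw [h]
  refine norm_integral_le_of_norm_le ((integrableOn_exp_decay hl x).const_mul _) ?_
  refine (ae_restrict_iff' measurableSet_Iic).2 (Eventually.of_forall fun y hy => ?_)
  rw [norm_mul]
  calc _ ≤ (Real.exp B * Real.exp (-lam.im * (x - y))) * M :=
          mul_le_mul (norm_kern_le hi hB hy) (hRM y) (norm_nonneg _) (by positivity)
      _ = _ := by ring

/-- Continuous dependence of `linSol` on `b` and `R`. -/
lemma tendsto_linSol {ι : Type*} {l : Filter ι} [l.IsCountablyGenerated] {lam : ℂ}
    (hl : 0 < lam.im) {b R : ι → ℝ → ℂ} {b₀ R₀ : ℝ → ℂ} {m : ℝ → ℝ} {M : ℝ}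
    (hb : ∀ᶠ i in l, Continuous (b i)) (hm : Integrable m) (hbm : ∀ᶠ i in l, ∀ x, ‖b i x‖ ≤ m x)
    (hR : ∀ᶠ i in l, Continuous (R i)) (hRM : ∀ᶠ i in l, ∀ x, ‖R i x‖ ≤ M)
    (hbt : ∀ x, Tendsto (fun i => b i x) l (𝓝 (b₀ x)))
    (hRt : ∀ x, Tendsto (fun i => R i x) l (𝓝 (R₀ x))) (x : ℝ) :
    Tendsto (fun i => linSol lam (b i) (R i) x) l (𝓝 (linSol lam b₀ R₀ x)) := by
  have hp : ∀ x, Tendsto (fun i => prim (b i) x) l (𝓝 (prim b₀ x)) := fun x => by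
    refine tendsto_integral_filter_of_dominated_convergence m ?_ ?_ hm.integrableOn
      (Eventually.of_forall fun y => hbt y)
    · filter_upwards [hb] with i h using h.aestronglyMeasurable
    · filter_upwards [hbm] with i h using Eventually.of_forall fun y => h y
  have hint : ∀ᶠ i in l, Integrable (b i) := by
    filter_upwards [hb, hbm] with i h1 h2
    exact hm.mono' h1.aestronglyMeasurable (Eventually.of_forall h2)
  have hB : ∀ᶠ i in l, ∫ y, ‖b i y‖ ≤ ∫ y, m y := by
    filter_upwards [hint, hbm] with i h1 h2
    exact integral_mono h1.norm hm h2
  refine tendsto_integral_filter_of_dominated_convergence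
    (fun y => (Real.exp (∫ y, m y) * M) * Real.exp (-lam.im * (x - y))) ?_ ?_
    ((integrableOn_exp_decay hl x).const_mul _) (Eventually.of_forall fun y => ?_)
  · filter_upwards [hb, hint, hR] with i h1 h2 h3
    exact ((continuous_kern_right h1 h2 x).mul h3).aestronglyMeasurable
  · filter_upwards [hint, hB, hRM] with i h1 h2 h3
    refine (ae_restrict_iff' measurableSet_Iic).2 (Eventually.of_forall fun y hy => ?_)
    rw [norm_mul]
    calc _ ≤ (Real.exp (∫ y, m y) * Real.exp (-lam.im * (x - y))) * M :=
          mul_le_mul (norm_kern_le h1 h2 hy) (h3 y) (norm_nonneg _) (by positivity)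
      _ = _ := by ring
  · refine Tendsto.mul ?_ (hRt y)
    exact (((hp x).sub (hp y)).const_add _).cexp

/-! ### Existence and uniqueness of the normalized solution -/

/-- `(f₁, f₂) = e^{iλx/2} j` for a Jost column `j = j₋⁽¹⁾`: the oscillating factor is removed, so that
the normalization at `-∞` becomes a limit of the functions themselves. -/
structure IsNormalized (q : 𝓢(ℝ, ℂ)) (lam : ℂ) (f₁ f₂ : ℝ → ℂ) : Prop where
  deriv_fst : ∀ x, HasDerivAt f₁ (conj (q x) * f₂ x) x
  deriv_snd : ∀ x, HasDerivAt f₂ (q x * f₁ x + Complex.I * lam * f₂ x) x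
  tendsto_fst : Tendsto f₁ atBot (𝓝 1)
  tendsto_snd : Tendsto f₂ atBot (𝓝 0)

lemma integrable_norm (q : 𝓢(ℝ, ℂ)) : Integrable fun x => ‖q x‖ := q.integrable.norm

lemma exists_norm_le (q : 𝓢(ℝ, ℂ)) : ∃ M, 0 ≤ M ∧ ∀ x, ‖q x‖ ≤ M := by
  obtain ⟨C, hC⟩ := q.decay 0 0
  exact ⟨C, hC.1.le, fun x => by simpa using hC.2 x⟩

lemma exists_norm_le_inv_one_add_sq (q : 𝓢(ℝ, ℂ)) : ∃ C, ∀ x, ‖q x‖ ≤ C * (1 + x ^ 2)⁻¹ := by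
  obtain ⟨C, hC⟩ := q.decay 0 0
  obtain ⟨D, hD⟩ := q.decay 2 0
  refine ⟨C + D, fun x => ?_⟩
  have h1 := hC.2 x
  have h2 := hD.2 x
  simp only [norm_iteratedFDeriv_zero, pow_zero, one_mul, Real.norm_eq_abs, sq_abs] at h1 h2
  rw [← div_eq_mul_inv, le_div_iff₀ (by positivity)]
  linarith

/-- The weight `w = exp (2 C arctan)`, bounded above and below, satisfies `∫_{-∞}^x m w ≤ w(x) / 2`
if `m` is dominated by `C / (1 + x²)`: this halves the norm of the Volterra operator with kernel `m`. -/
lemma setIntegral_weight_le {m : ℝ → ℝ} {C : ℝ} (hmC : ∀ x, m x ≤ C * (1 + x ^ 2)⁻¹)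
    {F : ℝ → ℝ} {K : ℝ} (hK : 0 ≤ K) (hF0 : ∀ x, 0 ≤ F x) (hF : ∀ x, F x ≤ m x * (Real.exp (2 * C * Real.arctan x) * K))
    (x : ℝ) : ∫ y in Iic x, F y ≤ Real.exp (2 * C * Real.arctan x) * (K / 2) := by
  have hd : ∀ y ∈ Iic x, HasDerivAt (fun y => Real.exp (2 * C * Real.arctan y) * (K / 2))
      (C * (1 + y ^ 2)⁻¹ * (Real.exp (2 * C * Real.arctan y) * K)) y := fun y _ => by
    refine ((((Real.hasDerivAt_arctan' y).const_mul (2 * C)).exp).mul_const _).congr_deriv ?_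
    ring
  have hbd : ∀ y, Real.exp (2 * C * Real.arctan y) ≤ Real.exp (2 * |C| * (Real.pi / 2)) := fun y => by
    apply Real.exp_le_exp.2
    have h1 : |Real.arctan y| ≤ Real.pi / 2 :=
      abs_le.2 ⟨(Real.neg_pi_div_two_lt_arctan y).le, (Real.arctan_lt_pi_div_two y).le⟩
    calc 2 * C * Real.arctan y ≤ |2 * C * Real.arctan y| := le_abs_self _
      _ = 2 * |C| * |Real.arctan y| := by rw [abs_mul, abs_mul, abs_two]
      _ ≤ _ := by gcongr
  have hint : IntegrableOn (fun y => C * (1 + y ^ 2)⁻¹ * (Real.exp (2 * C * Real.arctan y) * K)) (Iic x) := by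
    refine ((integrable_inv_one_add_sq.norm.const_mul (|C| * (Real.exp (2 * |C| * (Real.pi / 2)) * K)))).integrableOn.mono' ?_ ?_
    · have : Continuous fun y : ℝ => C * (1 + y ^ 2)⁻¹ * (Real.exp (2 * C * Real.arctan y) * K) := by
        have : ∀ y : ℝ, 1 + y ^ 2 ≠ 0 := fun y => by positivity
        have := Real.continuous_arctan
        fun_prop (disch := assumption)
      exact this.aestronglyMeasurable
    · refine Eventually.of_forall fun y => ?_
      rw [norm_mul, norm_mul, norm_mul, Real.norm_eq_abs C, Real.norm_of_nonneg hK, Real.norm_of_nonneg (Real.exp_pos _).le]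
      have := hbd y
      calc _ ≤ |C| * ‖(1 + y ^ 2)⁻¹‖ * (Real.exp (2 * |C| * (Real.pi / 2)) * K) := by gcongr
        _ = _ := by ring
  have ht : Tendsto (fun y => Real.exp (2 * C * Real.arctan y) * (K / 2)) atBot
      (𝓝 (Real.exp (2 * C * (-(Real.pi / 2))) * (K / 2))) := by
    have h1 : Tendsto Real.arctan atBot (𝓝 (-(Real.pi / 2))) :=
      tendsto_nhds_of_tendsto_nhdsWithin Real.tendsto_arctan_atBot
    exact ((h1.const_mul (2 * C)).rexp).mul_const _
  have h := integral_Iic_of_hasDerivAt_of_tendsto' hd hint ht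
  calc ∫ y in Iic x, F y ≤ ∫ y in Iic x, C * (1 + y ^ 2)⁻¹ * (Real.exp (2 * C * Real.arctan y) * K) := by
        refine integral_mono_of_nonneg (Eventually.of_forall hF0) hint (Eventually.of_forall fun y => ?_)
        exact (hF y).trans (mul_le_mul_of_nonneg_right (hmC y) (by positivity))
    _ ≤ _ := by
        rw [h]
        have : 0 ≤ Real.exp (2 * C * (-(Real.pi / 2))) * (K / 2) := by positivity
        linarith

/-- The integral equations for `(f₁, f₂)`. They are solved for the unknown `(f₁, f₂) / w` by the
contraction principle, for the weight `w` of `setIntegral_weight_le`. -/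
lemma exists_volterra (q : 𝓢(ℝ, ℂ)) {lam : ℂ} (hl : 0 ≤ lam.im) :
    ∃ f₁ f₂ : ℝ → ℂ, Continuous f₁ ∧ Continuous f₂ ∧ (∃ M, ∀ x, ‖f₁ x‖ ≤ M ∧ ‖f₂ x‖ ≤ M) ∧
      (∀ x, f₁ x = 1 + prim (fun y => conj (q y) * f₂ y) x) ∧
      ∀ x, f₂ x = linSol lam 0 (fun y => q y * f₁ y) x := by
  obtain ⟨C, hC⟩ := exists_norm_le_inv_one_add_sq q
  set w : ℝ → ℝ := fun x => Real.exp (2 * C * Real.arctan x) with hw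
  have hwc : Continuous w := by
    have := Real.continuous_arctan
    fun_prop
  have hw0 : ∀ x, 0 < w x := fun x => Real.exp_pos _
  obtain ⟨W, hW⟩ : ∃ W, ∀ x, w x ≤ W ∧ (w x)⁻¹ ≤ W := by
    have h2 : ∀ x, |2 * C * Real.arctan x| ≤ 2 * |C| * (Real.pi / 2) := fun x => by
      have h1 : |Real.arctan x| ≤ Real.pi / 2 :=
        abs_le.2 ⟨(Real.neg_pi_div_two_lt_arctan x).le, (Real.arctan_lt_pi_div_two x).le⟩
      rw [abs_mul, abs_mul, abs_two]
      gcongr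
    refine ⟨Real.exp (2 * |C| * (Real.pi / 2)), fun x => ⟨Real.exp_le_exp.2 ((le_abs_self _).trans (h2 x)), ?_⟩⟩
    rw [hw, ← Real.exp_neg]
    exact Real.exp_le_exp.2 ((neg_le_abs _).trans (h2 x))
  have hqc : Continuous q := q.continuous
  have hqbar : Continuous fun y => conj (q y) := Complex.continuous_conj.comp hqc
  -- the components of the weighted Volterra operator
  have hint : ∀ (c : ℝ → ℂ) (g : ℝ → ℂ) (M : ℝ), Continuous c → (∀ x, ‖c x‖ = ‖q x‖) → Continuous g → (∀ x, ‖g x‖ ≤ M) →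
      Continuous (fun y => c y * ((w y : ℂ) * g y)) ∧ Integrable (fun y => c y * ((w y : ℂ) * g y)) := by
    intro c g M hc hcq hg hM
    have hcont : Continuous (fun y => c y * ((w y : ℂ) * g y)) := by fun_prop
    refine ⟨hcont, ((integrable_norm q).mul_const (W * M)).mono' hcont.aestronglyMeasurable (Eventually.of_forall fun y => ?_)⟩
    rw [norm_mul, hcq, norm_mul, Complex.norm_real, Real.norm_of_nonneg (hw0 y).le]
    have := (hW y).1
    have := hM y
    have := (hw0 y).le.trans (hW y).1
    gcongr
  set G : (BoundedContinuousFunction ℝ (ℂ × ℂ)) → ℝ → ℂ × ℂ := fun h x =>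
    (((w x)⁻¹ : ℝ) : ℂ) • (1 + prim (fun y => conj (q y) * ((w y : ℂ) * (h y).2)) x,
      linSol lam 0 (fun y => q y * ((w y : ℂ) * (h y).1)) x) with hG
  have i1 : ∀ h : BoundedContinuousFunction ℝ (ℂ × ℂ), _ := fun h =>
    hint (fun y => conj (q y)) (fun y => (h y).2) ‖h‖ hqbar (fun x => RCLike.norm_conj _) (by fun_prop)
      (fun x => (norm_snd_le _).trans (h.norm_coe_le_norm x))
  have i2 : ∀ h : BoundedContinuousFunction ℝ (ℂ × ℂ), _ := fun h =>
    hint q (fun y => (h y).1) ‖h‖ hqc (fun x => rfl) (by fun_prop)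
      (fun x => (norm_fst_le _).trans (h.norm_coe_le_norm x))
  have hadm : ∀ h : BoundedContinuousFunction ℝ (ℂ × ℂ), Admissible lam (fun y => q y * ((w y : ℂ) * (h y).1)) :=
    fun h => ⟨(i2 h).1, Or.inr ⟨hl, (i2 h).2⟩⟩
  have h0c : Continuous (0 : ℝ → ℂ) := continuous_zero
  have h0i : Integrable (0 : ℝ → ℂ) := integrable_zero _ _ _
  have hGc : ∀ h, Continuous (G h) := fun h => by
    have c1 := continuous_prim (i1 h).1 (i1 h).2
    have c2 := continuous_linSol h0c h0i (hadm h)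
    have c3 : Continuous fun x => (w x)⁻¹ := hwc.inv₀ fun x => (hw0 x).ne'
    have c4 : Continuous fun x => (((w x)⁻¹ : ℝ) : ℂ) := Complex.continuous_ofReal.comp c3
    exact c4.smul ((continuous_const.add c1).prodMk c2)
  have h0B : ∫ y, ‖(0 : ℝ → ℂ) y‖ ≤ 0 := by simp
  have hGb : ∀ h, ∃ M, ∀ x, ‖G h x‖ ≤ M := fun h => by
    refine ⟨W * max (1 + ∫ y, ‖conj (q y) * ((w y : ℂ) * (h y).2)‖) (Real.exp 0 * ∫ y, ‖q y * ((w y : ℂ) * (h y).1)‖), fun x => ?_⟩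
    rw [hG]
    simp only [norm_smul, Complex.norm_real, Prod.norm_def]
    rw [Real.norm_of_nonneg (inv_nonneg.2 (hw0 x).le)]
    have e1 : ‖1 + prim (fun y => conj (q y) * ((w y : ℂ) * (h y).2)) x‖ ≤ 1 + ∫ y, ‖conj (q y) * ((w y : ℂ) * (h y).2)‖ := by
      refine (norm_add_le _ _).trans ?_
      rw [norm_one]
      exact add_le_add le_rfl (norm_prim_le (i1 h).2 x)
    have e2 := norm_linSol_le_integral (R := fun y => q y * ((w y : ℂ) * (h y).1)) hl h0i h0B (i2 h).2.norm (fun x => le_rfl) x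
    have := (hW x).2
    have := (inv_nonneg.2 (hw0 x).le).trans this
    gcongr
  choose M hM using hGb
  set T : BoundedContinuousFunction ℝ (ℂ × ℂ) → BoundedContinuousFunction ℝ (ℂ × ℂ) := fun h =>
    BoundedContinuousFunction.ofNormedAddCommGroup (G h) (hGc h) (M h) (hM h) with hT
  have hcontr : ContractingWith (1 / 2) T := by
    refine ⟨by rw [← NNReal.coe_lt_coe]; norm_num, LipschitzWith.of_dist_le_mul fun h g => ?_⟩
    refine (BoundedContinuousFunction.dist_le (by positivity)).2 fun x => ?_
    have hd : ∀ y, ‖h y - g y‖ ≤ dist h g := fun y => by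
      rw [← dist_eq_norm]
      exact BoundedContinuousFunction.dist_coe_le_dist y
    have key : ∀ c : ℝ → ℂ, (∀ x, ‖c x‖ = ‖q x‖) → ∀ d : ℝ → ℂ, (∀ y, ‖d y‖ ≤ ‖h y - g y‖) →
        ∫ y in Iic x, ‖c y * ((w y : ℂ) * d y)‖ ≤ w x * (dist h g / 2) := fun c hc d hdd =>
      setIntegral_weight_le hC dist_nonneg (fun y => norm_nonneg _) (fun y => by
        rw [norm_mul, norm_mul, Complex.norm_real, Real.norm_of_nonneg (hw0 y).le, hc]
        have := (hdd y).trans (hd y)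
        have := (hw0 y).le
        gcongr) x
    have e1 : ‖prim (fun y => conj (q y) * ((w y : ℂ) * (h y).2)) x - prim (fun y => conj (q y) * ((w y : ℂ) * (g y).2)) x‖
        ≤ w x * (dist h g / 2) := by
      rw [prim, prim, ← integral_sub (i1 h).2.integrableOn (i1 g).2.integrableOn]
      refine (norm_integral_le_integral_norm _).trans ?_
      have := key (fun y => conj (q y)) (fun x => RCLike.norm_conj _) (fun y => (h y).2 - (g y).2) (fun y => norm_snd_le (h y - g y))
      refine le_trans (le_of_eq ?_) this
      congr 1; ext y; congr 1; ring
    have e2 : ‖linSol lam 0 (fun y => q y * ((w y : ℂ) * (h y).1)) x - linSol lam 0 (fun y => q y * ((w y : ℂ) * (g y).1)) x‖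
        ≤ w x * (dist h g / 2) := by
      have hs : linSol lam 0 (fun y => q y * ((w y : ℂ) * (h y).1)) x - linSol lam 0 (fun y => q y * ((w y : ℂ) * (g y).1)) x
          = linSol lam 0 (fun y => q y * ((w y : ℂ) * ((h y).1 - (g y).1))) x := by
        rw [linSol, linSol, ← integral_sub (integrableOn_kern_mul h0c h0i (hadm h) x) (integrableOn_kern_mul h0c h0i (hadm g) x), linSol]
        congr 1; ext y; ring
      rw [hs]
      have hi : Integrable fun y => ‖q y * ((w y : ℂ) * ((h y).1 - (g y).1))‖ := by
        refine (((i2 h).2.sub (i2 g).2).norm).congr (Eventually.of_forall fun y => ?_)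
        simp only [Pi.sub_apply]
        congr 1; ring
      have := norm_linSol_le_prim (R := fun y => q y * ((w y : ℂ) * ((h y).1 - (g y).1))) hl h0i h0B hi (fun y => le_rfl) x
      rw [Real.exp_zero, one_mul] at this
      exact this.trans (key q (fun _ => rfl) (fun y => (h y).1 - (g y).1) (fun y => norm_fst_le (h y - g y)))
    have e3 : dist (T h x) (T g x) = ‖G h x - G g x‖ := dist_eq_norm _ _
    rw [e3, hG]
    simp only [← smul_sub, norm_smul, Complex.norm_real, Prod.mk_sub_mk, Prod.norm_def, add_sub_add_left_eq_sub]
    rw [Real.norm_of_nonneg (inv_nonneg.2 (hw0 x).le), inv_mul_le_iff₀ (hw0 x)]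
    refine (max_le e1 e2).trans (le_of_eq ?_)
    rw [NNReal.coe_div, NNReal.coe_one, NNReal.coe_ofNat]
    ring
  obtain ⟨h, hfix, -⟩ := hcontr.exists_fixedPoint 0 (edist_ne_top _ _)
  have hx : ∀ x, h x = G h x := fun x => by
    conv_lhs => rw [← hfix]
    rfl
  have hwx : ∀ x, (w x : ℂ) ≠ 0 := fun x => by exact_mod_cast (hw0 x).ne'
  refine ⟨fun x => w x * (h x).1, fun x => w x * (h x).2, by fun_prop, by fun_prop, ⟨W * ‖h‖, fun x => ?_⟩,
    fun x => ?_, fun x => ?_⟩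
  · have h1 := (norm_fst_le (h x)).trans (h.norm_coe_le_norm x)
    have h2 := (norm_snd_le (h x)).trans (h.norm_coe_le_norm x)
    have h3 := (hW x).1
    have h4 := (hw0 x).le.trans h3
    simp only [norm_mul, Complex.norm_real, Real.norm_of_nonneg (hw0 x).le]
    constructor <;> gcongr
  · have : (h x).1 = (G h x).1 := by rw [← hx]
    simp only [this, hG, Prod.smul_fst, smul_eq_mul, Complex.ofReal_inv]
    rw [mul_inv_cancel_left₀ (hwx x)]
  · have : (h x).2 = (G h x).2 := by rw [← hx]
    simp only [this, hG, Prod.smul_snd, smul_eq_mul, Complex.ofReal_inv]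
    rw [mul_inv_cancel_left₀ (hwx x)]

lemma exists_isNormalized (q : 𝓢(ℝ, ℂ)) {lam : ℂ} (hl : 0 ≤ lam.im) :
    ∃ f₁ f₂, IsNormalized q lam f₁ f₂ := by
  obtain ⟨f₁, f₂, c1, c2, ⟨M, hM⟩, h1, h2⟩ := exists_volterra q hl
  have hqbar : Continuous fun y => conj (q y) := Complex.continuous_conj.comp q.continuous
  have hqc := q.continuous
  have k1 : Continuous fun y => conj (q y) * f₂ y := hqbar.mul c2
  have k2 : Continuous fun y => q y * f₁ y := hqc.mul c1
  have i1 : Integrable fun y => conj (q y) * f₂ y := by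
    refine ((integrable_norm q).mul_const M).mono' k1.aestronglyMeasurable (Eventually.of_forall fun y => ?_)
    rw [norm_mul, RCLike.norm_conj]
    exact mul_le_mul_of_nonneg_left (hM y).2 (norm_nonneg _)
  have i2 : Integrable fun y => q y * f₁ y := by
    refine ((integrable_norm q).mul_const M).mono' k2.aestronglyMeasurable (Eventually.of_forall fun y => ?_)
    rw [norm_mul]
    exact mul_le_mul_of_nonneg_left (hM y).1 (norm_nonneg _)
  have adm : Admissible lam fun y => q y * f₁ y := ⟨k2, Or.inr ⟨hl, i2⟩⟩
  have hf1 : f₁ = fun x => 1 + prim (fun y => conj (q y) * f₂ y) x := funext h1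
  have hf2 : f₂ = linSol lam 0 (fun y => q y * f₁ y) := funext h2
  refine ⟨f₁, f₂, fun x => ?_, fun x => ?_, ?_, ?_⟩
  · have := (hasDerivAt_prim k1 (fun _ => i1.integrableOn) x).const_add 1
    rw [hf1]
    exact this
  · have := hasDerivAt_linSol (b := 0) continuous_zero (integrable_zero _ _ _) adm x
    rw [← hf2] at this
    refine this.congr_deriv ?_
    simp [add_comm]
  · rw [hf1]
    simpa using (tendsto_prim_atBot i1).const_add 1
  · rw [hf2]
    have hb := norm_linSol_le_prim (lam := lam) (b := 0) (B := 0) hl (integrable_zero _ _ _) (by simp) i2.norm (fun x => le_rfl)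
    refine squeeze_zero_norm hb ?_
    simpa using tendsto_integral_Iic_atBot i2.norm

namespace IsNormalized

variable {q : 𝓢(ℝ, ℂ)} {lam : ℂ} {f₁ f₂ g₁ g₂ : ℝ → ℂ}

/-- The function `e^{x Im λ} (|f₁|² - |f₂|²)` is increasing, and positive near `-∞`. This uses the
defocusing sign, that is, that the off-diagonal part of `V` is self-adjoint. -/
lemma norm_snd_lt (h : IsNormalized q lam f₁ f₂) (hl : 0 < lam.im) (x : ℝ) : ‖f₂ x‖ < ‖f₁ x‖ := by
  set k : ℝ → ℝ := fun x => Real.exp (lam.im * x) * (‖f₁ x‖ ^ 2 - ‖f₂ x‖ ^ 2) with hk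
  have hd : ∀ x, HasDerivAt k (Real.exp (lam.im * x) * (lam.im * (‖f₁ x‖ ^ 2 + ‖f₂ x‖ ^ 2))) x := fun x => by
    have h1 := (((hasDerivAt_id x).const_mul lam.im).exp).mul ((h.deriv_fst x).norm_sq.sub (h.deriv_snd x).norm_sq)
    refine h1.congr_deriv ?_
    simp only [Complex.inner, ← Complex.normSq_eq_norm_sq, Complex.normSq_apply, Pi.sub_apply]
    simp [Complex.mul_re, Complex.mul_im]
    ring
  have hmono : Monotone k := monotone_of_deriv_nonneg (fun x => (hd x).differentiableAt) fun x => by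
    rw [(hd x).deriv]
    positivity
  have hev : ∀ᶠ y in atBot, ‖f₂ y‖ < ‖f₁ y‖ := by
    have h1 := h.tendsto_fst.norm
    have h2 := h.tendsto_snd.norm
    exact h2.eventually_lt h1 (by simp)
  obtain ⟨y, hy, hyx⟩ := (hev.and (eventually_le_atBot x)).exists
  have h1 := hmono hyx
  have h2 : 0 < k y := mul_pos (Real.exp_pos _) (sub_pos.2 (pow_lt_pow_left₀ hy (norm_nonneg _) two_ne_zero))
  have h3 := pos_of_mul_pos_right (h2.trans_le h1) (Real.exp_pos _).le
  exact lt_of_pow_lt_pow_left₀ 2 (norm_nonneg _) (sub_pos.1 h3)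

lemma fst_ne_zero (h : IsNormalized q lam f₁ f₂) (hl : 0 < lam.im) (x : ℝ) : f₁ x ≠ 0 := fun h0 => by
  have := h.norm_snd_lt hl x
  rw [h0, norm_zero] at this
  exact (norm_nonneg _).not_gt this

lemma unique (hf : IsNormalized q lam f₁ f₂) (hg : IsNormalized q lam g₁ g₂) (hl : 0 < lam.im) :
    f₁ = g₁ ∧ f₂ = g₂ := by
  -- the Wronskian, multiplied by `exp(-iλx)`, is constant and vanishes at `-∞`
  have hW : ∀ x, f₁ x * g₂ x - f₂ x * g₁ x = 0 := by
    set W : ℝ → ℂ := fun x => Complex.exp (-(Complex.I * lam * x)) * (f₁ x * g₂ x - f₂ x * g₁ x) with hWdef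
    have hd : ∀ x, HasDerivAt W 0 x := fun x => by
      have h0 : HasDerivAt (fun x : ℝ => -(Complex.I * lam * x)) (-(Complex.I * lam)) x := by
        refine (((hasDerivAt_id x).ofReal_comp).const_mul (Complex.I * lam)).neg.congr_deriv ?_
        simp
      have h1 := h0.cexp.mul (((hf.deriv_fst x).mul (hg.deriv_snd x)).sub ((hf.deriv_snd x).mul (hg.deriv_fst x)))
      refine h1.congr_deriv ?_
      simp only [Pi.sub_apply, Pi.mul_apply]
      ring
    have hc : ∀ x y, W x = W y := is_const_of_deriv_eq_zero (fun x => (hd x).differentiableAt) fun x => (hd x).deriv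
    have ht : Tendsto W atBot (𝓝 0) := by
      have h0 : Tendsto (fun x : ℝ => Complex.exp (-(Complex.I * lam * x))) atBot (𝓝 0) := by
        rw [tendsto_zero_iff_norm_tendsto_zero]
        have : (fun x : ℝ => ‖Complex.exp (-(Complex.I * lam * x))‖) = fun x => Real.exp (lam.im * x) := by
          ext x
          rw [Complex.norm_exp]
          simp [Complex.mul_re]
        rw [this]
        exact Real.tendsto_exp_atBot.comp (tendsto_id.const_mul_atBot hl)
      simpa using h0.mul ((hf.tendsto_fst.mul hg.tendsto_snd).sub (hf.tendsto_snd.mul hg.tendsto_fst))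
    intro x
    have h1 : W x = 0 := tendsto_nhds_unique (tendsto_const_nhds.congr fun y => hc x y) ht
    exact (mul_eq_zero.1 h1).resolve_left (Complex.exp_ne_zero _)
  have hne := hf.fst_ne_zero hl
  have hd : ∀ x, HasDerivAt (fun x => g₁ x / f₁ x) 0 x := fun x => by
    refine ((hg.deriv_fst x).div (hf.deriv_fst x) (hne x)).congr_deriv ?_
    rw [div_eq_zero_iff]
    left
    linear_combination conj (q x) * hW x
  have hc : ∀ x y, g₁ x / f₁ x = g₁ y / f₁ y :=
    is_const_of_deriv_eq_zero (fun x => (hd x).differentiableAt) fun x => (hd x).deriv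
  have h1 : f₁ = g₁ := by
    ext x
    have : g₁ x / f₁ x = 1 := tendsto_nhds_unique (tendsto_const_nhds.congr fun y => hc x y)
      (by simpa using! hg.tendsto_fst.div hf.tendsto_fst one_ne_zero)
    rw [div_eq_one_iff_eq (hne x)] at this
    exact this.symm
  refine ⟨h1, ?_⟩
  ext x
  have := hW x
  rw [← h1] at this
  have h2 : f₁ x * (g₂ x - f₂ x) = 0 := by linear_combination this
  exact (sub_eq_zero.1 ((mul_eq_zero.1 h2).resolve_left (hne x))).symm

end IsNormalized

/-! ### The Riccati variable -/

/-- The normalized solution `(f₁, f₂)`; meaningful for `Im λ > 0`. -/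
def normJost (q : 𝓢(ℝ, ℂ)) (lam : ℂ) : (ℝ → ℂ) × (ℝ → ℂ) :=
  Classical.epsilon fun p => IsNormalized q lam p.1 p.2

/-- The ratio `r = f₂ / f₁` of the components of `j₋⁽¹⁾`, a solution of the Riccati equation
`r' = iλ r + ψ - ψ̄ r²`. -/
def ric (q : 𝓢(ℝ, ℂ)) (lam : ℂ) (x : ℝ) : ℂ := (normJost q lam).2 x / (normJost q lam).1 x

/-- `log f₁ = ∫_{-∞}^x ψ̄ r`. -/
def logJost (q : 𝓢(ℝ, ℂ)) (lam : ℂ) (x : ℝ) : ℂ := prim (fun y => conj (q y) * ric q lam y) x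

lemma continuous_conj_coe (q : 𝓢(ℝ, ℂ)) : Continuous fun y => conj (q y) :=
  Complex.continuous_conj.comp q.continuous

lemma integrable_conj_mul (q : 𝓢(ℝ, ℂ)) {g : ℝ → ℂ} {M : ℝ} (hg : Continuous g)
    (hM : ∀ x, ‖g x‖ ≤ M) : Integrable fun y => conj (q y) * g y := by
  refine ((integrable_norm q).mul_const M).mono'
    ((continuous_conj_coe q).mul hg).aestronglyMeasurable (Eventually.of_forall fun y => ?_)
  rw [norm_mul, RCLike.norm_conj]
  exact mul_le_mul_of_nonneg_left (hM y) (norm_nonneg _)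

section

variable (q : 𝓢(ℝ, ℂ)) {lam : ℂ} (hl : 0 < lam.im)

include hl

lemma isNormalized_normJost : IsNormalized q lam (normJost q lam).1 (normJost q lam).2 := by
  obtain ⟨f₁, f₂, h⟩ := exists_isNormalized q hl.le
  exact Classical.epsilon_spec (p := fun p : (ℝ → ℂ) × (ℝ → ℂ) => IsNormalized q lam p.1 p.2)
    ⟨(f₁, f₂), h⟩

lemma norm_ric_lt_one (x : ℝ) : ‖ric q lam x‖ < 1 := by
  have h := isNormalized_normJost q hl
  rw [ric, norm_div, div_lt_one (norm_pos_iff.2 (h.fst_ne_zero hl x))]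
  exact h.norm_snd_lt hl x

lemma hasDerivAt_ric (x : ℝ) : HasDerivAt (ric q lam)
    (Complex.I * lam * ric q lam x + q x - conj (q x) * ric q lam x ^ 2) x := by
  have h := isNormalized_normJost q hl
  have h0 := h.fst_ne_zero hl x
  refine ((h.deriv_snd x).div (h.deriv_fst x) h0).congr_deriv ?_
  rw [ric]
  field_simp
  ring

lemma continuous_ric : Continuous (ric q lam) :=
  continuous_iff_continuousAt.2 fun x => (hasDerivAt_ric q hl x).continuousAt

lemma integrable_conj_mul_ric : Integrable fun y => conj (q y) * ric q lam y :=
  integrable_conj_mul q (continuous_ric q hl) fun x => (norm_ric_lt_one q hl x).le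

lemma hasDerivAt_logJost (x : ℝ) :
    HasDerivAt (logJost q lam) (conj (q x) * ric q lam x) x :=
  hasDerivAt_prim ((continuous_conj_coe q).mul (continuous_ric q hl))
    (fun _ => (integrable_conj_mul_ric q hl).integrableOn) x

lemma tendsto_logJost_atBot : Tendsto (logJost q lam) atBot (𝓝 0) :=
  tendsto_prim_atBot (integrable_conj_mul_ric q hl)

lemma tendsto_logJost_atTop :
    Tendsto (logJost q lam) atTop (𝓝 (∫ y, conj (q y) * ric q lam y)) :=
  tendsto_prim_atTop (integrable_conj_mul_ric q hl)

lemma tendsto_ric_atBot : Tendsto (ric q lam) atBot (𝓝 0) := by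
  have h := isNormalized_normJost q hl
  simpa using! h.tendsto_snd.div h.tendsto_fst one_ne_zero

lemma normJost_fst (x : ℝ) : (normJost q lam).1 x = Complex.exp (logJost q lam x) := by
  have h := isNormalized_normJost q hl
  have hd : ∀ x, HasDerivAt (fun x => (normJost q lam).1 x * Complex.exp (-logJost q lam x)) 0 x :=
    fun x => by
      refine ((h.deriv_fst x).mul (hasDerivAt_logJost q hl x).neg.cexp).congr_deriv ?_
      rw [ric]
      have := h.fst_ne_zero hl x
      simp only [Pi.neg_apply]
      field_simp
      ring
  have hc := is_const_of_deriv_eq_zero (fun x => (hd x).differentiableAt) fun x => (hd x).deriv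
  have ht := h.tendsto_fst.mul (tendsto_logJost_atBot q hl).neg.cexp
  have h1 : (normJost q lam).1 x * Complex.exp (-logJost q lam x) = 1 :=
    tendsto_nhds_unique (tendsto_const_nhds.congr fun y => hc x y) (by simpa using ht)
  rw [Complex.exp_neg] at h1
  rwa [← div_eq_mul_inv, div_eq_one_iff_eq (Complex.exp_ne_zero _)] at h1

lemma normJost_snd (x : ℝ) :
    (normJost q lam).2 x = Complex.exp (logJost q lam x) * ric q lam x := by
  rw [ric, ← normJost_fst q hl, mul_div_cancel₀ _ ((isNormalized_normJost q hl).fst_ne_zero hl x)]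

end

/-! ### Jost columns and their symmetries -/

lemma isJostColumn_iff {l : Filter ℝ} {k : Fin 2} {ψ : 𝓢(ℝ, ℂ)} {lam : ℂ} {j : ℝ → Fin 2 → ℂ} :
    IsJostColumn l k ψ lam j ↔
      ((∀ x, HasDerivAt (fun x => j x 0)
          (-(Complex.I * lam / 2) * j x 0 + conj (ψ x) * j x 1) x) ∧
        ∀ x, HasDerivAt (fun x => j x 1) (ψ x * j x 0 + Complex.I * lam / 2 * j x 1) x) ∧
      Tendsto (fun x => (freeExp k lam x)⁻¹ * j x 0) l (𝓝 (Pi.single (M := fun _ => ℂ) k 1 0)) ∧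
      Tendsto (fun x => (freeExp k lam x)⁻¹ * j x 1) l (𝓝 (Pi.single (M := fun _ => ℂ) k 1 1)) := by
  simp only [IsJostColumn, hasDerivAt_pi, Fin.forall_fin_two, tendsto_pi_nhds, forall_and,
    Pi.smul_apply, smul_eq_mul]
  refine and_congr (and_congr (forall_congr' fun x => ?_) (forall_congr' fun x => ?_)) Iff.rfl
  · have : (matV ψ lam x).mulVec (j x) 0 = -(Complex.I * lam / 2) * j x 0 + conj (ψ x) * j x 1 := by
      simp [matV, matY, sigma3, Matrix.mulVec, dotProduct, Fin.sum_univ_two]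
    rw [this]
  · have : (matV ψ lam x).mulVec (j x) 1 = ψ x * j x 0 + Complex.I * lam / 2 * j x 1 := by
      simp [matV, matY, sigma3, Matrix.mulVec, dotProduct, Fin.sum_univ_two]
    rw [this]

lemma hasDerivAt_linear_phase (c : ℂ) (x : ℝ) : HasDerivAt (fun x : ℝ => c * x) c x := by
  refine (((hasDerivAt_id x).ofReal_comp).const_mul c).congr_deriv ?_
  simp

lemma IsJostColumn.isNormalized {ψ : 𝓢(ℝ, ℂ)} {lam : ℂ} {j : ℝ → Fin 2 → ℂ}
    (h : IsJostColumn atBot 0 ψ lam j) :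
    IsNormalized ψ lam (fun x => Complex.exp (Complex.I * lam / 2 * x) * j x 0)
      (fun x => Complex.exp (Complex.I * lam / 2 * x) * j x 1) := by
  obtain ⟨⟨h1, h2⟩, h3, h4⟩ := isJostColumn_iff.1 h
  have he : ∀ x : ℝ, (freeExp 0 lam x)⁻¹ = Complex.exp (Complex.I * lam / 2 * x) := fun x => by
    rw [freeExp, if_pos rfl, ← Complex.exp_neg]
    congr 1; ring
  simp only [he, Pi.single_eq_same] at h3 h4
  refine ⟨fun x => ?_, fun x => ?_, h3, by simpa using h4⟩
  · refine ((hasDerivAt_linear_phase (Complex.I * lam / 2) x).cexp.mul (h1 x)).congr_deriv ?_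
    ring
  · refine ((hasDerivAt_linear_phase (Complex.I * lam / 2) x).cexp.mul (h2 x)).congr_deriv ?_
    ring

lemma IsNormalized.isJostColumn {ψ : 𝓢(ℝ, ℂ)} {lam : ℂ} {f₁ f₂ : ℝ → ℂ}
    (h : IsNormalized ψ lam f₁ f₂) :
    IsJostColumn atBot 0 ψ lam fun x => ![Complex.exp (-(Complex.I * lam / 2) * x) * f₁ x,
      Complex.exp (-(Complex.I * lam / 2) * x) * f₂ x] := by
  have he : ∀ (x : ℝ) (z : ℂ), (freeExp 0 lam x)⁻¹ * (Complex.exp (-(Complex.I * lam / 2) * x) * z) = z :=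
    fun x z => by
      rw [freeExp, if_pos rfl, ← Complex.exp_neg, ← mul_assoc, ← Complex.exp_add]
      ring_nf
      simp
  rw [isJostColumn_iff]
  simp only [Matrix.cons_val_zero, Matrix.cons_val_one, he]
  refine ⟨⟨fun x => ?_, fun x => ?_⟩, by simpa using h.tendsto_fst, by simpa using h.tendsto_snd⟩
  · refine ((hasDerivAt_linear_phase (-(Complex.I * lam / 2)) x).cexp.mul (h.deriv_fst x)).congr_deriv ?_
    ring
  · refine ((hasDerivAt_linear_phase (-(Complex.I * lam / 2)) x).cexp.mul (h.deriv_snd x)).congr_deriv ?_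
    ring

/-- The reflected potential `x ↦ -conj (ψ (-x))`, which exchanges the two ends of the line. -/
def reflect : 𝓢(ℝ, ℂ) →ₗ[ℝ] 𝓢(ℝ, ℂ) :=
  -((SchwartzMap.postcompCLM (𝕜 := ℝ) (E := ℝ) (Complex.conjCLE : ℂ →L[ℝ] ℂ)).comp
    (SchwartzMap.compCLMOfContinuousLinearEquiv ℝ (ContinuousLinearEquiv.neg ℝ : ℝ ≃L[ℝ] ℝ))).toLinearMap

lemma reflect_apply (q : 𝓢(ℝ, ℂ)) (x : ℝ) : reflect q x = -conj (q (-x)) := rfl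

lemma reflect_reflect (q : 𝓢(ℝ, ℂ)) : reflect (reflect q) = q := by
  ext x
  simp [reflect_apply]

lemma IsJostColumn.reflect_atTop {q : 𝓢(ℝ, ℂ)} {lam : ℂ} {j : ℝ → Fin 2 → ℂ}
    (h : IsJostColumn atTop 1 q lam j) :
    IsJostColumn atBot 0 (reflect q) lam fun x => ![j (-x) 1, j (-x) 0] := by
  obtain ⟨⟨h1, h2⟩, h3, h4⟩ := isJostColumn_iff.1 h
  have he : ∀ x : ℝ, (freeExp 0 lam x)⁻¹ = (freeExp 1 lam (-x))⁻¹ := fun x => by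
    simp [freeExp]
    congr 1; ring
  rw [isJostColumn_iff]
  simp only [Matrix.cons_val_zero, Matrix.cons_val_one, he]
  refine ⟨⟨fun x => ?_, fun x => ?_⟩, ?_, ?_⟩
  · refine ((h2 (-x)).scomp x (hasDerivAt_neg x)).congr_deriv ?_
    simp [reflect_apply]
    ring
  · refine ((h1 (-x)).scomp x (hasDerivAt_neg x)).congr_deriv ?_
    simp [reflect_apply]
    ring
  · simpa using! h4.comp tendsto_neg_atBot_atTop
  · simpa using! h3.comp tendsto_neg_atBot_atTop

lemma IsJostColumn.reflect_atBot {q : 𝓢(ℝ, ℂ)} {lam : ℂ} {j : ℝ → Fin 2 → ℂ}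
    (h : IsJostColumn atBot 0 q lam j) :
    IsJostColumn atTop 1 (reflect q) lam fun x => ![j (-x) 1, j (-x) 0] := by
  obtain ⟨⟨h1, h2⟩, h3, h4⟩ := isJostColumn_iff.1 h
  have he : ∀ x : ℝ, (freeExp 1 lam x)⁻¹ = (freeExp 0 lam (-x))⁻¹ := fun x => by
    simp [freeExp]
    congr 1; ring
  rw [isJostColumn_iff]
  simp only [Matrix.cons_val_zero, Matrix.cons_val_one, he]
  refine ⟨⟨fun x => ?_, fun x => ?_⟩, ?_, ?_⟩
  · refine ((h2 (-x)).scomp x (hasDerivAt_neg x)).congr_deriv ?_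
    simp [reflect_apply]
    ring
  · refine ((h1 (-x)).scomp x (hasDerivAt_neg x)).congr_deriv ?_
    simp [reflect_apply]
    ring
  · simpa using! h4.comp tendsto_neg_atTop_atBot
  · simpa using! h3.comp tendsto_neg_atTop_atBot

/-- The symmetry `V(λ) = σ₁ conj(V(conj λ)) σ₁`, on vectors. -/
def conjSwap (v : Fin 2 → ℂ) : Fin 2 → ℂ := ![conj (v 1), conj (v 0)]

lemma conjSwap_conjSwap (v : Fin 2 → ℂ) : conjSwap (conjSwap v) = v := by
  ext i
  fin_cases i <;> simp [conjSwap]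

lemma IsJostColumn.conjSwap {l : Filter ℝ} {k : Fin 2} {q : 𝓢(ℝ, ℂ)} {lam : ℂ} {j : ℝ → Fin 2 → ℂ}
    (h : IsJostColumn l k q lam j) :
    IsJostColumn l (1 - k) q (conj lam) fun x => conjSwap (j x) := by
  obtain ⟨⟨h1, h2⟩, h3, h4⟩ := isJostColumn_iff.1 h
  have he : ∀ x : ℝ, (freeExp (1 - k) (conj lam) x)⁻¹ = conj (freeExp k lam x)⁻¹ := fun x => by
    have h2 : conj (2 : ℂ) = 2 := map_ofNat _ 2
    fin_cases k <;> simp [freeExp, ← Complex.exp_conj, h2] <;> ring_nf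
  rw [isJostColumn_iff]
  simp only [NLSScattering.conjSwap, Matrix.cons_val_zero, Matrix.cons_val_one, he, ← map_mul]
  refine ⟨⟨fun x => ?_, fun x => ?_⟩, ?_, ?_⟩
  · refine (h2 x).star.congr_deriv ?_
    simp
    ring
  · refine (h1 x).star.congr_deriv ?_
    simp
    ring
  · refine ((Complex.continuous_conj.tendsto _).comp h4).congr' ?_ |>.trans ?_
    · exact EventuallyEq.rfl
    · fin_cases k <;> simp
  · refine ((Complex.continuous_conj.tendsto _).comp h3).congr' ?_ |>.trans ?_
    · exact EventuallyEq.rfl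
    · fin_cases k <;> simp

lemma IsJostColumn.unique_atBot {q : 𝓢(ℝ, ℂ)} {lam : ℂ} (hl : 0 < lam.im) {j j' : ℝ → Fin 2 → ℂ}
    (h : IsJostColumn atBot 0 q lam j) (h' : IsJostColumn atBot 0 q lam j') : j = j' := by
  obtain ⟨e1, e2⟩ := h.isNormalized.unique h'.isNormalized hl
  ext x i
  fin_cases i
  · exact mul_left_cancel₀ (Complex.exp_ne_zero _) (congrFun e1 x)
  · exact mul_left_cancel₀ (Complex.exp_ne_zero _) (congrFun e2 x)

lemma existsUnique_jostColumn_atBot (q : 𝓢(ℝ, ℂ)) {lam : ℂ} (hl : 0 < lam.im) :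
    ∃! j, IsJostColumn atBot 0 q lam j :=
  ⟨_, (isNormalized_normJost q hl).isJostColumn, fun _ h =>
    h.unique_atBot hl (isNormalized_normJost q hl).isJostColumn⟩

lemma existsUnique_jostColumn_atTop (q : 𝓢(ℝ, ℂ)) {lam : ℂ} (hl : 0 < lam.im) :
    ∃! j, IsJostColumn atTop 1 q lam j := by
  obtain ⟨g, hg, -⟩ := existsUnique_jostColumn_atBot (reflect q) hl
  have hg' := hg.reflect_atBot
  rw [reflect_reflect] at hg'
  refine ⟨_, hg', fun j hj => ?_⟩
  have := hj.reflect_atTop.unique_atBot hl hg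
  ext x i
  fin_cases i
  · simpa using congrFun (congrFun this (-x)) 1
  · simpa using congrFun (congrFun this (-x)) 0

/-- Existence and uniqueness at `λ` from the same at `conj λ`, for the other column. -/
lemma existsUnique_jostColumn_conj {l : Filter ℝ} {k : Fin 2} {q : 𝓢(ℝ, ℂ)} {lam : ℂ}
    (h : ∃! j, IsJostColumn l k q (conj lam) j) : ∃! j, IsJostColumn l (1 - k) q lam j := by
  obtain ⟨g, hg, hu⟩ := h
  have hg' := hg.conjSwap
  rw [Complex.conj_conj] at hg'
  refine ⟨_, hg', fun j hj => ?_⟩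
  have h2 := hj.conjSwap
  rw [sub_sub_cancel] at h2
  have := hu _ h2
  ext1 x
  rw [← this]
  exact (conjSwap_conjSwap (j x)).symm

lemma jostColumn_eq {l : Filter ℝ} {k : Fin 2} {q : 𝓢(ℝ, ℂ)} {lam : ℂ} {j : ℝ → Fin 2 → ℂ}
    (h : ∃! j, IsJostColumn l k q lam j) (hj : IsJostColumn l k q lam j) :
    jostColumn l k q lam = j :=
  h.unique (Classical.epsilon_spec h.exists) hj

lemma jostColumn_conj {l : Filter ℝ} {k : Fin 2} {q : 𝓢(ℝ, ℂ)} {lam : ℂ}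
    (h : ∃! j, IsJostColumn l k q (conj lam) j) (x : ℝ) :
    jostColumn l (1 - k) q lam x = conjSwap (jostColumn l k q (conj lam) x) := by
  have h1 : IsJostColumn l k q (conj lam) (jostColumn l k q (conj lam)) :=
    Classical.epsilon_spec h.exists
  have h2 := h1.conjSwap
  rw [Complex.conj_conj] at h2
  rw [jostColumn_eq (existsUnique_jostColumn_conj h) h2]

lemma jostColumn_atBot (q : 𝓢(ℝ, ℂ)) {lam : ℂ} (hl : 0 < lam.im) (x : ℝ) :
    jostColumn atBot 0 q lam x =
      ![Complex.exp (-(Complex.I * lam / 2) * x) * Complex.exp (logJost q lam x),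
        Complex.exp (-(Complex.I * lam / 2) * x) * (Complex.exp (logJost q lam x) * ric q lam x)] := by
  rw [jostColumn_eq (existsUnique_jostColumn_atBot q hl) (isNormalized_normJost q hl).isJostColumn]
  simp only [normJost_fst q hl, normJost_snd q hl]

lemma jostColumn_atTop (q : 𝓢(ℝ, ℂ)) {lam : ℂ} (hl : 0 < lam.im) (x : ℝ) :
    jostColumn atTop 1 q lam x =
      ![Complex.exp (Complex.I * lam / 2 * x) *
          (Complex.exp (logJost (reflect q) lam (-x)) * ric (reflect q) lam (-x)),
        Complex.exp (Complex.I * lam / 2 * x) * Complex.exp (logJost (reflect q) lam (-x))] := by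
  have h := (isNormalized_normJost (reflect q) hl).isJostColumn.reflect_atBot
  rw [reflect_reflect] at h
  rw [jostColumn_eq (existsUnique_jostColumn_atTop q hl) h]
  simp [normJost_fst _ hl, normJost_snd _ hl]

/-! ### The coefficient `a` -/

/-- `1 - r s`, where `s` is the ratio of the components of `j₊⁽²⁾`, which is obtained from `r` by
reflection. This is the determinant of `H₊` up to exponential factors. -/
def gap (q : 𝓢(ℝ, ℂ)) (lam : ℂ) (x : ℝ) : ℂ := 1 - ric q lam x * ric (reflect q) lam (-x)

section

variable (q : 𝓢(ℝ, ℂ)) {lam : ℂ} (hl : 0 < lam.im)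

include hl

lemma gap_ne_zero (x : ℝ) : gap q lam x ≠ 0 := by
  have h1 := norm_ric_lt_one q hl x
  have h2 := norm_ric_lt_one (reflect q) hl (-x)
  intro h
  rw [gap, sub_eq_zero] at h
  have h3 : ‖ric q lam x * ric (reflect q) lam (-x)‖ < 1 := by
    rw [norm_mul]
    exact mul_lt_one_of_nonneg_of_lt_one_left (norm_nonneg _) h1 h2.le
  rw [← h, norm_one] at h3
  exact lt_irrefl _ h3

lemma hasDerivAt_ric_reflect (x : ℝ) : HasDerivAt (fun x => ric (reflect q) lam (-x))
    (-(Complex.I * lam * ric (reflect q) lam (-x)) + conj (q x)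
      - q x * ric (reflect q) lam (-x) ^ 2) x := by
  refine ((hasDerivAt_ric (reflect q) hl (-x)).scomp x (hasDerivAt_neg x)).congr_deriv ?_
  simp [reflect_apply]
  ring

lemma hasDerivAt_logJost_reflect (x : ℝ) : HasDerivAt (fun x => logJost (reflect q) lam (-x))
    (q x * ric (reflect q) lam (-x)) x := by
  refine ((hasDerivAt_logJost (reflect q) hl (-x)).scomp x (hasDerivAt_neg x)).congr_deriv ?_
  simp [reflect_apply]

/-- The Wronskian of `j₋⁽¹⁾` and `j₊⁽²⁾` does not depend on `x`; the right-hand side is its limit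
at `+∞`. -/
lemma exp_logJost_mul_gap (x : ℝ) :
    Complex.exp (logJost q lam x + logJost (reflect q) lam (-x)) * gap q lam x =
      Complex.exp (∫ y, conj (q y) * ric q lam y) := by
  have hd : ∀ x, HasDerivAt (fun x => Complex.exp (logJost q lam x + logJost (reflect q) lam (-x)) * gap q lam x) 0 x := fun x => by
    refine (((hasDerivAt_logJost q hl x).add (hasDerivAt_logJost_reflect q hl x)).cexp.mul
      (((hasDerivAt_ric q hl x).mul (hasDerivAt_ric_reflect q hl x)).const_sub 1)).congr_deriv ?_
    simp only [Pi.add_apply, Pi.mul_apply]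
    ring
  have hc := is_const_of_deriv_eq_zero (fun x => (hd x).differentiableAt) fun x => (hd x).deriv
  have h1 := (tendsto_logJost_atTop q hl).add ((tendsto_logJost_atBot (reflect q) hl).comp tendsto_neg_atTop_atBot)
  have h2 : Tendsto (fun x => ric q lam x * ric (reflect q) lam (-x)) atTop (𝓝 0) := by
    refine squeeze_zero_norm (a := fun x => ‖ric (reflect q) lam (-x)‖) (fun x => ?_) ?_
    · rw [norm_mul]
      exact mul_le_of_le_one_left (norm_nonneg _) (norm_ric_lt_one q hl x).le
    · simpa using! ((tendsto_ric_atBot (reflect q) hl).comp tendsto_neg_atTop_atBot).norm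
  have h3 := h1.cexp.mul (h2.const_sub 1)
  rw [add_zero, sub_zero, mul_one] at h3
  exact tendsto_nhds_unique (tendsto_const_nhds.congr fun y => hc x y) h3

lemma coeffA_eq : coeffA lam q = Complex.exp (∫ y, conj (q y) * ric q lam y) := by
  rw [← exp_logJost_mul_gap q hl 0, coeffA, jostColumn_atBot q hl, jostColumn_atTop q hl]
  simp [dotProduct, Matrix.mulVec, matJ, Fin.sum_univ_two, gap, Complex.exp_add]
  ring

end

/-! ### Differentiation of the Riccati variable -/

/-- The coefficient `-2 ψ̄ r` of the Riccati equation linearized at `r`. -/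
def ricCoeff (q : 𝓢(ℝ, ℂ)) (lam : ℂ) (x : ℝ) : ℂ := conj (q x) * (-2 * ric q lam x)

/-- The variation `δr` of `r` in the direction `v`: the bounded solution of the Riccati equation
linearized at `r`, with the source `v - v̄ r²`. -/
def dRic (q v : 𝓢(ℝ, ℂ)) (lam : ℂ) : ℝ → ℂ :=
  linSol lam (ricCoeff q lam) fun y => v y - conj (v y) * ric q lam y ^ 2

/-- The variation of `log f₁ = ∫_{-∞}^x ψ̄ r` in the direction `v`. -/
def dLog (q v : 𝓢(ℝ, ℂ)) (lam : ℂ) : ℝ → ℂ :=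
  prim fun y => conj (v y) * ric q lam y + conj (q y) * dRic q v lam y

lemma integral_norm_conj_mul_le (q : 𝓢(ℝ, ℂ)) {g : ℝ → ℂ} {M : ℝ} (hg : Continuous g)
    (hM : ∀ x, ‖g x‖ ≤ M) : ∫ x, ‖conj (q x) * g x‖ ≤ (∫ x, ‖q x‖) * M := by
  rw [← integral_mul_const]
  refine integral_mono (integrable_conj_mul q hg hM).norm ((integrable_norm q).mul_const M) fun x => ?_
  simp only [norm_mul, RCLike.norm_conj]
  exact mul_le_mul_of_nonneg_left (hM x) (norm_nonneg _)

/-- Difference quotients of solutions of Riccati equations. The difference `e = r_i - r` solves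
the linear equation `e' = (iλ - ψ̄ (r_i + r)) e + τ_i R_i`, and `τ_i` is the increment of the
parameter. The limit `R₀` of the `R_i` is required only once `r_i → r` is known, since `R_i` may
depend on `r_i`. -/
lemma ric_difference_quotient {ι : Type*} {l : Filter ι} [l.IsCountablyGenerated] (q : 𝓢(ℝ, ℂ))
    {lam : ℂ} (hl : 0 < lam.im) {r R : ι → ℝ → ℂ} {R₀ : ℝ → ℂ} {τ : ι → ℂ} {M : ℝ}
    (hr : ∀ᶠ i in l, Continuous (r i) ∧ ∀ x, ‖r i x‖ ≤ 1)
    (hR : ∀ᶠ i in l, Continuous (R i) ∧ ∀ x, ‖R i x‖ ≤ M)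
    (hd : ∀ᶠ i in l, ∀ x, HasDerivAt (fun x => r i x - ric q lam x)
      ((Complex.I * lam - conj (q x) * (r i x + ric q lam x)) * (r i x - ric q lam x)
        + τ i * R i x) x)
    (hτ : Tendsto τ l (𝓝 0))
    (hRt : (∀ x, Tendsto (fun i => r i x) l (𝓝 (ric q lam x))) →
      ∀ x, Tendsto (fun i => R i x) l (𝓝 (R₀ x))) :
    (∀ x, Tendsto (fun i => r i x) l (𝓝 (ric q lam x))) ∧
    ∃ E : ι → ℝ → ℂ, ∃ C : ℝ,
      (∀ᶠ i in l, Continuous (E i) ∧ (∀ x, r i x - ric q lam x = τ i * E i x) ∧ ∀ x, ‖E i x‖ ≤ C) ∧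
      ∀ x, Tendsto (fun i => E i x) l (𝓝 (linSol lam (ricCoeff q lam) R₀ x)) := by
  set b : ι → ℝ → ℂ := fun i x => conj (q x) * (-(r i x + ric q lam x)) with hb
  have hrc := continuous_ric q hl
  have hrn := fun x => (norm_ric_lt_one q hl x).le
  have hbc : ∀ᶠ i in l, Continuous (b i) ∧ (∀ x, ‖-(r i x + ric q lam x)‖ ≤ 2) ∧
      Continuous fun x => -(r i x + ric q lam x) := by
    filter_upwards [hr] with i ⟨h1, h2⟩
    refine ⟨(continuous_conj_coe q).mul (h1.add hrc).neg, fun x => ?_, (h1.add hrc).neg⟩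
    rw [norm_neg]
    refine (norm_add_le _ _).trans ?_
    linarith [h2 x, hrn x]
  have hkey : ∀ᶠ i in l, Continuous (linSol lam (b i) (R i)) ∧
      (∀ x, r i x - ric q lam x = τ i * linSol lam (b i) (R i) x) ∧
      ∀ x, ‖linSol lam (b i) (R i) x‖ ≤ Real.exp ((∫ x, ‖q x‖) * 2) * M / lam.im := by
    filter_upwards [hr, hbc, hR, hd] with i ⟨h1, h2⟩ ⟨h3, h4, h5⟩ ⟨h6, h7⟩ h8
    have hbi : Integrable (b i) := integrable_conj_mul q h5 h4
    have hadm : Admissible lam (R i) := ⟨h6, Or.inl ⟨hl, M, h7⟩⟩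
    refine ⟨continuous_linSol h3 hbi hadm, fun x => ?_, fun x =>
      norm_linSol_le_div hl hbi (integral_norm_conj_mul_le q h5 h4) h7 x⟩
    have hadm' : Admissible lam fun x => τ i * R i x :=
      ⟨continuous_const.mul h6, Or.inl ⟨hl, ‖τ i‖ * M, fun x => by
        rw [norm_mul]
        exact mul_le_mul_of_nonneg_left (h7 x) (norm_nonneg _)⟩⟩
    have := eq_linSol (e := fun x => r i x - ric q lam x) hl h3 hbi hadm' (fun x => (h8 x).congr_deriv (by
      simp only [hb]
      ring)) 2 (fun x => (norm_sub_le _ _).trans (by linarith [h2 x, hrn x]))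
    rw [congrFun this x, linSol, linSol, ← integral_const_mul]
    congr 1
    ext y
    ring
  have hlim : ∀ x, Tendsto (fun i => r i x) l (𝓝 (ric q lam x)) := fun x => by
    rw [tendsto_iff_norm_sub_tendsto_zero]
    have h0 : Tendsto (fun i => ‖τ i‖ * (Real.exp ((∫ x, ‖q x‖) * 2) * M / lam.im)) l (𝓝 0) := by
      simpa using hτ.norm.mul_const (Real.exp ((∫ x, ‖q x‖) * 2) * M / lam.im)
    refine squeeze_zero' (Eventually.of_forall fun i => norm_nonneg _) ?_ h0
    filter_upwards [hkey] with i h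
    rw [h.2.1 x, norm_mul]
    exact mul_le_mul_of_nonneg_left (h.2.2 x) (norm_nonneg _)
  refine ⟨hlim, fun i => linSol lam (b i) (R i), _, hkey, fun x => ?_⟩
  refine tendsto_linSol hl (hbc.mono fun i h => h.1) ((integrable_norm q).mul_const 2) ?_
    (hR.mono fun i h => h.1) (hR.mono fun i h => h.2) (fun x => ?_) (hRt hlim) x
  · filter_upwards [hbc] with i h x
    simp only [hb, norm_mul, RCLike.norm_conj]
    exact mul_le_mul_of_nonneg_left (h.2.1 x) (norm_nonneg _)
  · have := ((hlim x).add_const (ric q lam x)).neg.const_mul (conj (q x))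
    refine this.congr' EventuallyEq.rfl |>.trans (le_of_eq ?_)
    simp only [ricCoeff]
    ring_nf

section

variable (q v : 𝓢(ℝ, ℂ)) {lam : ℂ} (hl : 0 < lam.im)

include hl

lemma continuous_dRic_source : Continuous fun y => v y - conj (v y) * ric q lam y ^ 2 :=
  v.continuous.sub ((continuous_conj_coe v).mul ((continuous_ric q hl).pow 2))

lemma norm_dRic_source_le (x : ℝ) : ‖v x - conj (v x) * ric q lam x ^ 2‖ ≤ 2 * ‖v x‖ := by
  refine (norm_sub_le _ _).trans ?_
  rw [norm_mul, norm_pow, RCLike.norm_conj]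
  have := pow_le_one₀ (n := 2) (norm_nonneg _) (norm_ric_lt_one q hl x).le
  nlinarith [norm_nonneg (v x)]

lemma admissible_dRic_source : Admissible lam fun y => v y - conj (v y) * ric q lam y ^ 2 :=
  ⟨continuous_dRic_source q v hl, Or.inr ⟨hl.le, ((integrable_norm v).const_mul 2).mono'
    (continuous_dRic_source q v hl).aestronglyMeasurable
    (Eventually.of_forall fun x => norm_dRic_source_le q v hl x)⟩⟩

lemma continuous_ricCoeff : Continuous (ricCoeff q lam) :=
  (continuous_conj_coe q).mul (continuous_const.mul (continuous_ric q hl))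

lemma norm_neg_two_mul_ric_le (x : ℝ) : ‖-2 * ric q lam x‖ ≤ 2 := by
  have := (norm_ric_lt_one q hl x).le
  simp only [norm_mul, norm_neg, Complex.norm_ofNat]
  linarith

lemma integrable_ricCoeff : Integrable (ricCoeff q lam) :=
  integrable_conj_mul q (continuous_const.mul (continuous_ric q hl)) (norm_neg_two_mul_ric_le q hl)

lemma integral_norm_ricCoeff_le : ∫ x, ‖ricCoeff q lam x‖ ≤ (∫ x, ‖q x‖) * 2 :=
  integral_norm_conj_mul_le q (continuous_const.mul (continuous_ric q hl))
    (norm_neg_two_mul_ric_le q hl)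

lemma hasDerivAt_dRic (x : ℝ) : HasDerivAt (dRic q v lam)
    ((Complex.I * lam - 2 * conj (q x) * ric q lam x) * dRic q v lam x
      + (v x - conj (v x) * ric q lam x ^ 2)) x := by
  refine (hasDerivAt_linSol (continuous_ricCoeff q hl) (integrable_ricCoeff q hl)
    (admissible_dRic_source q v hl) x).congr_deriv ?_
  rw [dRic, ricCoeff]
  ring

lemma continuous_dRic : Continuous (dRic q v lam) :=
  continuous_iff_continuousAt.2 fun x => (hasDerivAt_dRic q v hl x).continuousAt

lemma exists_norm_dRic_le : ∃ C, ∀ x, ‖dRic q v lam x‖ ≤ C :=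
  ⟨_, norm_linSol_le_integral hl.le (integrable_ricCoeff q hl) le_rfl
    ((integrable_norm v).const_mul 2) (norm_dRic_source_le q v hl)⟩

lemma continuous_dLog_integrand :
    Continuous fun y => conj (v y) * ric q lam y + conj (q y) * dRic q v lam y :=
  ((continuous_conj_coe v).mul (continuous_ric q hl)).add
    ((continuous_conj_coe q).mul (continuous_dRic q v hl))

lemma integrable_dLog_integrand :
    Integrable fun y => conj (v y) * ric q lam y + conj (q y) * dRic q v lam y := by
  obtain ⟨C, hC⟩ := exists_norm_dRic_le q v hl
  exact (integrable_conj_mul v (continuous_ric q hl) fun x => (norm_ric_lt_one q hl x).le).add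
    (integrable_conj_mul q (continuous_dRic q v hl) hC)

lemma continuous_dLog : Continuous (dLog q v lam) :=
  continuous_prim (continuous_dLog_integrand q v hl) (integrable_dLog_integrand q v hl)

lemma ric_difference_quotient_potential :
    (∀ x, Tendsto (fun t : ℝ => ric (q + t • v) lam x) (𝓝[≠] 0) (𝓝 (ric q lam x))) ∧
    ∃ E : ℝ → ℝ → ℂ, ∃ C : ℝ,
      (∀ᶠ t in 𝓝[≠] (0 : ℝ), Continuous (E t) ∧
        (∀ x, ric (q + t • v) lam x - ric q lam x = t * E t x) ∧ ∀ x, ‖E t x‖ ≤ C) ∧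
      ∀ x, Tendsto (fun t => E t x) (𝓝[≠] 0) (𝓝 (dRic q v lam x)) := by
  obtain ⟨M, hM0, hM⟩ := exists_norm_le v
  refine ric_difference_quotient q hl (r := fun t : ℝ => ric (q + t • v) lam)
    (R := fun t y => v y - conj (v y) * ric (q + t • v) lam y ^ 2) (τ := fun t : ℝ => (t : ℂ))
    (M := 2 * M) ?_ ?_ ?_ ?_ ?_
  · exact Eventually.of_forall fun t =>
      ⟨continuous_ric _ hl, fun x => (norm_ric_lt_one _ hl x).le⟩
  · refine Eventually.of_forall fun t => ⟨continuous_dRic_source _ v hl, fun x => ?_⟩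
    exact (norm_dRic_source_le _ v hl x).trans (by linarith [hM x])
  · refine Eventually.of_forall fun t x => ?_
    refine ((hasDerivAt_ric (q + t • v) hl x).sub (hasDerivAt_ric q hl x)).congr_deriv ?_
    simp
    ring
  · have : Tendsto (fun t : ℝ => (t : ℂ)) (𝓝 0) (𝓝 0) := by
      simpa using Complex.continuous_ofReal.tendsto 0
    exact this.mono_left nhdsWithin_le_nhds
  · intro h x
    exact (((h x).pow 2).const_mul _).const_sub _

lemma hasLineDerivAt_ric (x : ℝ) :
    HasLineDerivAt ℝ (fun φ => ric φ lam x) (dRic q v lam x) q v := by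
  obtain ⟨-, E, C, h1, h2⟩ := ric_difference_quotient_potential q v hl
  rw [HasLineDerivAt, hasDerivAt_iff_tendsto_slope_zero]
  refine (h2 x).congr' ?_
  filter_upwards [h1, self_mem_nhdsWithin] with t ht ht0
  have ht0' : (t : ℂ) ≠ 0 := Complex.ofReal_ne_zero.2 ht0
  simp [ht.2.1 x, ht0']

lemma hasLineDerivAt_logJost (x : ℝ) :
    HasLineDerivAt ℝ (fun φ => logJost φ lam x) (dLog q v lam x) q v := by
  obtain ⟨h0, E, C, h1, h2⟩ := ric_difference_quotient_potential q v hl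
  rw [HasLineDerivAt, hasDerivAt_iff_tendsto_slope_zero]
  have key : Tendsto (fun t : ℝ => prim (fun y => conj (v y) * ric (q + t • v) lam y + conj (q y) * E t y) x)
      (𝓝[≠] 0) (𝓝 (dLog q v lam x)) := by
    refine tendsto_integral_filter_of_dominated_convergence (fun y => ‖v y‖ * 1 + ‖q y‖ * C) ?_ ?_
      (((integrable_norm v).mul_const 1).add ((integrable_norm q).mul_const C)).integrableOn
      (Eventually.of_forall fun y => ((h0 y).const_mul _).add ((h2 y).const_mul _))
    · filter_upwards [h1] with t ht
      exact (((continuous_conj_coe v).mul (continuous_ric _ hl)).add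
        ((continuous_conj_coe q).mul ht.1)).aestronglyMeasurable
    · filter_upwards [h1] with t ht
      refine Eventually.of_forall fun y => (norm_add_le _ _).trans ?_
      rw [norm_mul, norm_mul, RCLike.norm_conj, RCLike.norm_conj]
      have := ht.2.2 y
      have := (norm_ric_lt_one (q + t • v) hl y).le
      gcongr
  refine key.congr' ?_
  filter_upwards [h1, self_mem_nhdsWithin] with t ht ht0
  have ht0' : (t : ℂ) ≠ 0 := Complex.ofReal_ne_zero.2 ht0
  simp only [zero_add, zero_smul, add_zero, logJost, prim]
  rw [← integral_sub (integrable_conj_mul_ric _ hl).integrableOn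
    (integrable_conj_mul_ric _ hl).integrableOn, ← integral_smul]
  congr 1
  ext y
  have h3 : ric (q + t • v) lam y = ric q lam y + t * E t y := by rw [← ht.2.1 y]; ring
  simp only [h3, add_apply, smul_apply, Complex.real_smul, map_add, map_mul,
    Complex.conj_ofReal, Complex.ofReal_inv]
  field_simp
  ring

end

/-! ### Analyticity in `λ` -/

/-- The logarithm `∫ ψ̄ r` of `a`. -/
def logA (q : 𝓢(ℝ, ℂ)) (lam : ℂ) : ℂ := ∫ y, conj (q y) * ric q lam y

lemma differentiableAt_logA (q : 𝓢(ℝ, ℂ)) {lam : ℂ} (hl : 0 < lam.im) :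
    DifferentiableAt ℂ (logA q) lam := by
  have hpos : ∀ᶠ t in 𝓝[≠] (0 : ℂ), 0 < (lam + t).im := by
    have : Tendsto (fun t : ℂ => (lam + t).im) (𝓝 0) (𝓝 lam.im) := by
      have h : Continuous fun t : ℂ => (lam + t).im := by fun_prop
      simpa using h.tendsto 0
    exact (this.mono_left nhdsWithin_le_nhds).eventually (lt_mem_nhds hl)
  obtain ⟨h0, E, C, h1, h2⟩ := ric_difference_quotient q hl (l := 𝓝[≠] (0 : ℂ))
    (r := fun t => ric q (lam + t)) (R := fun t y => Complex.I * ric q (lam + t) y) (τ := fun t => t)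
    (R₀ := fun y => Complex.I * ric q lam y) (M := 1)
    (hpos.mono fun t ht => ⟨continuous_ric _ ht, fun x => (norm_ric_lt_one _ ht x).le⟩)
    (hpos.mono fun t ht => ⟨continuous_const.mul (continuous_ric _ ht), fun x => by
      simpa using (norm_ric_lt_one _ ht x).le⟩)
    (hpos.mono fun t ht x => by
      refine ((hasDerivAt_ric q ht x).sub (hasDerivAt_ric q hl x)).congr_deriv ?_
      ring)
    (tendsto_id.mono_left nhdsWithin_le_nhds)
    (fun h x => (h x).const_mul _)
  refine HasDerivAt.differentiableAt (f' := ∫ y, conj (q y) * linSol lam (ricCoeff q lam) (fun y => Complex.I * ric q lam y) y) ?_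
  rw [hasDerivAt_iff_tendsto_slope_zero]
  have key : Tendsto (fun t : ℂ => ∫ y, conj (q y) * E t y) (𝓝[≠] 0)
      (𝓝 (∫ y, conj (q y) * linSol lam (ricCoeff q lam) (fun y => Complex.I * ric q lam y) y)) := by
    refine tendsto_integral_filter_of_dominated_convergence (fun y => ‖q y‖ * C) ?_ ?_
      ((integrable_norm q).mul_const C) (Eventually.of_forall fun y => (h2 y).const_mul _)
    · filter_upwards [h1] with t ht
      exact ((continuous_conj_coe q).mul ht.1).aestronglyMeasurable
    · filter_upwards [h1] with t ht
      refine Eventually.of_forall fun y => ?_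
      rw [norm_mul, RCLike.norm_conj]
      exact mul_le_mul_of_nonneg_left (ht.2.2 y) (norm_nonneg _)
  refine key.congr' ?_
  filter_upwards [h1, hpos, self_mem_nhdsWithin] with t ht htp ht0
  have ht0' : t ≠ 0 := ht0
  rw [logA, logA, ← integral_sub (integrable_conj_mul_ric _ htp) (integrable_conj_mul_ric _ hl),
    ← integral_smul]
  congr 1
  ext y
  rw [← mul_sub, ht.2.1 y, smul_eq_mul]
  field_simp

/-! ### The Krichever–Phong density in terms of the Riccati variables -/

/-- The entry `21` of `δH₊ H₊⁻¹`. -/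
def varLower (q v : 𝓢(ℝ, ℂ)) (lam : ℂ) (x : ℝ) : ℂ :=
  (dLog q v lam x * ric q lam x + dRic q v lam x
    - ric q lam x * dLog (reflect q) (reflect v) lam (-x)) / gap q lam x

/-- The entry `12` of `δH₊ H₊⁻¹`. -/
def varUpper (q v : 𝓢(ℝ, ℂ)) (lam : ℂ) (x : ℝ) : ℂ :=
  (dRic (reflect q) (reflect v) lam (-x) + ric (reflect q) lam (-x) *
    (dLog (reflect q) (reflect v) lam (-x) - dLog q v lam x)) / gap q lam x

/-- The density `tr (δV(u) δ_vH H⁻¹ - δV(v) δ_uH H⁻¹)`; only off-diagonal entries enter. -/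
def redDensity (q u v : 𝓢(ℝ, ℂ)) (lam : ℂ) (x : ℝ) : ℂ :=
  conj (u x) * varLower q v lam x + u x * varUpper q v lam x
    - (conj (v x) * varLower q u lam x + v x * varUpper q u lam x)

lemma trace_dualMat_mul (α : ℂ) (H D : Mat) (u : 𝓢(ℝ, ℂ)) (x : ℝ) :
    Matrix.trace (dualMat α H * matJ * deltaV u x * D) =
      α⁻¹ * (conj (u x) * (H 1 1 * D 1 0 - H 1 0 * D 1 1)
        + u x * (H 0 0 * D 0 1 - H 0 1 * D 0 0)) := by
  rw [Matrix.eta_fin_two H, Matrix.eta_fin_two D]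
  simp only [Matrix.trace, dualMat, sigma3, sigma1, matJ, deltaV, matY, Matrix.of_apply,
    Matrix.mul_apply, Fin.sum_univ_two, Matrix.transpose_apply, Matrix.neg_apply, Matrix.smul_apply,
    Matrix.diag_apply, Matrix.cons_val', Matrix.cons_val_zero, Matrix.cons_val_one, smul_eq_mul,
    Matrix.cons_val_fin_one]
  ring

lemma hasLineDerivAt_comp_reflect {F : 𝓢(ℝ, ℂ) → ℂ} {F' : ℂ} {q v : 𝓢(ℝ, ℂ)}
    (h : HasLineDerivAt ℝ F F' (reflect q) (reflect v)) :
    HasLineDerivAt ℝ (fun φ => F (reflect φ)) F' q v := by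
  simpa [HasLineDerivAt, map_add, map_smul] using h

section

variable (q : 𝓢(ℝ, ℂ)) {lam : ℂ} (hl : 0 < lam.im)

include hl

lemma Hplus_eq (x : ℝ) : Hplus lam q x =
    !![Complex.exp (-(Complex.I * lam / 2) * x) * Complex.exp (logJost q lam x),
      Complex.exp (Complex.I * lam / 2 * x) *
        (Complex.exp (logJost (reflect q) lam (-x)) * ric (reflect q) lam (-x));
      Complex.exp (-(Complex.I * lam / 2) * x) * (Complex.exp (logJost q lam x) * ric q lam x),
      Complex.exp (Complex.I * lam / 2 * x) * Complex.exp (logJost (reflect q) lam (-x))] := by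
  rw [Hplus, jostColumn_atBot q hl, jostColumn_atTop q hl]
  simp [ofColumns]

/-- The variation of `H₊`. -/
lemma hasLineDerivAt_Hplus (v : 𝓢(ℝ, ℂ)) (x : ℝ) (i k : Fin 2) :
    HasLineDerivAt ℝ (fun φ => Hplus lam φ x i k)
      ((!![Complex.exp (-(Complex.I * lam / 2) * x) *
            (Complex.exp (logJost q lam x) * dLog q v lam x),
          Complex.exp (Complex.I * lam / 2 * x) * (Complex.exp (logJost (reflect q) lam (-x)) *
            (dLog (reflect q) (reflect v) lam (-x) * ric (reflect q) lam (-x)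
              + dRic (reflect q) (reflect v) lam (-x)));
          Complex.exp (-(Complex.I * lam / 2) * x) * (Complex.exp (logJost q lam x) *
            (dLog q v lam x * ric q lam x + dRic q v lam x)),
          Complex.exp (Complex.I * lam / 2 * x) * (Complex.exp (logJost (reflect q) lam (-x)) *
            dLog (reflect q) (reflect v) lam (-x))] : Mat) i k) q v := by
  have hL := hasLineDerivAt_logJost q v hl x
  have hr := hasLineDerivAt_ric q v hl x
  have hK := hasLineDerivAt_comp_reflect (hasLineDerivAt_logJost (reflect q) (reflect v) hl (-x))
  have hs := hasLineDerivAt_comp_reflect (hasLineDerivAt_ric (reflect q) (reflect v) hl (-x))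
  simp only [Hplus_eq _ hl]
  unfold HasLineDerivAt at *
  fin_cases i <;> fin_cases k
  · refine (hL.cexp.const_mul _).congr_deriv ?_
    simp
  · refine ((hK.cexp.mul hs).const_mul _).congr_deriv ?_
    simp
    ring
  · refine ((hL.cexp.mul hr).const_mul _).congr_deriv ?_
    simp
    ring
  · refine (hK.cexp.const_mul _).congr_deriv ?_
    simp

lemma kpDensity_plus (u v : 𝓢(ℝ, ℂ)) (x : ℝ) :
    kpDensity (coeffA lam) (Hplus lam) q u v x = redDensity q u v lam x := by
  have hdelta : ∀ v, deltaH (Hplus lam) q v x = _ := fun v => by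
    ext i k
    exact (hasLineDerivAt_Hplus q hl v x i k).lineDeriv
  have hB : Complex.exp (Complex.I * lam / 2 * x) = (Complex.exp (-(Complex.I * lam / 2) * x))⁻¹ := by
    rw [← Complex.exp_neg]
    congr 1; ring
  have hg := gap_ne_zero q hl x
  rw [kpDensity, Matrix.trace_sub, trace_dualMat_mul, trace_dualMat_mul, hdelta u, hdelta v, Hplus_eq q hl, coeffA_eq q hl, ← exp_logJost_mul_gap q hl x,
    Complex.exp_add, hB]
  simp only [redDensity, varLower, varUpper]
  generalize Complex.exp (-(Complex.I * lam / 2) * x) = A at *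
  have hA : A ≠ 0 := by
    intro h
    rw [h, inv_zero] at hB
    exact Complex.exp_ne_zero _ hB
  have hP := Complex.exp_ne_zero (logJost q lam x)
  have hQ := Complex.exp_ne_zero (logJost (reflect q) lam (-x))
  simp only [Matrix.of_apply, Matrix.cons_val', Matrix.cons_val_zero, Matrix.cons_val_one,
    Matrix.cons_val_fin_one]
  field_simp
  ring

lemma continuous_varLower (v : 𝓢(ℝ, ℂ)) : Continuous (varLower q v lam) := by
  have h1 := continuous_dLog q v hl
  have h2 := continuous_ric q hl
  have h3 := continuous_dRic q v hl
  have h4 := continuous_dLog (reflect q) (reflect v) hl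
  have h5 := continuous_ric (reflect q) hl
  unfold varLower gap
  exact Continuous.div₀ (by fun_prop) (by fun_prop) (gap_ne_zero q hl)

lemma continuous_varUpper (v : 𝓢(ℝ, ℂ)) : Continuous (varUpper q v lam) := by
  have h1 := continuous_dLog q v hl
  have h2 := continuous_ric q hl
  have h3 := continuous_dRic (reflect q) (reflect v) hl
  have h4 := continuous_dLog (reflect q) (reflect v) hl
  have h5 := continuous_ric (reflect q) hl
  unfold varUpper gap
  exact Continuous.div₀ (by fun_prop) (by fun_prop) (gap_ne_zero q hl)

lemma exists_norm_inv_gap_le : ∃ C, ∀ x, ‖(gap q lam x)⁻¹‖ ≤ C := by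
  refine ⟨Real.exp ((∫ y, ‖conj (q y) * ric q lam y‖) + ∫ y, ‖conj (reflect q y) * ric (reflect q) lam y‖) /
    ‖Complex.exp (∫ y, conj (q y) * ric q lam y)‖, fun x => ?_⟩
  have h : (gap q lam x)⁻¹ = Complex.exp (logJost q lam x + logJost (reflect q) lam (-x)) /
      Complex.exp (∫ y, conj (q y) * ric q lam y) := by
    rw [← exp_logJost_mul_gap q hl x]
    have := gap_ne_zero q hl x
    field_simp [Complex.exp_ne_zero]
  rw [h, norm_div]
  gcongr
  rw [Complex.norm_exp]
  refine Real.exp_le_exp.2 ((Complex.re_le_norm _).trans ((norm_add_le _ _).trans ?_))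
  exact add_le_add (norm_prim_le (integrable_conj_mul_ric q hl) x)
    (norm_prim_le (integrable_conj_mul_ric (reflect q) hl) (-x))

lemma exists_norm_dLog_le (v : 𝓢(ℝ, ℂ)) : ∃ C, ∀ x, ‖dLog q v lam x‖ ≤ C :=
  ⟨_, norm_prim_le (integrable_dLog_integrand q v hl)⟩

lemma exists_norm_var_le (v : 𝓢(ℝ, ℂ)) :
    ∃ C, ∀ x, ‖varLower q v lam x‖ ≤ C ∧ ‖varUpper q v lam x‖ ≤ C := by
  obtain ⟨G, hG⟩ := exists_norm_inv_gap_le q hl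
  obtain ⟨L, hL⟩ := exists_norm_dLog_le q hl v
  obtain ⟨K, hK⟩ := exists_norm_dLog_le (reflect q) hl (reflect v)
  obtain ⟨A, hA⟩ := exists_norm_dRic_le q v hl
  obtain ⟨B, hB⟩ := exists_norm_dRic_le (reflect q) (reflect v) hl
  refine ⟨max ((L + A + K) * G) ((B + (K + L)) * G), fun x => ?_⟩
  have h1 := (norm_ric_lt_one q hl x).le
  have h2 := (norm_ric_lt_one (reflect q) hl (-x)).le
  have hG0 : 0 ≤ G := (norm_nonneg _).trans (hG x)
  have hL0 : 0 ≤ L := (norm_nonneg _).trans (hL x)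
  have hK0 : 0 ≤ K := (norm_nonneg _).trans (hK x)
  have hA0 : 0 ≤ A := (norm_nonneg _).trans (hA x)
  have hB0 : 0 ≤ B := (norm_nonneg _).trans (hB x)
  constructor
  · refine le_trans ?_ (le_max_left _ _)
    rw [varLower, div_eq_mul_inv, norm_mul]
    refine mul_le_mul ?_ (hG x) (norm_nonneg _) (by positivity)
    refine (norm_sub_le _ _).trans (add_le_add ((norm_add_le _ _).trans (add_le_add ?_ (hA x))) ?_)
    · rw [norm_mul]
      exact (mul_le_of_le_one_right (norm_nonneg _) h1).trans (hL x)
    · rw [norm_mul]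
      exact (mul_le_of_le_one_left (norm_nonneg _) h1).trans (hK _)
  · refine le_trans ?_ (le_max_right _ _)
    rw [varUpper, div_eq_mul_inv, norm_mul]
    refine mul_le_mul ?_ (hG x) (norm_nonneg _) (by positivity)
    refine (norm_add_le _ _).trans (add_le_add (hB _) ?_)
    rw [norm_mul]
    exact (mul_le_of_le_one_left (norm_nonneg _) h2).trans
      ((norm_sub_le _ _).trans (add_le_add (hK _) (hL x)))

lemma integrable_conj_mul_varLower (u v : 𝓢(ℝ, ℂ)) :
    Integrable fun x => conj (u x) * varLower q v lam x := by
  obtain ⟨C, hC⟩ := exists_norm_var_le q hl v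
  exact integrable_conj_mul u (continuous_varLower q hl v) fun x => (hC x).1

lemma integrable_mul_varUpper (u v : 𝓢(ℝ, ℂ)) :
    Integrable fun x => u x * varUpper q v lam x := by
  obtain ⟨C, hC⟩ := exists_norm_var_le q hl v
  refine ((integrable_norm u).mul_const C).mono'
    (u.continuous.mul (continuous_varUpper q hl v)).aestronglyMeasurable
    (Eventually.of_forall fun y => ?_)
  rw [norm_mul]
  exact mul_le_mul_of_nonneg_left (hC y).2 (norm_nonneg _)

lemma integrable_redDensity (u v : 𝓢(ℝ, ℂ)) : Integrable (redDensity q u v lam) :=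
  ((integrable_conj_mul_varLower q hl u v).add (integrable_mul_varUpper q hl u v)).sub
    ((integrable_conj_mul_varLower q hl v u).add (integrable_mul_varUpper q hl v u))

end

lemma kricheverPhongMeaningful_plus {lam : ℂ} (hl : 0 < lam.im) :
    KricheverPhongMeaningful (coeffA lam) (Hplus lam) := fun ψ => by
  refine ⟨?_, fun v x i k => (hasLineDerivAt_Hplus ψ hl v x i k).lineDifferentiableAt, fun u v => ?_⟩
  · rw [coeffA_eq ψ hl]
    exact Complex.exp_ne_zero _
  · rw [show kpDensity (coeffA lam) (Hplus lam) ψ u v = redDensity ψ u v lam from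
      funext (kpDensity_plus ψ hl u v)]
    exact integrable_redDensity ψ hl u v

/-! ### The lower half-plane -/

lemma Hminus_eq {lam : ℂ} (hl : lam.im < 0) (q : 𝓢(ℝ, ℂ)) (x : ℝ) (i k : Fin 2) :
    Hminus lam q x i k = conj (Hplus (conj lam) q x (1 - i) (1 - k)) := by
  have hl' : 0 < (conj lam).im := by simpa using hl
  have h1 := jostColumn_conj (existsUnique_jostColumn_atBot q hl') x
  have h2 := jostColumn_conj (existsUnique_jostColumn_atTop q hl') x
  rw [sub_zero] at h1
  rw [sub_self] at h2
  rw [Hminus, Hplus, h1, h2]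
  fin_cases i <;> fin_cases k <;> simp [ofColumns, conjSwap]

lemma deltaH_minus {lam : ℂ} (hl : lam.im < 0) (q v : 𝓢(ℝ, ℂ)) (x : ℝ) (i k : Fin 2) :
    deltaH (Hminus lam) q v x i k = conj (deltaH (Hplus (conj lam)) q v x (1 - i) (1 - k)) := by
  simp only [deltaH, Matrix.of_apply, lineDeriv, Hminus_eq hl]
  exact deriv.star

lemma kpDensity_minus {lam : ℂ} (hl : lam.im < 0) (q u v : 𝓢(ℝ, ℂ)) (x : ℝ) :
    kpDensity (coeffAStar lam) (Hminus lam) q u v x =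
      conj (kpDensity (coeffA (conj lam)) (Hplus (conj lam)) q u v x) := by
  simp only [kpDensity, Matrix.trace_sub, trace_dualMat_mul, Hminus_eq hl, deltaH_minus hl,
    coeffAStar, sub_zero, sub_self, map_sub, map_add, map_mul, map_inv₀, Complex.conj_conj]
  ring

lemma kpMinus_eq {lam : ℂ} (hl : lam.im < 0) (q u v : 𝓢(ℝ, ℂ)) :
    kpMinus q u v lam = conj (kpPlus q u v (conj lam)) := by
  simp only [kpMinus, kpPlus, kpDensity_minus hl]
  exact integral_conj

lemma kricheverPhongMeaningful_minus {lam : ℂ} (hl : lam.im < 0) :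
    KricheverPhongMeaningful (coeffAStar lam) (Hminus lam) := fun ψ => by
  have hl' : 0 < (conj lam).im := by simpa using hl
  obtain ⟨h1, h2, h3⟩ := kricheverPhongMeaningful_plus hl' ψ
  refine ⟨?_, fun v x i k => ?_, fun u v => ?_⟩
  · rw [coeffAStar]
    exact (map_ne_zero _).2 h1
  · have := (h2 v x (1 - i) (1 - k)).star
    simpa only [Hminus_eq hl] using! this
  · rw [show kpDensity (coeffAStar lam) (Hminus lam) ψ u v = _ from
      funext (kpDensity_minus hl ψ u v)]
    exact (LinearIsometryEquiv.integrable_comp_iff (Complex.conjLIE)).2 (h3 u v)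

/-! ### Asymptotics in sectors and the residue -/

lemma le_im_of_mem_upperSector {δ : ℝ} (hδ : 0 < δ) {z : ℂ} (hz : z ∈ upperSector δ) :
    Real.sin δ * ‖z‖ ≤ z.im ∧ 0 < Real.sin δ := by
  obtain ⟨h1, h2⟩ := hz
  have hpi := Real.pi_pos
  have hsin : Real.sin δ ≤ Real.sin z.arg := by
    rcases le_total z.arg (Real.pi / 2) with h | h
    · exact Real.sin_le_sin_of_le_of_le_pi_div_two (by linarith) h h1
    · rw [← Real.sin_pi_sub z.arg]
      exact Real.sin_le_sin_of_le_of_le_pi_div_two (by linarith) (by linarith) (by linarith)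
  refine ⟨?_, Real.sin_pos_of_pos_of_lt_pi hδ (by linarith)⟩
  rw [← Complex.norm_mul_sin_arg z, mul_comm]
  exact mul_le_mul_of_nonneg_left hsin (norm_nonneg _)

lemma im_pos_of_mem_upperSector {δ : ℝ} (hδ : 0 < δ) {z : ℂ} (hz : z ∈ upperSector δ) : 0 < z.im := by
  have h := le_im_of_mem_upperSector hδ hz
  have h0 : z ≠ 0 := by
    rintro rfl
    have := hz.1
    rw [Complex.arg_zero] at this
    linarith
  exact (mul_pos h.2 (norm_pos_iff.2 h0)).trans_le h.1

lemma conj_mem_upperSector {δ : ℝ} (hδ : 0 < δ) {z : ℂ} (hz : z ∈ lowerSector δ) :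
    conj z ∈ upperSector δ := by
  have h : z.arg ≠ Real.pi := fun h => by
    have := hz.2
    have := Real.pi_pos
    linarith
  rw [upperSector, Set.mem_ofPred_eq, Complex.arg_conj, if_neg h]
  exact ⟨by linarith [hz.2], by linarith [hz.1]⟩

/-- A remainder `O(λ^{-N-1})` is `o(λ^{-N})`. -/
lemma hasExpansion_of_le {S : ℝ → Set ℂ} {F : ℂ → ℂ} {c : ℕ → ℂ} {N : ℕ}
    (h : ∀ δ : ℝ, 0 < δ → ∃ C ρ : ℝ, ∀ z ∈ S δ, ρ ≤ ‖z‖ →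
      ‖F z - ∑ s ∈ Finset.range (N + 1), c s * z⁻¹ ^ s‖ ≤ C * ‖z‖⁻¹ ^ (N + 1)) :
    HasExpansion S F c N := fun δ hδ => by
  obtain ⟨C, ρ, hC⟩ := h δ hδ
  have hev : ∀ᶠ z in Bornology.cobounded ℂ ⊓ 𝓟 (S δ), ρ ≤ ‖z‖ ∧ z ∈ S δ :=
    ((tendsto_norm_cobounded_atTop.eventually_ge_atTop ρ).filter_mono inf_le_left).and
      (eventually_inf_principal.2 (Eventually.of_forall fun z hz => hz))
  have h1 : (fun z : ℂ => F z - ∑ s ∈ Finset.range (N + 1), c s * z⁻¹ ^ s)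
      =O[Bornology.cobounded ℂ ⊓ 𝓟 (S δ)] fun z : ℂ => z⁻¹ ^ (N + 1) := by
    refine Asymptotics.IsBigO.of_bound C ?_
    filter_upwards [hev] with z hz
    rw [norm_pow, norm_inv]
    exact hC z hz.2 hz.1
  have h2 : (fun z : ℂ => z⁻¹ ^ N * z⁻¹) =o[Bornology.cobounded ℂ ⊓ 𝓟 (S δ)] fun z : ℂ => z⁻¹ ^ N * 1 :=
    (Asymptotics.isBigO_refl _ _).mul_isLittleO
      ((Asymptotics.isLittleO_one_iff ℂ).2 (tendsto_inv₀_cobounded.mono_left inf_le_left))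
  simp only [mul_one] at h2
  exact h1.trans_isLittleO h2

/-- The region `Im λ ≥ c |λ|`, `|λ| ≥ 1`, of a sector. -/
def Far (c : ℝ) (lam : ℂ) : Prop := 1 ≤ ‖lam‖ ∧ c * ‖lam‖ ≤ lam.im

lemma Far.im_pos {c : ℝ} (hc : 0 < c) {lam : ℂ} (h : Far c lam) : 0 < lam.im :=
  (mul_pos hc (one_pos.trans_le h.1)).trans_le h.2

lemma Far.div_im_le {c : ℝ} (hc : 0 < c) {lam : ℂ} (h : Far c lam) {A : ℝ} (hA : 0 ≤ A) :
    A / lam.im ≤ A / c * ‖lam‖⁻¹ := by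
  have h0 : 0 < ‖lam‖ := one_pos.trans_le h.1
  rw [div_mul_eq_mul_div, ← div_eq_mul_inv, div_div, mul_comm ‖lam‖ c]
  exact div_le_div_of_nonneg_left hA (by positivity) h.2

lemma exists_ric_le (q : 𝓢(ℝ, ℂ)) {c : ℝ} (hc : 0 < c) :
    ∃ C, 0 ≤ C ∧ ∀ lam, Far c lam → ∀ x, ‖ric q lam x‖ ≤ C * ‖lam‖⁻¹ := by
  obtain ⟨M, hM0, hM⟩ := exists_norm_le q
  refine ⟨2 * M / c, by positivity, fun lam hf x => ?_⟩
  have hl := hf.im_pos hc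
  have hs := admissible_dRic_source q q hl
  have h := eq_linSol (b := 0) (e := ric q lam) hl continuous_zero (integrable_zero _ _ _) hs
    (fun x => (hasDerivAt_ric q hl x).congr_deriv (by simp; ring)) 1
    (fun x => (norm_ric_lt_one q hl x).le)
  have h2 := norm_linSol_le_div (b := 0) (B := 0) hl (integrable_zero _ _ _) (by simp)
    (fun x => (norm_dRic_source_le q q hl x).trans (mul_le_mul_of_nonneg_left (hM x) zero_le_two)) x
  rw [← h, Real.exp_zero, one_mul] at h2
  exact h2.trans (hf.div_im_le hc (by positivity))

lemma exists_dRic_le (q v : 𝓢(ℝ, ℂ)) {c : ℝ} (hc : 0 < c) :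
    ∃ C, 0 ≤ C ∧ ∀ lam, Far c lam → ∀ x, ‖dRic q v lam x‖ ≤ C * ‖lam‖⁻¹ := by
  obtain ⟨M, hM0, hM⟩ := exists_norm_le v
  refine ⟨Real.exp ((∫ x, ‖q x‖) * 2) * (2 * M) / c, by positivity, fun lam hf x => ?_⟩
  have hl := hf.im_pos hc
  have h2 := norm_linSol_le_div hl (integrable_ricCoeff q hl) (integral_norm_ricCoeff_le q hl)
    (fun x => (norm_dRic_source_le q v hl x).trans (mul_le_mul_of_nonneg_left (hM x) zero_le_two)) x
  exact h2.trans (hf.div_im_le hc (by positivity))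

lemma exists_dLog_le (q v : 𝓢(ℝ, ℂ)) {c : ℝ} (hc : 0 < c) :
    ∃ C, 0 ≤ C ∧ ∀ lam, Far c lam → ∀ x, ‖dLog q v lam x‖ ≤ C * ‖lam‖⁻¹ := by
  obtain ⟨A, hA0, hA⟩ := exists_ric_le q hc
  obtain ⟨B, hB0, hB⟩ := exists_dRic_le q v hc
  have hv0 : 0 ≤ ∫ x, ‖v x‖ := integral_nonneg fun x => norm_nonneg _
  have hq0 : 0 ≤ ∫ x, ‖q x‖ := integral_nonneg fun x => norm_nonneg _
  refine ⟨(∫ x, ‖v x‖) * A + (∫ x, ‖q x‖) * B, by positivity, fun lam hf x => ?_⟩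
  have hl := hf.im_pos hc
  have i1 := integrable_conj_mul v (continuous_ric q hl) (hA lam hf)
  have i2 := integrable_conj_mul q (continuous_dRic q v hl) (hB lam hf)
  rw [dLog, prim, integral_add i1.integrableOn i2.integrableOn]
  refine (norm_add_le _ _).trans ?_
  have e1 := (norm_prim_le i1 x).trans (integral_norm_conj_mul_le v (continuous_ric q hl) (hA lam hf))
  have e2 := (norm_prim_le i2 x).trans (integral_norm_conj_mul_le q (continuous_dRic q v hl) (hB lam hf))
  rw [prim] at e1 e2
  linarith

/-- The leading term of `δr` is `i v / λ`: the remainder solves the equation of `δr` with a source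
of order `1 / λ`, and the integral equation gains another factor `1 / Im λ`. -/
lemma exists_dRic_sub_le (q v : 𝓢(ℝ, ℂ)) {c : ℝ} (hc : 0 < c) :
    ∃ C, 0 ≤ C ∧ ∀ lam, Far c lam → ∀ x,
      ‖dRic q v lam x - Complex.I * v x * lam⁻¹‖ ≤ C * ‖lam‖⁻¹ ^ 2 := by
  obtain ⟨A, hA0, hA⟩ := exists_ric_le q hc
  obtain ⟨V, hV0, hV⟩ := exists_norm_le v
  obtain ⟨Q, hQ0, hQ⟩ := exists_norm_le q
  obtain ⟨D, hD0, hD⟩ := exists_norm_le (SchwartzMap.derivCLM ℝ ℂ v)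
  set M := V * A + 2 * Q * V + D with hM
  refine ⟨Real.exp ((∫ x, ‖q x‖) * 2) * M / c, by positivity, fun lam hf x => ?_⟩
  have hl := hf.im_pos hc
  have hn0 : 0 < ‖lam‖ := one_pos.trans_le hf.1
  have hlam : lam ≠ 0 := norm_pos_iff.1 hn0
  have hi1 : ‖lam‖⁻¹ ≤ 1 := inv_le_one_of_one_le₀ hf.1
  have hi0 : 0 ≤ ‖lam‖⁻¹ := by positivity
  set R : ℝ → ℂ := fun y => -(conj (v y) * ric q lam y ^ 2)
    - (2 * conj (q y) * ric q lam y * (Complex.I * v y) + Complex.I * deriv v y) * lam⁻¹ with hR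
  have hdc : Continuous (deriv v) := (SchwartzMap.derivCLM ℝ ℂ v).continuous
  have hRc : Continuous R := by
    have h1 := continuous_ric q hl
    have h2 := continuous_conj_coe v
    have h3 := continuous_conj_coe q
    have h4 := v.continuous
    fun_prop
  have hRM : ∀ y, ‖R y‖ ≤ M * ‖lam‖⁻¹ := fun y => by
    have hr1 := hA lam hf y
    have hr2 := (norm_ric_lt_one q hl y).le
    have hd : ‖deriv v y‖ ≤ D := hD y
    have t1 : ‖conj (v y) * ric q lam y ^ 2‖ ≤ V * (A * ‖lam‖⁻¹) := by
      rw [norm_mul, RCLike.norm_conj, norm_pow, pow_two]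
      have := mul_le_mul hr1 hr2 (norm_nonneg _) (by positivity)
      rw [mul_one] at this
      exact mul_le_mul (hV y) this (by positivity) hV0
    have t2 : ‖2 * conj (q y) * ric q lam y * (Complex.I * v y)‖ ≤ 2 * Q * V := by
      simp only [norm_mul, RCLike.norm_conj, Complex.norm_ofNat, Complex.norm_I, one_mul]
      calc 2 * ‖q y‖ * ‖ric q lam y‖ * ‖v y‖ ≤ 2 * Q * 1 * V := by
            gcongr
            · exact hQ y
            · exact hV y
        _ = _ := by ring
    have t3 : ‖Complex.I * deriv v y‖ ≤ D := by simpa using hd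
    calc ‖R y‖ ≤ V * (A * ‖lam‖⁻¹) + (2 * Q * V + D) * ‖lam‖⁻¹ := by
          refine (norm_sub_le _ _).trans (add_le_add (by rwa [norm_neg]) ?_)
          rw [norm_mul, norm_inv]
          exact mul_le_mul_of_nonneg_right ((norm_add_le _ _).trans (add_le_add t2 t3)) hi0
      _ = M * ‖lam‖⁻¹ := by rw [hM]; ring
  obtain ⟨B, hB⟩ := exists_norm_dRic_le q v hl
  have h := eq_linSol (b := ricCoeff q lam) (R := R) (e := fun x => dRic q v lam x - Complex.I * v x * lam⁻¹)
    hl (continuous_ricCoeff q hl) (integrable_ricCoeff q hl) ⟨hRc, Or.inl ⟨hl, _, hRM⟩⟩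
    (fun x => by
      refine ((hasDerivAt_dRic q v hl x).sub (((v.hasDerivAt x).const_mul Complex.I).mul_const lam⁻¹)).congr_deriv ?_
      simp only [hR, ricCoeff]
      linear_combination (v x * lam * lam⁻¹) * Complex.I_sq - v x * mul_inv_cancel₀ hlam) (B + V)
    (fun x => (norm_sub_le _ _).trans (add_le_add (hB x) (by
      rw [norm_mul, norm_mul, Complex.norm_I, one_mul, norm_inv]
      exact (mul_le_of_le_one_right (norm_nonneg _) hi1).trans (hV x))))
  have h2 := norm_linSol_le_div hl (integrable_ricCoeff q hl) (integral_norm_ricCoeff_le q hl) hRM x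
  rw [← h] at h2
  refine h2.trans ?_
  have h3 := hf.div_im_le hc (A := Real.exp ((∫ x, ‖q x‖) * 2) * (M * ‖lam‖⁻¹)) (by positivity)
  refine h3.trans (le_of_eq ?_)
  ring

/-- The off-diagonal entries of `δH₊ H₊⁻¹` to leading order. -/
lemma exists_var_le (q v : 𝓢(ℝ, ℂ)) {c : ℝ} (hc : 0 < c) :
    ∃ C ρ, ∀ lam, Far c lam → ρ ≤ ‖lam‖ → ∀ x,
      ‖varLower q v lam x - Complex.I * v x * lam⁻¹‖ ≤ C * ‖lam‖⁻¹ ^ 2 ∧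
      ‖varUpper q v lam x + Complex.I * conj (v x) * lam⁻¹‖ ≤ C * ‖lam‖⁻¹ ^ 2 := by
  obtain ⟨A, hA0, hA⟩ := exists_ric_le q hc
  obtain ⟨B, hB0, hB⟩ := exists_ric_le (reflect q) hc
  obtain ⟨K, hK0, hK⟩ := exists_dLog_le q v hc
  obtain ⟨L, hL0, hL⟩ := exists_dLog_le (reflect q) (reflect v) hc
  obtain ⟨D, hD0, hD⟩ := exists_dRic_sub_le q v hc
  obtain ⟨E, hE0, hE⟩ := exists_dRic_sub_le (reflect q) (reflect v) hc
  obtain ⟨V, hV0, hV⟩ := exists_norm_le v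
  refine ⟨2 * (K * A + A * L + D + V * (A * B) + (B * (L + K) + E)), 2 * A, fun lam hf hρ x => ?_⟩
  have hl := hf.im_pos hc
  have hn0 : 0 < ‖lam‖ := one_pos.trans_le hf.1
  have hi1 : ‖lam‖⁻¹ ≤ 1 := inv_le_one_of_one_le₀ hf.1
  set t := ‖lam‖⁻¹ with ht
  have ht0 : 0 ≤ t := by positivity
  have hr := hA lam hf x
  have hs := hB lam hf (-x)
  have hk := hK lam hf x
  have hL' := hL lam hf (-x)
  have hd := hD lam hf x
  have he := hE lam hf (-x)
  have hAt : A * t ≤ 1 / 2 := by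
    rw [ht, ← div_eq_mul_inv, div_le_iff₀ hn0]
    linarith
  have hs1 := (norm_ric_lt_one (reflect q) hl (-x)).le
  have hg0 := gap_ne_zero q hl x
  have hrs : ‖ric q lam x * ric (reflect q) lam (-x)‖ ≤ 1 / 2 := by
    rw [norm_mul]
    exact (mul_le_of_le_one_right (norm_nonneg _) hs1).trans (hr.trans hAt)
  have hg : ‖(gap q lam x)⁻¹‖ ≤ 2 := by
    rw [norm_inv, inv_le_comm₀ (norm_pos_iff.2 hg0) two_pos]
    have := norm_sub_norm_le (1 : ℂ) (ric q lam x * ric (reflect q) lam (-x))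
    rw [norm_one] at this
    rw [gap]
    linarith
  have hrs2 : ‖ric q lam x * ric (reflect q) lam (-x)‖ ≤ A * B * t ^ 2 := by
    rw [norm_mul]
    calc _ ≤ (A * t) * (B * t) := mul_le_mul hr hs (norm_nonneg _) (by positivity)
      _ = _ := by ring
  have hvt : ‖Complex.I * v x * lam⁻¹‖ ≤ V := by
    rw [norm_mul, norm_mul, Complex.norm_I, one_mul, norm_inv]
    exact (mul_le_of_le_one_right (norm_nonneg _) hi1).trans (hV x)
  have hvt' : ‖Complex.I * conj (v x) * lam⁻¹‖ ≤ V := by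
    rw [norm_mul, norm_mul, Complex.norm_I, one_mul, norm_inv, RCLike.norm_conj]
    exact (mul_le_of_le_one_right (norm_nonneg _) hi1).trans (hV x)
  have hrv : reflect v (-x) = -conj (v x) := by rw [reflect_apply, neg_neg]
  rw [hrv] at he
  constructor
  · have h : varLower q v lam x - Complex.I * v x * lam⁻¹ =
        (dLog q v lam x * ric q lam x - ric q lam x * dLog (reflect q) (reflect v) lam (-x)
          + (dRic q v lam x - Complex.I * v x * lam⁻¹)
          + Complex.I * v x * lam⁻¹ * (ric q lam x * ric (reflect q) lam (-x))) * (gap q lam x)⁻¹ := by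
      rw [varLower]
      field_simp
      rw [gap]
      ring
    have e1 : ‖dLog q v lam x * ric q lam x‖ ≤ K * A * t ^ 2 := by
      rw [norm_mul]
      calc _ ≤ (K * t) * (A * t) := mul_le_mul hk hr (norm_nonneg _) (by positivity)
        _ = _ := by ring
    have e2 : ‖ric q lam x * dLog (reflect q) (reflect v) lam (-x)‖ ≤ A * L * t ^ 2 := by
      rw [norm_mul]
      calc _ ≤ (A * t) * (L * t) := mul_le_mul hr hL' (norm_nonneg _) (by positivity)
        _ = _ := by ring
    have e3 : ‖Complex.I * v x * lam⁻¹ * (ric q lam x * ric (reflect q) lam (-x))‖ ≤ V * (A * B * t ^ 2) := by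
      rw [norm_mul]
      exact mul_le_mul hvt hrs2 (norm_nonneg _) hV0
    rw [h, norm_mul]
    have e4 : ‖dLog q v lam x * ric q lam x - ric q lam x * dLog (reflect q) (reflect v) lam (-x)
          + (dRic q v lam x - Complex.I * v x * lam⁻¹)
          + Complex.I * v x * lam⁻¹ * (ric q lam x * ric (reflect q) lam (-x))‖ ≤
          K * A * t ^ 2 + A * L * t ^ 2 + D * t ^ 2 + V * (A * B * t ^ 2) :=
      (norm_add_le _ _).trans (add_le_add ((norm_add_le _ _).trans (add_le_add
        ((norm_sub_le _ _).trans (add_le_add e1 e2)) hd)) e3)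
    have e5 : 0 ≤ (B * (L + K) + E) * t ^ 2 := by positivity
    have e6 := mul_le_mul e4 hg (norm_nonneg _) (by positivity)
    refine e6.trans ?_
    nlinarith [e5]
  · have h : varUpper q v lam x + Complex.I * conj (v x) * lam⁻¹ =
        ((dRic (reflect q) (reflect v) lam (-x) - Complex.I * -conj (v x) * lam⁻¹)
          + ric (reflect q) lam (-x) * (dLog (reflect q) (reflect v) lam (-x) - dLog q v lam x)
          - Complex.I * conj (v x) * lam⁻¹ * (ric q lam x * ric (reflect q) lam (-x))) * (gap q lam x)⁻¹ := by
      rw [varUpper]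
      field_simp
      rw [gap]
      ring
    have e1 : ‖ric (reflect q) lam (-x) * (dLog (reflect q) (reflect v) lam (-x) - dLog q v lam x)‖
        ≤ B * (L + K) * t ^ 2 := by
      rw [norm_mul]
      calc _ ≤ (B * t) * (L * t + K * t) :=
            mul_le_mul hs ((norm_sub_le _ _).trans (add_le_add hL' hk)) (norm_nonneg _) (by positivity)
        _ = _ := by ring
    have e3 : ‖Complex.I * conj (v x) * lam⁻¹ * (ric q lam x * ric (reflect q) lam (-x))‖ ≤ V * (A * B * t ^ 2) := by
      rw [norm_mul]
      exact mul_le_mul hvt' hrs2 (norm_nonneg _) hV0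
    rw [h, norm_mul]
    have e4 : ‖(dRic (reflect q) (reflect v) lam (-x) - Complex.I * -conj (v x) * lam⁻¹)
          + ric (reflect q) lam (-x) * (dLog (reflect q) (reflect v) lam (-x) - dLog q v lam x)
          - Complex.I * conj (v x) * lam⁻¹ * (ric q lam x * ric (reflect q) lam (-x))‖ ≤
          E * t ^ 2 + B * (L + K) * t ^ 2 + V * (A * B * t ^ 2) :=
      (norm_sub_le _ _).trans (add_le_add ((norm_add_le _ _).trans (add_le_add he e1)) e3)
    have e5 : 0 ≤ (K * A + A * L + D) * t ^ 2 := by positivity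
    have e6 := mul_le_mul e4 hg (norm_nonneg _) (by positivity)
    refine e6.trans ?_
    nlinarith [e5]

/-- The two-form `2i ∫ (δψ̄ ∧ δψ)`. -/
def omegaVal (u v : 𝓢(ℝ, ℂ)) : ℂ := 2 * Complex.I * ∫ x, (conj (u x) * v x - conj (v x) * u x)

lemma integrable_conj_mul_schwartz (u v : 𝓢(ℝ, ℂ)) : Integrable fun x => conj (u x) * v x := by
  obtain ⟨M, -, hM⟩ := exists_norm_le v
  exact integrable_conj_mul u v.continuous hM

lemma exists_kpPlus_le (q u v : 𝓢(ℝ, ℂ)) {c : ℝ} (hc : 0 < c) :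
    ∃ C ρ, ∀ lam, Far c lam → ρ ≤ ‖lam‖ →
      ‖kpPlus q u v lam - omegaVal u v * lam⁻¹‖ ≤ C * ‖lam‖⁻¹ ^ 2 := by
  obtain ⟨A, ρ₁, hA⟩ := exists_var_le q v hc
  obtain ⟨B, ρ₂, hB⟩ := exists_var_le q u hc
  refine ⟨∫ x, (2 * A * ‖u x‖ + 2 * B * ‖v x‖), max ρ₁ ρ₂, fun lam hf hρ => ?_⟩
  have hl := hf.im_pos hc
  have h1 := hA lam hf ((le_max_left _ _).trans hρ)
  have h2 := hB lam hf ((le_max_right _ _).trans hρ)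
  have e1 : kpPlus q u v lam = ∫ x, redDensity q u v lam x := by
    simp only [kpPlus, kpDensity_plus q hl]
  have i1 : Integrable fun x => 2 * Complex.I * (conj (u x) * v x - conj (v x) * u x) * lam⁻¹ :=
    (((integrable_conj_mul_schwartz u v).sub (integrable_conj_mul_schwartz v u)).const_mul _).mul_const _
  have e2 : omegaVal u v * lam⁻¹ = ∫ x, 2 * Complex.I * (conj (u x) * v x - conj (v x) * u x) * lam⁻¹ := by
    rw [integral_mul_const, integral_const_mul, omegaVal]
  rw [e1, e2, ← integral_sub (integrable_redDensity q hl u v) i1, ← integral_mul_const]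
  refine norm_integral_le_of_norm_le ((((integrable_norm u).const_mul _).add
    ((integrable_norm v).const_mul _)).mul_const _) (Eventually.of_forall fun x => ?_)
  have e3 : redDensity q u v lam x - 2 * Complex.I * (conj (u x) * v x - conj (v x) * u x) * lam⁻¹ =
      conj (u x) * (varLower q v lam x - Complex.I * v x * lam⁻¹)
      + u x * (varUpper q v lam x + Complex.I * conj (v x) * lam⁻¹)
      - (conj (v x) * (varLower q u lam x - Complex.I * u x * lam⁻¹)
      + v x * (varUpper q u lam x + Complex.I * conj (u x) * lam⁻¹)) := by
    rw [redDensity]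
    ring
  rw [e3]
  refine (norm_sub_le _ _).trans ?_
  have k1 := (norm_add_le (conj (u x) * (varLower q v lam x - Complex.I * v x * lam⁻¹))
    (u x * (varUpper q v lam x + Complex.I * conj (v x) * lam⁻¹)))
  have k2 := (norm_add_le (conj (v x) * (varLower q u lam x - Complex.I * u x * lam⁻¹))
    (v x * (varUpper q u lam x + Complex.I * conj (u x) * lam⁻¹)))
  rw [norm_mul, norm_mul, RCLike.norm_conj] at k1 k2
  have m1 := mul_le_mul_of_nonneg_left (h1 x).1 (norm_nonneg (u x))
  have m2 := mul_le_mul_of_nonneg_left (h1 x).2 (norm_nonneg (u x))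
  have m3 := mul_le_mul_of_nonneg_left (h2 x).1 (norm_nonneg (v x))
  have m4 := mul_le_mul_of_nonneg_left (h2 x).2 (norm_nonneg (v x))
  linarith

lemma far_of_mem_upperSector {δ : ℝ} (hδ : 0 < δ) {z : ℂ} (hz : z ∈ upperSector δ) (h1 : 1 ≤ ‖z‖) :
    Far (Real.sin δ) z := ⟨h1, (le_im_of_mem_upperSector hδ hz).1⟩

lemma conj_omegaVal (u v : 𝓢(ℝ, ℂ)) : conj (omegaVal u v) = omegaVal u v := by
  rw [omegaVal, map_mul, ← integral_conj, map_mul, Complex.conj_I]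
  have : ∀ x, conj (conj (u x) * v x - conj (v x) * u x) = -(conj (u x) * v x - conj (v x) * u x) := fun x => by
    simp
    ring
  simp only [this, integral_neg, map_ofNat]
  ring

lemma isKricheverPhongValue_omegaVal (ψ u v : 𝓢(ℝ, ℂ)) :
    IsKricheverPhongValue ψ u v (omegaVal u v) := by
  have hsum : ∀ z : ℂ, ∑ s ∈ Finset.range (1 + 1), (if s = 1 then omegaVal u v else 0) * z⁻¹ ^ s
      = omegaVal u v * z⁻¹ := fun z => by simp
  refine ⟨omegaVal u v, omegaVal u v, ⟨fun s => if s = 1 then omegaVal u v else 0,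
    hasExpansion_of_le fun δ hδ => ?_, by simp⟩, ⟨fun s => if s = 1 then omegaVal u v else 0,
    hasExpansion_of_le fun δ hδ => ?_, by simp⟩, by ring⟩
  · rcases lt_or_ge 0 (Real.sin δ) with hs | hs
    · obtain ⟨C, ρ, h⟩ := exists_kpPlus_le ψ u v hs
      refine ⟨C, max 1 ρ, fun z hz hρ => ?_⟩
      rw [hsum]
      exact h z (far_of_mem_upperSector hδ hz ((le_max_left _ _).trans hρ)) ((le_max_right _ _).trans hρ)
    -- the sector is empty
    · exact ⟨0, 0, fun z hz => absurd (le_im_of_mem_upperSector hδ hz).2 hs.not_gt⟩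
  · rcases lt_or_ge 0 (Real.sin δ) with hs | hs
    · obtain ⟨C, ρ, h⟩ := exists_kpPlus_le ψ u v hs
      refine ⟨C, max 1 ρ, fun z hz hρ => ?_⟩
      have hz' := conj_mem_upperSector hδ hz
      have him : z.im < 0 := by simpa using im_pos_of_mem_upperSector hδ hz'
      rw [hsum, kpMinus_eq him]
      have := h (conj z) (far_of_mem_upperSector hδ hz' (by
        rw [RCLike.norm_conj]; exact (le_max_left _ _).trans hρ)) (by
        rw [RCLike.norm_conj]; exact (le_max_right _ _).trans hρ)
      rw [RCLike.norm_conj] at this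
      rw [← RCLike.norm_conj, map_sub, map_mul, Complex.conj_conj, conj_omegaVal, map_inv₀]
      exact this
    -- the sector is empty
    · exact ⟨0, 0, fun z hz =>
        absurd (le_im_of_mem_upperSector hδ (conj_mem_upperSector hδ hz)).2 hs.not_gt⟩

/-! ### The symplectic form -/

lemma integral_conj_mul_eq_inner (u v : 𝓢(ℝ, ℂ)) :
    ∫ x, conj (u x) * v x = inner ℂ (u.toLp 2) (v.toLp 2) := by
  refine Eq.trans ?_ (SchwartzMap.inner_toL2_toL2_eq u v volume).symm
  congr 1
  ext x
  rw [RCLike.inner_apply, mul_comm]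

lemma omegaVal_eq_inner (u v : 𝓢(ℝ, ℂ)) : omegaVal u v =
    2 * Complex.I * (inner ℂ (u.toLp 2) (v.toLp 2) - inner ℂ (v.toLp 2) (u.toLp 2)) := by
  rw [omegaVal, integral_sub (integrable_conj_mul_schwartz u v) (integrable_conj_mul_schwartz v u),
    integral_conj_mul_eq_inner, integral_conj_mul_eq_inner]

lemma omegaVal_add_left (u u' v : 𝓢(ℝ, ℂ)) :
    omegaVal (u + u') v = omegaVal u v + omegaVal u' v := by
  have h : (u + u').toLp 2 (volume : Measure ℝ) = u.toLp 2 volume + u'.toLp 2 volume :=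
    map_add (SchwartzMap.toLpCLM ℝ ℂ 2 volume) u u'
  simp only [omegaVal_eq_inner, h, inner_add_left, inner_add_right]
  ring

lemma omegaVal_smul_left (t : ℝ) (u v : 𝓢(ℝ, ℂ)) : omegaVal (t • u) v = t * omegaVal u v := by
  rw [omegaVal, omegaVal, mul_left_comm, ← integral_const_mul (t : ℂ)]
  refine congrArg (fun z : ℂ => 2 * Complex.I * z) (integral_congr_ae (Eventually.of_forall fun x => ?_))
  simp
  ring

lemma omegaVal_neg_swap (u v : 𝓢(ℝ, ℂ)) : omegaVal u v = -omegaVal v u := by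
  simp only [omegaVal_eq_inner]
  ring

/-- The form `2i ∫ (δψ̄ ∧ δψ)` as a continuous alternating map; its continuity is that of the inner
product of `L²`. -/
def omegaForm : 𝓢(ℝ, ℂ) [⋀^Fin 2]→L[ℝ] ℂ where
  toFun w := omegaVal (w 0) (w 1)
  map_update_add' w i x y := by
    fin_cases i
    · simp [omegaVal_add_left]
    · simp only [Fin.mk_one, Fin.isValue, ne_eq, zero_ne_one, not_false_eq_true,
        Function.update_of_ne, Function.update_self]
      rw [omegaVal_neg_swap, omegaVal_add_left, omegaVal_neg_swap x,
        omegaVal_neg_swap y, neg_add, neg_neg, neg_neg]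
  map_update_smul' w i t x := by
    fin_cases i
    · simp [omegaVal_smul_left]
    · simp only [Fin.mk_one, Fin.isValue, ne_eq, zero_ne_one, not_false_eq_true,
        Function.update_of_ne, Function.update_self]
      rw [omegaVal_neg_swap, omegaVal_smul_left, omegaVal_neg_swap x]
      simp
  cont := by
    have h : Continuous fun u : 𝓢(ℝ, ℂ) => u.toLp 2 (volume : Measure ℝ) := SchwartzMap.continuous_toLp
    simp only [omegaVal_eq_inner]
    fun_prop
  map_eq_zero_of_eq' w i j hij hne := by
    have h01 : w 0 = w 1 := by
      fin_cases i <;> fin_cases j <;> first | exact absurd rfl hne | exact hij | exact hij.symm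
    simp [h01, omegaVal]

lemma isClosedTwoForm_const {E : Type*} [AddCommGroup E] [Module ℝ E] [TopologicalSpace E]
    (ω : E [⋀^Fin 2]→L[ℝ] ℂ) : IsClosedTwoForm fun _ : E => ω := by
  refine ⟨fun p u v w => differentiableAt_const _, fun p u v w => ?_⟩
  simp [lineDeriv]

/-! ### Formal Riccati series over a differential algebra -/

open PowerSeries in
/-- The coefficientwise extension of a derivation to power series. -/
def seriesDeriv {R : Type*} [CommRing R] [Algebra ℂ R] (d : Derivation ℂ R R) :
    Derivation ℂ R⟦X⟧ R⟦X⟧ :=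
  Derivation.mk'
    { toFun := fun F => PowerSeries.mk fun n => d (coeff n F)
      map_add' := fun F G => by
        ext n
        simp
      map_smul' := fun c F => by
        ext n
        simp } fun F G => by
    ext n
    simp only [LinearMap.coe_mk, AddHom.coe_mk, coeff_mk, coeff_mul, map_sum, Derivation.leibniz,
      smul_eq_mul, map_add, Finset.sum_add_distrib]
    congr 1
    rw [← Finset.Nat.sum_antidiagonal_swap]
    rfl

open PowerSeries in
lemma coeff_seriesDeriv {R : Type*} [CommRing R] [Algebra ℂ R] (d : Derivation ℂ R R) (F : R⟦X⟧)
    (n : ℕ) : coeff n (seriesDeriv d F) = d (coeff n F) := by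
  simp [seriesDeriv]

/-- The coefficientwise extension of a derivation to polynomials. -/
def polyDeriv {R : Type*} [CommRing R] [Algebra ℂ R] (d : Derivation ℂ R R) :
    Derivation ℂ (Polynomial R) (Polynomial R) :=
  (PolynomialModule.equivPolynomialSelf (R := R)).toLinearMap.compDer d.mapCoeffs

lemma polyDeriv_monomial {R : Type*} [CommRing R] [Algebra ℂ R] (d : Derivation ℂ R R) (n : ℕ) (a : R) :
    polyDeriv d (Polynomial.monomial n a) = Polynomial.monomial n (d a) := by
  simp [polyDeriv]

lemma coeff_polyDeriv {R : Type*} [CommRing R] [Algebra ℂ R] (d : Derivation ℂ R R)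
    (P : Polynomial R) (n : ℕ) : (polyDeriv d P).coeff n = d (P.coeff n) := by
  induction P using Polynomial.induction_on' with
  | add P Q hP hQ => simp [hP, hQ]
  | monomial m a =>
    rw [polyDeriv_monomial, Polynomial.coeff_monomial, Polynomial.coeff_monomial]
    split_ifs <;> simp

/-- The coefficients of the formal solution, in powers of `1/λ`, of the Riccati equation
`κ⁻¹ r λ = r' + p r² - q`. -/
def riccatiSeq {R : Type*} [CommRing R] [Algebra ℂ R] (d : Derivation ℂ R R) (κ : ℂ) (p q : R) :
    ℕ → R
  | 0 => 0
  | n + 1 => κ • (d (riccatiSeq d κ p q n) +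
      p * ∑ j : Fin (n + 1), riccatiSeq d κ p q j.val * riccatiSeq d κ p q (n - j.val)
      - if n = 0 then q else 0)
  termination_by n => n
  decreasing_by all_goals omega

section Generic

variable {R : Type*} [CommRing R] [Algebra ℂ R] (d : Derivation ℂ R R) (κ : ℂ) (p q : R)

lemma riccatiSeq_zero : riccatiSeq d κ p q 0 = 0 := by rw [riccatiSeq]

lemma riccatiSeq_succ (n : ℕ) : riccatiSeq d κ p q (n + 1) =
    κ • (d (riccatiSeq d κ p q n) +
      p * ∑ ij ∈ Finset.HasAntidiagonal.antidiagonal n, riccatiSeq d κ p q ij.1 * riccatiSeq d κ p q ij.2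
      - if n = 0 then q else 0) := by
  rw [riccatiSeq, Finset.Nat.sum_antidiagonal_eq_sum_range_succ
    (fun i j => riccatiSeq d κ p q i * riccatiSeq d κ p q j), Finset.sum_range]

/-- A morphism of differential algebras maps formal solutions to formal solutions. -/
lemma riccatiSeq_map {R' : Type*} [CommRing R'] [Algebra ℂ R'] (d' : Derivation ℂ R' R')
    (φ : R →ₐ[ℂ] R') (hφ : ∀ x, φ (d x) = d' (φ x)) (n : ℕ) :
    φ (riccatiSeq d κ p q n) = riccatiSeq d' κ (φ p) (φ q) n := by
  induction n using Nat.strong_induction_on with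
  | _ n ih =>
    rcases n with _ | n
    · rw [riccatiSeq_zero, riccatiSeq_zero, map_zero]
    · rw [riccatiSeq_succ, riccatiSeq_succ, map_smul, map_sub, map_add, hφ, ih n n.lt_succ_self,
        map_mul, map_sum, apply_ite φ, map_zero]
      congr 4
      refine Finset.sum_congr rfl fun ij hij => ?_
      have := Finset.HasAntidiagonal.mem_antidiagonal.1 hij
      rw [map_mul, ih _ (by omega), ih _ (by omega)]

lemma riccatiSeq_mem (I : Ideal R) (hI : ∀ x ∈ I, d x ∈ I) (hq : q ∈ I) (n : ℕ) :
    riccatiSeq d κ p q n ∈ I := by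
  induction n using Nat.strong_induction_on with
  | _ n ih =>
    rcases n with _ | n
    · rw [riccatiSeq_zero]
      exact I.zero_mem
    · rw [riccatiSeq_succ, Algebra.smul_def]
      refine I.mul_mem_left _ (I.sub_mem (I.add_mem (hI _ (ih n n.lt_succ_self))
        (I.mul_mem_left _ (I.sum_mem fun ij hij => ?_))) ?_)
      · have := Finset.HasAntidiagonal.mem_antidiagonal.1 hij
        exact I.mul_mem_right _ (ih _ (by omega))
      · split_ifs
        exacts [hq, I.zero_mem]

open PowerSeries

/-- The formal solution of the Riccati equation, as a power series in `X = 1/λ`. -/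
def riccatiSeries : R⟦X⟧ := PowerSeries.mk (riccatiSeq d κ p q)

lemma X_mul_seriesDeriv_riccatiSeries {μ : ℂ} (hμ : μ * κ = 1) :
    X * seriesDeriv d (riccatiSeries d κ p q) = X * C q + algebraMap ℂ R⟦X⟧ μ * riccatiSeries d κ p q
      - X * (C p * riccatiSeries d κ p q ^ 2) := by
  ext n
  rw [← Algebra.smul_def]
  rcases n with _ | n
  · simp [riccatiSeries, riccatiSeq_zero]
  · simp only [map_sub, map_add, coeff_succ_X_mul, coeff_seriesDeriv, coeff_smul, coeff_C_mul,
      pow_two, riccatiSeries, coeff_mk, coeff_C]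
    rw [riccatiSeq_succ, smul_smul, hμ, one_smul, coeff_mul]
    simp only [coeff_mk]
    ring

end Generic

/-! ### The algebra of the formal resolvent -/

/-! Here `z` stands for `1/λ`, the derivations `D` and `Δ` for `d/dx` and a variation of `(p, q) = (ψ̄, ψ)`,
and `r`, `s` for the two Riccati variables. The resolvent has the diagonal entry
`-(i/2) (1 + r s) / (1 - r s)`, the upper entry `i s / (1 - r s)` and the lower entry
`-i r / (1 - r s)`. -/

section Algebra

variable {S : Type*} [CommRing S] [Algebra ℂ S] (D Δ : Derivation ℂ S S) {z p q r s E : S}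

lemma algebraMap_I_sq : algebraMap ℂ S Complex.I ^ 2 = -1 := by
  rw [← map_pow, Complex.I_sq, map_neg, map_one]

lemma two_mul_algebraMap_I_div_two : 2 * algebraMap ℂ S (Complex.I / 2) = algebraMap ℂ S Complex.I := by
  rw [show (2 : S) = algebraMap ℂ S 2 from (map_ofNat _ 2).symm, ← map_mul]
  congr 1
  ring

variable (hr : z * D r = z * q + algebraMap ℂ S Complex.I * r - z * (p * r ^ 2))
  (hs : z * D s = z * p + algebraMap ℂ S (-Complex.I) * s - z * (q * s ^ 2))
  (hE : (1 - r * s) * E = 1)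

include hr hs hE

/-- `E = 1 / (1 - r s)` satisfies `E' = (q s + p r) E`. -/
lemma deriv_inv_gap : z * D E = z * ((q * s + p * r) * E) := by
  have h := congrArg D hE
  simp only [Derivation.leibniz, map_sub, Derivation.map_one_eq_zero, smul_eq_mul] at h
  rw [map_neg] at hs
  linear_combination (z * E) * h + E ^ 2 * s * hr + E ^ 2 * r * hs
    - (z * D E - z * (q * s + p * r) * E) * hE

/-- The upper entry of `Q' = [V, Q]`. -/
lemma deriv_upper : z * D (algebraMap ℂ S Complex.I * (s * E)) =
    -(algebraMap ℂ S Complex.I * (algebraMap ℂ S Complex.I * (s * E)))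
      - 2 * (z * (p * -(algebraMap ℂ S (Complex.I / 2) * ((1 + r * s) * E)))) := by
  have h := deriv_inv_gap D hr hs hE
  have h2 := two_mul_algebraMap_I_div_two (S := S)
  rw [map_neg] at hs
  simp only [Derivation.leibniz, smul_eq_mul, Derivation.map_algebraMap, mul_zero, add_zero]
  linear_combination algebraMap ℂ S Complex.I * s * h + algebraMap ℂ S Complex.I * E * hs
    - z * p * (1 + r * s) * E * h2

/-- The lower entry of `Q' = [V, Q]`. -/
lemma deriv_lower : z * D (-(algebraMap ℂ S Complex.I * (r * E))) =
    algebraMap ℂ S Complex.I * -(algebraMap ℂ S Complex.I * (r * E))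
      + 2 * (z * (q * -(algebraMap ℂ S (Complex.I / 2) * ((1 + r * s) * E)))) := by
  have h := deriv_inv_gap D hr hs hE
  have h2 := two_mul_algebraMap_I_div_two (S := S)
  simp only [map_neg, Derivation.leibniz, smul_eq_mul, Derivation.map_algebraMap, mul_zero, add_zero]
  linear_combination -algebraMap ℂ S Complex.I * r * h - algebraMap ℂ S Complex.I * E * hr
    + z * q * (1 + r * s) * E * h2

/-- The diagonal part of `Q' = [V, Q]`. -/
lemma deriv_diag : z * D (-(algebraMap ℂ S (Complex.I / 2) * ((1 + r * s) * E))) =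
    z * (p * -(algebraMap ℂ S Complex.I * (r * E)) - q * (algebraMap ℂ S Complex.I * (s * E))) := by
  have h := deriv_inv_gap D hr hs hE
  have h2 := two_mul_algebraMap_I_div_two (S := S)
  rw [map_neg] at hs
  simp only [map_neg, map_add, Derivation.leibniz, smul_eq_mul, Derivation.map_algebraMap,
    Derivation.map_one_eq_zero, mul_zero, add_zero, zero_add]
  linear_combination -algebraMap ℂ S (Complex.I / 2) * (1 + r * s) * h
    - algebraMap ℂ S (Complex.I / 2) * E * s * hr - algebraMap ℂ S (Complex.I / 2) * E * r * hs
    - z * (q * s + p * r) * E * h2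

/-- The variation of `p r` is, up to a total derivative, linear in the variations of `p` and `q`:
the linearized Riccati equation for `Δ r` is solved for the term `p Δ r` with the integrating factor
`s E`. The coefficients are the off-diagonal entries of the resolvent, up to the factor `i`. -/
lemma variation_eq_add_deriv (hz : Δ z = 0) (hc : D (Δ r) = Δ (D r)) :
    z * Δ (p * r) = z * ((Δ p * r - Δ q * s) * E + D (s * (Δ r * E))) := by
  have h := deriv_inv_gap D hr hs hE
  have h1 := congrArg Δ hr
  rw [map_neg] at hs
  simp only [map_sub, map_add, Derivation.leibniz, Derivation.leibniz_pow, smul_eq_mul, hz,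
    Derivation.map_algebraMap, mul_zero, add_zero, ← hc] at h1
  simp only [Derivation.leibniz, smul_eq_mul]
  simp only [nsmul_eq_mul, Nat.cast_ofNat, Nat.add_one_sub_one, pow_one] at h1
  linear_combination (-(z * p * Δ r) - z * Δ p * r) * hE - s * E * h1 - Δ r * E * hs - s * Δ r * h

omit hr hs in
/-- `Q² = -1/4`. -/
lemma resolvent_sq : (-(algebraMap ℂ S (Complex.I / 2) * ((1 + r * s) * E))) ^ 2
    + (algebraMap ℂ S Complex.I * (s * E)) * -(algebraMap ℂ S Complex.I * (r * E)) =
    algebraMap ℂ S (-(1 / 4)) := by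
  have h2 := two_mul_algebraMap_I_div_two (S := S)
  have h4 : 4 * algebraMap ℂ S (-(1 / 4)) = -1 := by
    rw [show (4 : S) = algebraMap ℂ S 4 from (map_ofNat _ 4).symm, ← map_mul, ← map_one (algebraMap ℂ S), ← map_neg]
    congr 1
    norm_num
  have h5 : algebraMap ℂ S (Complex.I / 2) ^ 2 = algebraMap ℂ S (-(1 / 4)) := by
    rw [← map_pow]
    congr 1
    rw [div_pow, Complex.I_sq]
    norm_num
  rw [← h2]
  linear_combination ((1 + r * s) ^ 2 * E ^ 2 - 4 * s * r * E ^ 2) * h5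
    + algebraMap ℂ S (-(1 / 4)) * ((1 - r * s) * E + 1) * hE

end Algebra

/-! ### The differential algebra of constants plus Schwartz functions -/

/-- The algebra `ℂ + 𝓢(ℝ)` of functions on the line. The constants are needed for the diagonal
entries of the resolvent. -/
def schwartzAlg : Subalgebra ℂ (ℝ → ℂ) where
  carrier := {f | ∃ (c : ℂ) (φ : 𝓢(ℝ, ℂ)), ∀ x, f x = c + φ x}
  mul_mem' := by
    rintro f g ⟨c, φ, hf⟩ ⟨c', φ', hg⟩
    refine ⟨c * c', c • φ' + c' • φ + SchwartzMap.pairing (ContinuousLinearMap.mul ℂ ℂ) φ φ', fun x => ?_⟩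
    simp only [Pi.mul_apply, hf, hg, add_apply, smul_apply, SchwartzMap.pairing_apply_apply,
      ContinuousLinearMap.mul_apply', smul_eq_mul]
    ring
  add_mem' := by
    rintro f g ⟨c, φ, hf⟩ ⟨c', φ', hg⟩
    refine ⟨c + c', φ + φ', fun x => ?_⟩
    simp only [Pi.add_apply, hf, hg, add_apply]
    ring
  algebraMap_mem' c := ⟨c, 0, fun x => by simp⟩

lemma differentiable_schwartzAlg (f : schwartzAlg) : Differentiable ℝ f.1 := by
  obtain ⟨c, φ, h⟩ := f.2
  rw [show f.1 = fun x => c + φ x from funext h]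
  exact fun x => ((φ.hasDerivAt x).const_add c).differentiableAt

lemma deriv_mem_schwartzAlg (f : schwartzAlg) : ∃ φ : 𝓢(ℝ, ℂ), ∀ x, deriv f.1 x = φ x := by
  obtain ⟨c, φ, h⟩ := f.2
  refine ⟨SchwartzMap.derivCLM ℝ ℂ φ, fun x => ?_⟩
  rw [show f.1 = fun x => c + φ x from funext h]
  exact ((φ.hasDerivAt x).const_add c).deriv

/-- Differentiation in `x`. -/
def dx : Derivation ℂ schwartzAlg schwartzAlg :=
  Derivation.mk'
    { toFun := fun f => ⟨deriv f.1, 0, (deriv_mem_schwartzAlg f).choose, fun x => by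
        rw [zero_add]
        exact (deriv_mem_schwartzAlg f).choose_spec x⟩
      map_add' := fun f g => by
        ext x
        exact deriv_add (differentiable_schwartzAlg f x) (differentiable_schwartzAlg g x)
      map_smul' := fun c f => by
        ext x
        exact deriv_const_smul c (differentiable_schwartzAlg f x) } fun f g => by
    ext x
    refine (deriv_mul (differentiable_schwartzAlg f x) (differentiable_schwartzAlg g x)).trans ?_
    simp only [LinearMap.coe_mk, AddHom.coe_mk, smul_eq_mul, Subalgebra.coe_add, Subalgebra.coe_mul,
      Pi.add_apply, Pi.mul_apply]
    ring

lemma dx_apply (f : schwartzAlg) (x : ℝ) : (dx f).1 x = deriv f.1 x := rfl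

lemma hasDerivAt_schwartzAlg (f : schwartzAlg) (x : ℝ) : HasDerivAt f.1 ((dx f).1 x) x :=
  (differentiable_schwartzAlg f x).hasDerivAt

/-- The ideal of Schwartz functions. -/
def schwartzIdeal : Ideal schwartzAlg where
  carrier := {f | ∃ φ : 𝓢(ℝ, ℂ), ∀ x, f.1 x = φ x}
  add_mem' := by
    rintro f g ⟨φ, hf⟩ ⟨φ', hg⟩
    refine ⟨φ + φ', fun x => ?_⟩
    simp [hf, hg]
  zero_mem' := ⟨0, fun _ => rfl⟩
  smul_mem' := by
    rintro f g ⟨φ', hg⟩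
    obtain ⟨c, φ, hf⟩ := f.2
    refine ⟨c • φ' + SchwartzMap.pairing (ContinuousLinearMap.mul ℂ ℂ) φ φ', fun x => ?_⟩
    simp only [smul_eq_mul, Subalgebra.coe_mul, Pi.mul_apply, hf, hg, add_apply, smul_apply,
      SchwartzMap.pairing_apply_apply, ContinuousLinearMap.mul_apply']
    ring

lemma dx_mem_schwartzIdeal (f : schwartzAlg) : dx f ∈ schwartzIdeal := deriv_mem_schwartzAlg f

lemma integrable_of_mem_schwartzIdeal {f : schwartzAlg} (hf : f ∈ schwartzIdeal) : Integrable f.1 := by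
  obtain ⟨φ, h⟩ := hf
  rw [show f.1 = φ from funext h]
  exact φ.integrable

/-- Total derivatives of Schwartz functions integrate to zero. -/
lemma integral_dx {f : schwartzAlg} (hf : f ∈ schwartzIdeal) : ∫ x, (dx f).1 x = 0 :=
  integral_eq_zero_of_hasDerivAt_of_integrable (hasDerivAt_schwartzAlg f)
    (integrable_of_mem_schwartzIdeal (dx_mem_schwartzIdeal f)) (integrable_of_mem_schwartzIdeal hf)

/-- A Schwartz function as an element of `ℂ + 𝓢(ℝ)`. -/
def toAlg (φ : 𝓢(ℝ, ℂ)) : schwartzAlg := ⟨φ, 0, φ, fun _ => (zero_add _).symm⟩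

/-- The complex conjugate of a Schwartz function, as an element of `ℂ + 𝓢(ℝ)`. -/
def toAlgConj (φ : 𝓢(ℝ, ℂ)) : schwartzAlg :=
  toAlg (SchwartzMap.postcompCLM (𝕜 := ℝ) (E := ℝ) (Complex.conjCLE : ℂ →L[ℝ] ℂ) φ)

lemma toAlg_apply (φ : 𝓢(ℝ, ℂ)) (x : ℝ) : (toAlg φ).1 x = φ x := rfl

lemma toAlgConj_apply (φ : 𝓢(ℝ, ℂ)) (x : ℝ) : (toAlgConj φ).1 x = conj (φ x) := rfl

lemma toAlg_mem (φ : 𝓢(ℝ, ℂ)) : toAlg φ ∈ schwartzIdeal := ⟨φ, fun _ => rfl⟩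

lemma toAlgConj_mem (φ : 𝓢(ℝ, ℂ)) : toAlgConj φ ∈ schwartzIdeal := toAlg_mem _

/-! ### The formal resolvent -/

section Generic

open PowerSeries

variable {R : Type*} [CommRing R] [Algebra ℂ R] (d : Derivation ℂ R R) (p q : R)

/-- The formal expansion of `r`, with `p`, `q` in the roles of `ψ̄`, `ψ`. -/
def serR : R⟦X⟧ := riccatiSeries d (-Complex.I) p q

/-- The formal expansion of the second Riccati variable `s`, the ratio of the components of
`j₊⁽²⁾`. -/
def serS : R⟦X⟧ := riccatiSeries d Complex.I q p

/-- The formal expansion of `1 / (1 - r s)`. -/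
def serE : R⟦X⟧ := invOfUnit (1 - serR d p q * serS d p q) 1

/-- The diagonal entry of the formal resolvent. -/
def resDiag : R⟦X⟧ :=
  -(algebraMap ℂ R⟦X⟧ (Complex.I / 2) * ((1 + serR d p q * serS d p q) * serE d p q))

/-- The upper entry of the formal resolvent. -/
def resUpper : R⟦X⟧ := algebraMap ℂ R⟦X⟧ Complex.I * (serS d p q * serE d p q)

/-- The lower entry of the formal resolvent. -/
def resLower : R⟦X⟧ := -(algebraMap ℂ R⟦X⟧ Complex.I * (serR d p q * serE d p q))

lemma serR_eq : X * seriesDeriv d (serR d p q) = X * C q + algebraMap ℂ R⟦X⟧ Complex.I * serR d p q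
      - X * (C p * serR d p q ^ 2) :=
  X_mul_seriesDeriv_riccatiSeries d _ p q (by simp)

lemma serS_eq : X * seriesDeriv d (serS d p q) = X * C p + algebraMap ℂ R⟦X⟧ (-Complex.I) * serS d p q
      - X * (C q * serS d p q ^ 2) :=
  X_mul_seriesDeriv_riccatiSeries d _ q p (by simp)

lemma constantCoeff_serR : constantCoeff (serR d p q) = 0 := by
  rw [← coeff_zero_eq_constantCoeff_apply, serR, riccatiSeries, coeff_mk, riccatiSeq_zero]

lemma constantCoeff_serS : constantCoeff (serS d p q) = 0 := by
  rw [← coeff_zero_eq_constantCoeff_apply, serS, riccatiSeries, coeff_mk, riccatiSeq_zero]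

lemma serE_eq : (1 - serR d p q * serS d p q) * serE d p q = 1 :=
  mul_invOfUnit _ _ (by simp [constantCoeff_serR])

lemma constantCoeff_serE : constantCoeff (serE d p q) = 1 := by
  simp [serE]

lemma coeff_zero_resDiag : coeff 0 (resDiag d p q) = -algebraMap ℂ R (Complex.I / 2) := by
  simp [resDiag, constantCoeff_serR, constantCoeff_serE, PowerSeries.algebraMap_apply]

lemma coeff_zero_resUpper : coeff 0 (resUpper d p q) = 0 := by
  simp [resUpper, constantCoeff_serS]

lemma coeff_zero_resLower : coeff 0 (resLower d p q) = 0 := by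
  simp [resLower, constantCoeff_serR]

lemma I_smul_I_smul (a : R) : Complex.I • Complex.I • a = -a := by
  rw [smul_smul, Complex.I_mul_I, neg_one_smul]

lemma coeff_succ_resUpper (n : ℕ) : coeff (n + 1) (resUpper d p q) =
    Complex.I • (d (coeff n (resUpper d p q)) + 2 * (p * coeff n (resDiag d p q))) := by
  have h := congrArg (coeff (n + 1)) (deriv_upper (seriesDeriv d) (serR_eq d p q) (serS_eq d p q) (serE_eq d p q))
  rw [← resUpper, ← resDiag, ← Algebra.smul_def, show (2 : R⟦X⟧) = C 2 from (map_ofNat C 2).symm] at h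
  simp only [map_sub, map_neg, coeff_succ_X_mul, coeff_seriesDeriv, coeff_smul, coeff_C_mul] at h
  rw [h, sub_add_cancel, smul_neg, I_smul_I_smul, neg_neg]

lemma coeff_succ_resLower (n : ℕ) : coeff (n + 1) (resLower d p q) =
    -(Complex.I • (d (coeff n (resLower d p q)) - 2 * (q * coeff n (resDiag d p q)))) := by
  have h := congrArg (coeff (n + 1)) (deriv_lower (seriesDeriv d) (serR_eq d p q) (serS_eq d p q) (serE_eq d p q))
  rw [← resLower, ← resDiag, ← Algebra.smul_def, show (2 : R⟦X⟧) = C 2 from (map_ofNat C 2).symm] at h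
  simp only [map_add, coeff_succ_X_mul, coeff_seriesDeriv, coeff_smul, coeff_C_mul] at h
  rw [h, add_sub_cancel_right, I_smul_I_smul, neg_neg]

lemma deriv_coeff_resDiag (n : ℕ) : d (coeff n (resDiag d p q)) =
    p * coeff n (resLower d p q) - q * coeff n (resUpper d p q) := by
  have h := congrArg (coeff (n + 1)) (deriv_diag (seriesDeriv d) (serR_eq d p q) (serS_eq d p q) (serE_eq d p q))
  rw [← resLower, ← resDiag, ← resUpper] at h
  simpa only [map_sub, coeff_succ_X_mul, coeff_seriesDeriv, coeff_C_mul] using h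

lemma coeff_succ_resDiag (n : ℕ) : coeff (n + 1) (resDiag d p q) =
    -(Complex.I • ∑ j : Fin n, (coeff (j.val + 1) (resDiag d p q) * coeff (n - j.val) (resDiag d p q)
      + coeff (j.val + 1) (resUpper d p q) * coeff (n - j.val) (resLower d p q))) := by
  have h := congrArg (coeff (n + 1)) (resolvent_sq (serE_eq d p q))
  rw [← resLower, ← resDiag, ← resUpper, pow_two, map_add, coeff_mul, coeff_mul, ← Finset.sum_add_distrib,
    Finset.Nat.sum_antidiagonal_eq_sum_range_succ (fun i j => coeff i (resDiag d p q) * coeff j (resDiag d p q)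
      + coeff i (resUpper d p q) * coeff j (resLower d p q)), Finset.sum_range_succ, Finset.sum_range_succ',
    PowerSeries.algebraMap_apply, coeff_C, if_neg (Nat.succ_ne_zero n), Nat.sub_self, coeff_zero_resDiag,
    coeff_zero_resUpper, coeff_zero_resLower, Finset.sum_range] at h
  have h2 : ∀ j : Fin n, n + 1 - (j.val + 1) = n - j.val := fun j => by omega
  simp only [h2, Nat.sub_zero] at h
  rw [show ∑ j : Fin n, (coeff (j.val + 1) (resDiag d p q) * coeff (n - j.val) (resDiag d p q)
      + coeff (j.val + 1) (resUpper d p q) * coeff (n - j.val) (resLower d p q)) =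
      Complex.I • coeff (n + 1) (resDiag d p q) from ?_, I_smul_I_smul, neg_neg]
  rw [Algebra.smul_def]
  linear_combination h + coeff (n + 1) (resDiag d p q) * two_mul_algebraMap_I_div_two (S := R)

end Generic

/-- The diagonal entry of the coefficient of `λ⁻ⁿ` in the formal resolvent of the potential `ψ`. -/
abbrev diagCoeff (ψ : 𝓢(ℝ, ℂ)) (n : ℕ) : schwartzAlg :=
  PowerSeries.coeff n (resDiag dx (toAlgConj ψ) (toAlg ψ))

/-- The upper entry of the coefficient of `λ⁻ⁿ` in the formal resolvent of the potential `ψ`. -/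
abbrev upperCoeff (ψ : 𝓢(ℝ, ℂ)) (n : ℕ) : schwartzAlg :=
  PowerSeries.coeff n (resUpper dx (toAlgConj ψ) (toAlg ψ))

/-- The lower entry of the coefficient of `λ⁻ⁿ` in the formal resolvent of the potential `ψ`. -/
abbrev lowerCoeff (ψ : 𝓢(ℝ, ℂ)) (n : ℕ) : schwartzAlg :=
  PowerSeries.coeff n (resLower dx (toAlgConj ψ) (toAlg ψ))

lemma diagCoeff_succ_apply (ψ : 𝓢(ℝ, ℂ)) (n : ℕ) (x : ℝ) : (diagCoeff ψ (n + 1)).1 x =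
    -Complex.I * ∑ j : Fin n, ((diagCoeff ψ (j.val + 1)).1 x * (diagCoeff ψ (n - j.val)).1 x
      + (upperCoeff ψ (j.val + 1)).1 x * (lowerCoeff ψ (n - j.val)).1 x) := by
  rw [diagCoeff, coeff_succ_resDiag]
  simp [Finset.sum_apply]

lemma upperCoeff_succ_apply (ψ : 𝓢(ℝ, ℂ)) (n : ℕ) (x : ℝ) : (upperCoeff ψ (n + 1)).1 x =
    Complex.I * (deriv (upperCoeff ψ n).1 x + 2 * conj (ψ x) * (diagCoeff ψ n).1 x) := by
  have h2 : ((2 : schwartzAlg) : ℝ → ℂ) x = 2 := rfl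
  rw [upperCoeff, coeff_succ_resUpper, ← dx_apply]
  simp [toAlgConj_apply, mul_assoc, mul_add, h2]

lemma lowerCoeff_succ_apply (ψ : 𝓢(ℝ, ℂ)) (n : ℕ) (x : ℝ) : (lowerCoeff ψ (n + 1)).1 x =
    -Complex.I * (deriv (lowerCoeff ψ n).1 x - 2 * ψ x * (diagCoeff ψ n).1 x) := by
  have h2 : ((2 : schwartzAlg) : ℝ → ℂ) x = 2 := rfl
  rw [lowerCoeff, coeff_succ_resLower, ← dx_apply]
  simp [toAlg_apply, mul_assoc, h2]

/-- The matrices `Q_n` are the coefficients of the formal resolvent: both satisfy the same recursion. -/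
lemma laxCoeff_eq (ψ : 𝓢(ℝ, ℂ)) (n : ℕ) (x : ℝ) : laxCoeff ψ n x =
    !![(diagCoeff ψ n).1 x, (upperCoeff ψ n).1 x; (lowerCoeff ψ n).1 x, -(diagCoeff ψ n).1 x] := by
  induction n using Nat.strong_induction_on generalizing x with
  | _ n ih =>
    rcases n with _ | n
    · rw [laxCoeff, diagCoeff, upperCoeff, lowerCoeff, coeff_zero_resDiag, coeff_zero_resUpper,
        coeff_zero_resLower]
      ext i k
      fin_cases i <;> fin_cases k <;> simp [sigma3]
    · rw [laxCoeff]
      have e1 : (fun y => laxCoeff ψ n y 0 1) = (upperCoeff ψ n).1 := by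
        ext y
        rw [ih n n.lt_succ_self]
        rfl
      have e2 : (fun y => laxCoeff ψ n y 1 0) = (lowerCoeff ψ n).1 := by
        ext y
        rw [ih n n.lt_succ_self]
        rfl
      have e3 : ∀ j : Fin n, (laxCoeff ψ (j.val + 1) x * laxCoeff ψ (n - j.val) x) 0 0 =
          (diagCoeff ψ (j.val + 1)).1 x * (diagCoeff ψ (n - j.val)).1 x
            + (upperCoeff ψ (j.val + 1)).1 x * (lowerCoeff ψ (n - j.val)).1 x := fun j => by
        rw [ih _ (by omega), ih _ (by omega)]
        simp [Matrix.mul_apply, Fin.sum_univ_two]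
      have e4 : laxCoeff ψ n x 0 0 = (diagCoeff ψ n).1 x := by
        rw [ih n n.lt_succ_self]
        rfl
      simp only [e1, e2, e3, e4]
      rw [diagCoeff_succ_apply, upperCoeff_succ_apply, lowerCoeff_succ_apply]

/-! ### The variation of the conserved densities -/

section Generic

open PowerSeries

variable {R : Type*} [CommRing R] [Algebra ℂ R] (d : Derivation ℂ R R)

/-- Evaluation of polynomials at a constant, as a map of complex algebras. -/
def evalConst (t : ℂ) : Polynomial R →ₐ[ℂ] R :=
  (Polynomial.aeval (algebraMap ℂ R t)).restrictScalars ℂ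

lemma evalConst_apply (t : ℂ) (P : Polynomial R) :
    evalConst t P = P.eval (algebraMap ℂ R t) := by
  simp [evalConst, Polynomial.aeval_def, Polynomial.eval₂_eq_eval_map]

lemma evalConst_polyDeriv (t : ℂ) (P : Polynomial R) :
    evalConst t (polyDeriv d P) = d (evalConst t P) := by
  induction P using Polynomial.induction_on' with
  | add P Q hP hQ => rw [map_add, map_add, hP, hQ, map_add, map_add]
  | monomial m a =>
    rw [polyDeriv_monomial, evalConst_apply, evalConst_apply, Polynomial.eval_monomial,
      Polynomial.eval_monomial, ← map_pow, mul_comm, mul_comm a, ← Algebra.smul_def,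
      ← Algebra.smul_def, Derivation.map_smul]

/-- Differentiation with respect to the polynomial variable. -/
def paramDeriv : Derivation ℂ (Polynomial R) (Polynomial R) :=
  (Polynomial.derivative' (R := R)).restrictScalars ℂ

lemma paramDeriv_apply (P : Polynomial R) : paramDeriv P = Polynomial.derivative P := rfl

lemma polyDeriv_paramDeriv (P : Polynomial R) :
    polyDeriv d (paramDeriv P) = paramDeriv (polyDeriv d P) := by
  ext n
  rw [paramDeriv_apply, paramDeriv_apply, coeff_polyDeriv, Polynomial.coeff_derivative,
    Polynomial.coeff_derivative, coeff_polyDeriv, ← Nat.cast_succ, mul_comm, ← nsmul_eq_mul,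
    map_nsmul, nsmul_eq_mul, mul_comm]

/-- The straight line with initial point `p` and velocity `w`. -/
def linePoly (p w : R) : Polynomial R := Polynomial.C p + Polynomial.X * Polynomial.C w

lemma evalConst_linePoly (t : ℂ) (p w : R) : evalConst t (linePoly p w) = p + t • w := by
  rw [evalConst_apply, linePoly, Algebra.smul_def]
  simp [mul_comm w]

lemma paramDeriv_linePoly (p w : R) : paramDeriv (linePoly p w) = Polynomial.C w := by
  simp [paramDeriv_apply, linePoly]

omit [Algebra ℂ R] in
lemma linePoly_mem {I : Ideal R} {p w : R} (hp : p ∈ I) (hw : w ∈ I) :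
    linePoly p w ∈ I.map Polynomial.C :=
  Ideal.add_mem _ (Ideal.mem_map_of_mem _ hp) (Ideal.mul_mem_left _ _ (Ideal.mem_map_of_mem _ hw))

lemma evalConst_riccatiSeq (κ : ℂ) (t : ℂ) (P Q : Polynomial R) (n : ℕ) :
    evalConst t (riccatiSeq (polyDeriv d) κ P Q n) =
      riccatiSeq d κ (evalConst t P) (evalConst t Q) n :=
  riccatiSeq_map _ _ _ _ _ _ (evalConst_polyDeriv d t) n

/-- `variation_eq_add_deriv` for a straight line in the space of potentials: the polynomials over `R`
form a differential algebra with the parameter of the line as variable, and the coefficient of degree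
one of a polynomial is its derivative at the initial point. -/
lemma coeff_one_linePoly_mul_riccatiSeq {I : Ideal R} (hI : ∀ x ∈ I, d x ∈ I) {p q : R} (hp : p ∈ I)
    (w v : R) (n : ℕ) : ∃ b ∈ I,
    (linePoly p w * riccatiSeq (polyDeriv d) (-Complex.I) (linePoly p w) (linePoly q v) n).coeff 1 =
      w * coeff n (serR d p q * serE d p q) - v * coeff n (serS d p q * serE d p q) + d b := by
  set P := linePoly p w with hP
  set Q := linePoly q v with hQ
  set r := serR (polyDeriv d) P Q with hr
  set s := serS (polyDeriv d) P Q with hs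
  set E := serE (polyDeriv d) P Q with hE
  set φ : Polynomial R →+* R := (evalConst (R := R) 0).toRingHom with hφ
  have eP : φ P = p := (evalConst_linePoly 0 p w).trans (by simp)
  have eQ : φ Q = q := (evalConst_linePoly 0 q v).trans (by simp)
  have er : PowerSeries.map φ r = serR d p q := by
    ext n
    rw [coeff_map, hr, serR, serR, riccatiSeries, riccatiSeries, coeff_mk, coeff_mk, ← eP, ← eQ]
    exact evalConst_riccatiSeq d _ 0 P Q n
  have es : PowerSeries.map φ s = serS d p q := by
    ext n
    rw [coeff_map, hs, serS, serS, riccatiSeries, riccatiSeries, coeff_mk, coeff_mk, ← eP, ← eQ]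
    exact evalConst_riccatiSeq d _ 0 Q P n
  have eE : PowerSeries.map φ E = serE d p q := by
    have h := congrArg (PowerSeries.map φ) (serE_eq (polyDeriv d) P Q)
    rw [map_mul, map_sub, map_mul, map_one, ← hr, ← hs, ← hE, er, es] at h
    have h' := serE_eq d p q
    linear_combination serE d p q * h - PowerSeries.map φ E * h'
  have h := variation_eq_add_deriv (seriesDeriv (polyDeriv d)) (seriesDeriv paramDeriv)
    (serR_eq (polyDeriv d) P Q) (serS_eq (polyDeriv d) P Q) (serE_eq (polyDeriv d) P Q)
    (by
      ext n
      rw [coeff_seriesDeriv, coeff_X]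
      split_ifs <;> simp)
    (by
      ext1 n
      simp only [coeff_seriesDeriv, polyDeriv_paramDeriv])
  have hC : ∀ a : Polynomial R, seriesDeriv paramDeriv (C a) = C (paramDeriv a) := fun a => by
    ext n : 1
    rw [coeff_seriesDeriv, coeff_C, coeff_C]
    split_ifs <;> simp
  have dP : paramDeriv P = Polynomial.C w := paramDeriv_linePoly p w
  have dQ : paramDeriv Q = Polynomial.C v := paramDeriv_linePoly q v
  rw [← hr, ← hs, ← hE, hC, hC, dP, dQ] at h
  have e0 : ∀ T : Polynomial R, φ (paramDeriv T) = T.coeff 1 := fun T => by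
    rw [paramDeriv_apply]
    change evalConst 0 _ = _
    rw [evalConst_apply, map_zero, ← Polynomial.coeff_zero_eq_eval_zero, Polynomial.coeff_derivative]
    simp
  have ed : ∀ T : Polynomial R, φ (polyDeriv d T) = d (φ T) := evalConst_polyDeriv d 0
  have eC : ∀ a : R, φ (Polynomial.C a) = a := fun a => by
    change evalConst 0 _ = _
    rw [evalConst_apply, Polynomial.eval_C]
  have h1 := congrArg φ (congrArg (coeff (n + 1)) h)
  rw [coeff_succ_X_mul, coeff_succ_X_mul, coeff_seriesDeriv, coeff_C_mul, map_add, coeff_seriesDeriv,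
    sub_mul, mul_assoc, mul_assoc,
    map_sub, coeff_C_mul, coeff_C_mul, map_add, e0, ed, map_sub, map_mul φ, map_mul φ, eC, eC,
    ← coeff_map φ, ← coeff_map φ, map_mul (PowerSeries.map φ), map_mul (PowerSeries.map φ), er, es, eE, hr, serR, riccatiSeries, coeff_mk] at h1
  refine ⟨_, ?_, h1⟩
  rw [← coeff_map φ, map_mul (PowerSeries.map φ), es, coeff_mul]
  refine I.sum_mem fun ij _ => I.mul_mem_right _ ?_
  rw [serS, riccatiSeries, coeff_mk]
  exact riccatiSeq_mem d _ q p I hI hp _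

end Generic

/-- The coefficients of the expansion of `r` in powers of `1/λ`. -/
def ricSeq (ψ : 𝓢(ℝ, ℂ)) (n : ℕ) : schwartzAlg :=
  riccatiSeq dx (-Complex.I) (toAlgConj ψ) (toAlg ψ) n

lemma ricSeq_mem (ψ : 𝓢(ℝ, ℂ)) (n : ℕ) : ricSeq ψ n ∈ schwartzIdeal :=
  riccatiSeq_mem _ _ _ _ _ (fun f _ => dx_mem_schwartzIdeal f) (toAlg_mem ψ) n

/-- The coefficients of the expansion of `log a` in powers of `1/λ`. -/
def logCoeff (n : ℕ) (ψ : 𝓢(ℝ, ℂ)) : ℂ := ∫ x, conj (ψ x) * (ricSeq ψ n).1 x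

lemma toAlg_line (ψ v : 𝓢(ℝ, ℂ)) (t : ℝ) : toAlg (ψ + t • v) = toAlg ψ + (t : ℂ) • toAlg v := by
  ext x
  simp [toAlg_apply]

lemma toAlgConj_line (ψ v : 𝓢(ℝ, ℂ)) (t : ℝ) :
    toAlgConj (ψ + t • v) = toAlgConj ψ + (t : ℂ) • toAlgConj v := by
  ext x
  simp [toAlgConj_apply]

lemma conj_mul_ricSeq_line (ψ v : 𝓢(ℝ, ℂ)) (n : ℕ) (t : ℝ) :
    toAlgConj (ψ + t • v) * ricSeq (ψ + t • v) n =
      evalConst (t : ℂ) (linePoly (toAlgConj ψ) (toAlgConj v) * riccatiSeq (polyDeriv dx) (-Complex.I)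
        (linePoly (toAlgConj ψ) (toAlgConj v)) (linePoly (toAlg ψ) (toAlg v)) n) := by
  rw [map_mul, evalConst_riccatiSeq, evalConst_linePoly, evalConst_linePoly, ← toAlg_line,
    ← toAlgConj_line, ricSeq]

/-- The integral of a polynomial in `t` with Schwartz coefficients is a polynomial in `t`. -/
lemma integral_evalConst {P : Polynomial schwartzAlg} (hP : ∀ n, P.coeff n ∈ schwartzIdeal) (t : ℂ) :
    ∫ x, (evalConst t P).1 x =
      (∑ j ∈ Finset.range (P.natDegree + 1), Polynomial.monomial j (∫ x, (P.coeff j).1 x)).eval t := by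
  have h : (evalConst t P).1 =
      fun x => ∑ j ∈ Finset.range (P.natDegree + 1), (P.coeff j).1 x * t ^ j := by
    ext x
    rw [evalConst_apply, Polynomial.eval_eq_sum_range]
    simp [Finset.sum_apply, Algebra.algebraMap_eq_smul_one]
  rw [h, integral_finsetSum _ fun j _ => (integrable_of_mem_schwartzIdeal (hP j)).mul_const _,
    Polynomial.eval_finsetSum]
  exact Finset.sum_congr rfl fun j _ => by rw [integral_mul_const, Polynomial.eval_monomial]

/-- The variation of the coefficients of `log a`, in terms of the formal resolvent. -/
lemma hasLineDerivAt_logCoeff (n : ℕ) (ψ v : 𝓢(ℝ, ℂ)) : HasLineDerivAt ℝ (logCoeff n)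
    (Complex.I * ∫ x, (conj (v x) * (lowerCoeff ψ n).1 x + v x * (upperCoeff ψ n).1 x)) ψ v := by
  set P := linePoly (toAlgConj ψ) (toAlgConj v) * riccatiSeq (polyDeriv dx) (-Complex.I)
        (linePoly (toAlgConj ψ) (toAlgConj v)) (linePoly (toAlg ψ) (toAlg v)) n with hPdef
  have hP : ∀ n, P.coeff n ∈ schwartzIdeal := fun k =>
    Ideal.mem_map_C_iff.1 (Ideal.mul_mem_right _ _ (linePoly_mem (toAlgConj_mem ψ) (toAlgConj_mem v))) k
  have h1 : ∀ t : ℝ, logCoeff n (ψ + t • v) =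
      (∑ j ∈ Finset.range (P.natDegree + 1), Polynomial.monomial j (∫ x, (P.coeff j).1 x)).eval (t : ℂ) :=
    fun t => by
      rw [← integral_evalConst hP, ← conj_mul_ricSeq_line]
      rfl
  obtain ⟨b, hb, hb1⟩ := coeff_one_linePoly_mul_riccatiSeq dx (fun f (_ : f ∈ schwartzIdeal) =>
    dx_mem_schwartzIdeal f) (toAlgConj_mem ψ) (q := toAlg ψ) (toAlgConj v) (toAlg v) n
  have h2 : ∫ x, (P.coeff 1).1 x =
      Complex.I * ∫ x, (conj (v x) * (lowerCoeff ψ n).1 x + v x * (upperCoeff ψ n).1 x) := by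
    have e : P.coeff 1 = Complex.I • (toAlgConj v * lowerCoeff ψ n + toAlg v * upperCoeff ψ n) + dx b := by
      rw [hPdef, hb1, lowerCoeff, upperCoeff, resLower, resUpper, ← Algebra.smul_def, ← Algebra.smul_def,
        map_neg, PowerSeries.coeff_smul, PowerSeries.coeff_smul, Algebra.smul_def, Algebra.smul_def,
        Algebra.smul_def]
      linear_combination (toAlgConj v * PowerSeries.coeff n (serR dx (toAlgConj ψ) (toAlg ψ)
        * serE dx (toAlgConj ψ) (toAlg ψ)) - toAlg v * PowerSeries.coeff n (serS dx (toAlgConj ψ) (toAlg ψ)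
        * serE dx (toAlgConj ψ) (toAlg ψ))) * algebraMap_I_sq (S := schwartzAlg)
    have hi : (toAlgConj v * lowerCoeff ψ n + toAlg v * upperCoeff ψ n) ∈ schwartzIdeal :=
      Ideal.add_mem _ (Ideal.mul_mem_right _ _ (toAlgConj_mem v)) (Ideal.mul_mem_right _ _ (toAlg_mem v))
    rw [e]
    refine (integral_add ((integrable_of_mem_schwartzIdeal hi).const_mul Complex.I)
      (integrable_of_mem_schwartzIdeal (dx_mem_schwartzIdeal b))).trans ?_
    rw [integral_dx hb, add_zero, integral_const_mul]
    rfl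
  rw [HasLineDerivAt]
  simp only [h1]
  have h3 := (Polynomial.hasDerivAt (∑ j ∈ Finset.range (P.natDegree + 1), Polynomial.monomial j
    (∫ x, (P.coeff j).1 x)) ((0 : ℝ) : ℂ)).comp_ofReal
  refine h3.congr_deriv ?_
  rw [← h2, Complex.ofReal_zero, ← Polynomial.coeff_zero_eq_eval_zero, Polynomial.coeff_derivative,
    Polynomial.finsetSum_coeff]
  simp only [Polynomial.coeff_monomial, zero_add, Nat.cast_zero, mul_one, Finset.sum_ite_eq',
    Finset.mem_range]
  split_ifs with h4
  · rfl
  · rw [Polynomial.coeff_eq_zero_of_natDegree_lt (by omega)]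
    simp

/-! ### The asymptotic expansion of `log a` -/

/-- A truncated power series, squared, differs from the truncation of the square by terms of higher
order. -/
lemma norm_sq_sub_cauchy_le (a : ℕ → ℂ) (n : ℕ) {z : ℂ} (hz : ‖z‖ ≤ 1) :
    ‖(∑ i ∈ Finset.range n, a i * z ^ i) ^ 2 - ∑ k ∈ Finset.range n,
      (∑ ij ∈ Finset.HasAntidiagonal.antidiagonal k, a ij.1 * a ij.2) * z ^ k‖ ≤
      ‖z‖ ^ n * (∑ i ∈ Finset.range n, ‖a i‖) ^ 2 := by
  have h1 : ∑ k ∈ Finset.range n, (∑ ij ∈ Finset.HasAntidiagonal.antidiagonal k, a ij.1 * a ij.2) * z ^ k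
      = ∑ i ∈ Finset.range n, ∑ j ∈ Finset.range (n - i), (a i * z ^ i) * (a j * z ^ j) := by
    rw [← Finset.sum_range_diag_flip n fun i j => (a i * z ^ i) * (a j * z ^ j)]
    refine Finset.sum_congr rfl fun k _ => ?_
    rw [Finset.Nat.sum_antidiagonal_eq_sum_range_succ (fun i j => a i * a j), Finset.sum_mul]
    refine Finset.sum_congr rfl fun i hi => ?_
    have hi' : i + (k - i) = k := by
      have := Finset.mem_range.1 hi
      omega
    calc _ = a i * a (k - i) * z ^ (i + (k - i)) := by rw [hi']
      _ = _ := by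
        rw [pow_add]
        ring
  have h2 : (∑ i ∈ Finset.range n, a i * z ^ i) ^ 2 - ∑ k ∈ Finset.range n,
      (∑ ij ∈ Finset.HasAntidiagonal.antidiagonal k, a ij.1 * a ij.2) * z ^ k =
      ∑ i ∈ Finset.range n, ∑ j ∈ Finset.Ico (n - i) n, (a i * z ^ i) * (a j * z ^ j) := by
    rw [h1, pow_two, Finset.sum_mul_sum, ← Finset.sum_sub_distrib]
    refine Finset.sum_congr rfl fun i _ => ?_
    rw [Finset.sum_Ico_eq_sub _ (Nat.sub_le n i)]
  rw [h2, pow_two, Finset.sum_mul_sum, Finset.mul_sum]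
  refine norm_sum_le_of_le _ fun i _ => ?_
  rw [Finset.mul_sum]
  have h4 : ∀ j ∈ Finset.Ico (n - i) n, ‖(a i * z ^ i) * (a j * z ^ j)‖ ≤ ‖z‖ ^ n * (‖a i‖ * ‖a j‖) :=
    fun j hj => by
      have hj' := Finset.mem_Ico.1 hj
      have h3 : ‖z‖ ^ (i + j) ≤ ‖z‖ ^ n := pow_le_pow_of_le_one (norm_nonneg _) hz (by omega)
      calc _ = ‖z‖ ^ (i + j) * (‖a i‖ * ‖a j‖) := by
            rw [norm_mul, norm_mul, norm_mul, norm_pow, norm_pow, pow_add]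
            ring
        _ ≤ _ := mul_le_mul_of_nonneg_right h3 (by positivity)
  exact (norm_sum_le_of_le _ h4).trans (Finset.sum_le_sum_of_subset_of_nonneg
    (fun j hj => Finset.mem_range.2 (Finset.mem_Ico.1 hj).2) fun j _ _ => by positivity)

lemma exists_norm_le_of_mem {f : schwartzAlg} (hf : f ∈ schwartzIdeal) :
    ∃ M, ∀ x, ‖f.1 x‖ ≤ M := by
  obtain ⟨φ, h⟩ := hf
  obtain ⟨M, -, hM⟩ := exists_norm_le φ
  exact ⟨M, fun x => (h x).symm ▸ hM x⟩

lemma continuous_schwartzAlg (f : schwartzAlg) : Continuous f.1 :=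
  (differentiable_schwartzAlg f).continuous

lemma hasDerivAt_ricSeq (ψ : 𝓢(ℝ, ℂ)) (n : ℕ) (x : ℝ) : HasDerivAt (ricSeq ψ n).1
    (Complex.I * (ricSeq ψ (n + 1)).1 x - conj (ψ x) * ∑ ij ∈ Finset.HasAntidiagonal.antidiagonal n,
      (ricSeq ψ ij.1).1 x * (ricSeq ψ ij.2).1 x + if n = 0 then ψ x else 0) x := by
  refine (hasDerivAt_schwartzAlg _ x).congr_deriv ?_
  have h : Complex.I • ricSeq ψ (n + 1) = dx (ricSeq ψ n) + toAlgConj ψ *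
      ∑ ij ∈ Finset.HasAntidiagonal.antidiagonal n, ricSeq ψ ij.1 * ricSeq ψ ij.2
      - if n = 0 then toAlg ψ else 0 := by
    rw [ricSeq, riccatiSeq_succ, smul_smul]
    simp only [mul_neg, Complex.I_mul_I, neg_neg, one_smul, ricSeq]
  have h1 := congrFun (congrArg Subtype.val h) x
  simp only [Subalgebra.coe_smul, Subalgebra.coe_add, Subalgebra.coe_sub, Subalgebra.coe_mul,
    Pi.smul_apply, Pi.add_apply, Pi.sub_apply, Pi.mul_apply, smul_eq_mul,
    AddSubmonoidClass.coe_finsetSum, Finset.sum_apply, toAlgConj_apply] at h1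
  have h2 : (if n = 0 then toAlg ψ else 0 : schwartzAlg).1 x = if n = 0 then ψ x else 0 := by
    split_ifs <;> rfl
  rw [h2] at h1
  rw [h1]
  ring

/-- The asymptotic expansion of `r`, uniform in `x` and in the half-plane `Im λ > 0`: the remainder `e`
satisfies `e' = (iλ - ψ̄ (r + S)) e + O(λ⁻ⁿ)`, where `S` is the partial sum and the last term is bounded
by an integrable function of `x`. -/
lemma exists_norm_ric_sub_le (ψ : 𝓢(ℝ, ℂ)) (n : ℕ) : ∃ C, ∀ lam : ℂ, 0 < lam.im → 1 ≤ ‖lam‖ → ∀ x,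
    ‖ric ψ lam x - ∑ i ∈ Finset.range (n + 1), (ricSeq ψ i).1 x * lam⁻¹ ^ i‖ ≤ C * ‖lam‖⁻¹ ^ n := by
  choose K hK using fun i => exists_norm_le_of_mem (ricSeq_mem ψ i)
  set k := ∑ i ∈ Finset.range (n + 1), K i with hk
  have hsum : ∀ x, ∑ i ∈ Finset.range (n + 1), ‖(ricSeq ψ i).1 x‖ ≤ k := fun x =>
    Finset.sum_le_sum fun i _ => hK i x
  set m : ℝ → ℝ := fun x => ‖(ricSeq ψ (n + 1)).1 x‖ + ‖ψ x‖ * k ^ 2 with hm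
  have hmi : Integrable m := (integrable_of_mem_schwartzIdeal (ricSeq_mem ψ _)).norm.add
    ((integrable_norm ψ).mul_const _)
  refine ⟨Real.exp ((∫ x, ‖ψ x‖) * (1 + k)) * ∫ x, m x, fun lam hl h1 x => ?_⟩
  have h0 : lam ≠ 0 := norm_pos_iff.1 (by linarith)
  set z := lam⁻¹ with hz
  have hz1 : ‖z‖ ≤ 1 := by
    rw [hz, norm_inv]
    exact inv_le_one_of_one_le₀ h1
  set s : ℝ → ℂ := fun x => ∑ i ∈ Finset.range (n + 1), (ricSeq ψ i).1 x * z ^ i with hs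
  have hsc : Continuous s := continuous_finsetSum _ fun i _ =>
    (continuous_schwartzAlg _).mul continuous_const
  have hsn : ∀ x, ‖s x‖ ≤ k := fun x => by
    refine (norm_sum_le_of_le _ fun i _ => ?_).trans (hsum x)
    rw [norm_mul, norm_pow]
    exact mul_le_of_le_one_right (norm_nonneg _) (pow_le_one₀ (norm_nonneg _) hz1)
  set W : ℝ → ℂ := fun x => s x ^ 2 - ∑ j ∈ Finset.range (n + 1),
    (∑ ij ∈ Finset.HasAntidiagonal.antidiagonal j, (ricSeq ψ ij.1).1 x * (ricSeq ψ ij.2).1 x) * z ^ j with hW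
  have hWc : Continuous W := (hsc.pow 2).sub (continuous_finsetSum _ fun j _ =>
    (continuous_finsetSum _ fun ij _ => (continuous_schwartzAlg _).mul (continuous_schwartzAlg _)).mul
      continuous_const)
  have hWn : ∀ x, ‖W x‖ ≤ ‖z‖ ^ n * k ^ 2 := fun x => by
    refine (norm_sq_sub_cauchy_le (fun i => (ricSeq ψ i).1 x) (n + 1) hz1).trans ?_
    exact mul_le_mul (pow_le_pow_of_le_one (norm_nonneg _) hz1 n.le_succ)
      (pow_le_pow_left₀ (Finset.sum_nonneg fun i _ => norm_nonneg _) (hsum x) 2) (by positivity)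
      (by positivity)
  have hsd : ∀ x, HasDerivAt s (Complex.I * lam * s x + Complex.I * (ricSeq ψ (n + 1)).1 x * z ^ n
      - conj (ψ x) * (s x ^ 2 - W x) + ψ x) x := fun x => by
    refine (HasDerivAt.fun_sum fun i _ => (hasDerivAt_ricSeq ψ i x).mul_const (z ^ i)).congr_deriv ?_
    have e1 : ∑ i ∈ Finset.range (n + 1), (ricSeq ψ (i + 1)).1 x * z ^ i =
        lam * s x + (ricSeq ψ (n + 1)).1 x * z ^ n := by
      rw [Finset.sum_range_succ, show s x = ∑ i ∈ Finset.range (n + 1), (ricSeq ψ i).1 x * z ^ i from rfl,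
        Finset.sum_range_succ' _ n, mul_add, Finset.mul_sum]
      have e0 : (ricSeq ψ 0).1 x = 0 := by
        rw [ricSeq, riccatiSeq_zero]
        rfl
      rw [e0, zero_mul, mul_zero, add_zero]
      congr 1
      refine Finset.sum_congr rfl fun i _ => ?_
      rw [pow_succ, hz]
      field_simp
    have e2 : ∑ i ∈ Finset.range (n + 1), (if i = 0 then ψ x else 0) * z ^ i = ψ x := by
      rw [Finset.sum_range_succ']
      simp
    simp only [sub_mul, add_mul, Finset.sum_add_distrib, Finset.sum_sub_distrib, e2, mul_assoc,
      ← Finset.mul_sum, e1, hW]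
    ring
  set g : ℝ → ℂ := fun y => -(ric ψ lam y + s y) with hg
  have hgc : Continuous g := ((continuous_ric ψ hl).add hsc).neg
  have hgn : ∀ y, ‖g y‖ ≤ 1 + k := fun y => by
    rw [hg, norm_neg]
    exact (norm_add_le _ _).trans (add_le_add (norm_ric_lt_one ψ hl y).le (hsn y))
  have hbc : Continuous fun y => conj (ψ y) * g y := (continuous_conj_coe ψ).mul hgc
  have hbi := integrable_conj_mul ψ hgc hgn
  have hbB := integral_norm_conj_mul_le ψ hgc hgn
  set Rem : ℝ → ℂ := fun x => -(Complex.I * (ricSeq ψ (n + 1)).1 x * z ^ n + conj (ψ x) * W x) with hRem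
  have hRc : Continuous Rem := (((continuous_const.mul (continuous_schwartzAlg _)).mul
    continuous_const).add ((continuous_conj_coe ψ).mul hWc)).neg
  have hRn : ∀ x, ‖Rem x‖ ≤ ‖z‖ ^ n * m x := fun x => by
    rw [hRem, norm_neg]
    refine (norm_add_le _ _).trans ?_
    rw [norm_mul, norm_mul, norm_mul, Complex.norm_I, one_mul, norm_pow, RCLike.norm_conj, hm]
    nlinarith [mul_le_mul_of_nonneg_left (hWn x) (norm_nonneg (ψ x))]
  have hRi : Integrable Rem := (hmi.const_mul _).mono' hRc.aestronglyMeasurable (Eventually.of_forall hRn)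
  have hlin := eq_linSol (e := fun x => ric ψ lam x - s x) hl
    hbc hbi ⟨hRc, Or.inr ⟨hl.le, hRi⟩⟩
    (fun x => ((hasDerivAt_ric ψ hl x).sub (hsd x)).congr_deriv (by
      simp only [hRem, hg]
      ring)) (1 + k) (fun x => (norm_sub_le _ _).trans (add_le_add (norm_ric_lt_one ψ hl x).le (hsn x)))
  have hfin := norm_linSol_le_integral hl.le hbi hbB (hmi.const_mul (‖z‖ ^ n)) hRn x
  rw [← hlin, integral_const_mul] at hfin
  refine hfin.trans (le_of_eq ?_)
  rw [hz, norm_inv]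
  ring

/-- The asymptotic expansion of `log a`, to all orders. -/
lemma exists_norm_logA_sub_le (ψ : 𝓢(ℝ, ℂ)) (n : ℕ) : ∃ C, ∀ lam : ℂ, 0 < lam.im → 1 ≤ ‖lam‖ →
    ‖logA ψ lam - ∑ i ∈ Finset.range n, logCoeff i ψ * lam⁻¹ ^ i‖ ≤ C * ‖lam‖⁻¹ ^ n := by
  obtain ⟨C, hC⟩ := exists_norm_ric_sub_le ψ n
  refine ⟨(∫ x, ‖ψ x‖) * C + ‖logCoeff n ψ‖, fun lam hl h1 => ?_⟩
  have hi : ∀ i, Integrable fun x => conj (ψ x) * (ricSeq ψ i).1 x := fun i => by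
    obtain ⟨M, hM⟩ := exists_norm_le_of_mem (ricSeq_mem ψ i)
    exact integrable_conj_mul ψ (continuous_schwartzAlg _) hM
  have hc : Continuous fun x => ric ψ lam x - ∑ i ∈ Finset.range (n + 1), (ricSeq ψ i).1 x * lam⁻¹ ^ i :=
    (continuous_ric ψ hl).sub (continuous_finsetSum _ fun i _ =>
      (continuous_schwartzAlg _).mul continuous_const)
  have h2 : logA ψ lam - ∑ i ∈ Finset.range (n + 1), logCoeff i ψ * lam⁻¹ ^ i = ∫ x, conj (ψ x) *
      (ric ψ lam x - ∑ i ∈ Finset.range (n + 1), (ricSeq ψ i).1 x * lam⁻¹ ^ i) := by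
    have h3 : ∑ i ∈ Finset.range (n + 1), logCoeff i ψ * lam⁻¹ ^ i =
        ∫ x, ∑ i ∈ Finset.range (n + 1), conj (ψ x) * (ricSeq ψ i).1 x * lam⁻¹ ^ i := by
      rw [integral_finsetSum _ fun i _ => (hi i).mul_const _]
      exact Finset.sum_congr rfl fun i _ => (integral_mul_const _ _).symm
    rw [h3, logA, ← integral_sub (integrable_conj_mul_ric ψ hl)
      (integrable_finsetSum _ fun i _ => (hi i).mul_const _)]
    congr 1
    ext x
    rw [mul_sub, Finset.mul_sum]
    simp only [mul_assoc]
  have h4 := (norm_integral_le_integral_norm _).trans (integral_norm_conj_mul_le ψ hc (hC lam hl h1))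
  rw [← h2, Finset.sum_range_succ] at h4
  calc _ ≤ ‖logA ψ lam - (∑ i ∈ Finset.range n, logCoeff i ψ * lam⁻¹ ^ i + logCoeff n ψ * lam⁻¹ ^ n)‖
        + ‖logCoeff n ψ * lam⁻¹ ^ n‖ := by
        refine (norm_add_le _ _).trans' (le_of_eq ?_)
        congr 1
        ring
    _ ≤ _ := by
        rw [norm_mul, norm_pow, norm_inv]
        nlinarith [h4]

lemma logCoeff_zero (ψ : 𝓢(ℝ, ℂ)) : logCoeff 0 ψ = 0 := by
  have h : ∀ x, (ricSeq ψ 0).1 x = 0 := fun x => by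
    rw [ricSeq, riccatiSeq_zero]
    rfl
  simp [logCoeff, h]

/-- The quasimomentum `p_∞ = (i/2) log a`. -/
def quasimomentum (ψ : 𝓢(ℝ, ℂ)) (lam : ℂ) : ℂ := Complex.I / 2 * logA ψ lam

lemma isQuasimomentum_quasimomentum (ψ : 𝓢(ℝ, ℂ)) : IsQuasimomentum ψ (quasimomentum ψ) := by
  refine ⟨fun z hz => ((differentiableAt_logA ψ hz).const_mul _).differentiableWithinAt,
    fun z hz => ?_, ?_⟩
  · rw [coeffA_eq ψ hz, quasimomentum, logA]
    congr 1
    rw [← mul_assoc, show -2 * Complex.I * (Complex.I / 2) = -(Complex.I * Complex.I) by ring,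
      Complex.I_mul_I, neg_neg, one_mul]
  · obtain ⟨C, hC⟩ := exists_norm_logA_sub_le ψ 1
    have h0 : Tendsto (fun z : ℂ => C * ‖z‖⁻¹) (Bornology.cobounded ℂ ⊓ 𝓟 {z | 0 < z.im}) (𝓝 0) := by
      have := (tendsto_inv_atTop_zero.comp (tendsto_norm_cobounded_atTop (E := ℂ))).const_mul C
      rw [mul_zero] at this
      exact this.mono_left inf_le_left
    have h1 : Tendsto (logA ψ) (Bornology.cobounded ℂ ⊓ 𝓟 {z | 0 < z.im}) (𝓝 0) := by
      refine squeeze_zero_norm' ?_ h0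
      have h2 := (tendsto_norm_cobounded_atTop (E := ℂ)).eventually_ge_atTop 1
      filter_upwards [h2.filter_mono inf_le_left, mem_inf_of_right (mem_principal_self _)] with z hz hz'
      simpa [logCoeff_zero] using hC z hz' hz
    have := h1.const_mul (Complex.I / 2)
    rwa [mul_zero] at this

lemma hasExpansion_quasimomentum (ψ : 𝓢(ℝ, ℂ)) (N : ℕ) :
    HasExpansion upperSector (quasimomentum ψ) (fun s => Complex.I / 2 * logCoeff s ψ) N := by
  refine hasExpansion_of_le fun δ hδ => ?_
  obtain ⟨C, hC⟩ := exists_norm_logA_sub_le ψ (N + 1)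
  refine ⟨C / 2, 1, fun z hz h1 => ?_⟩
  have h2 := hC z (im_pos_of_mem_upperSector hδ hz) h1
  have h3 : quasimomentum ψ z - ∑ s ∈ Finset.range (N + 1), Complex.I / 2 * logCoeff s ψ * z⁻¹ ^ s =
      Complex.I / 2 * (logA ψ z - ∑ s ∈ Finset.range (N + 1), logCoeff s ψ * z⁻¹ ^ s) := by
    rw [quasimomentum, mul_sub, Finset.mul_sum]
    simp only [mul_assoc]
  rw [h3, norm_mul]
  have h4 : ‖Complex.I / 2‖ = 1 / 2 := by simp
  rw [h4]
  linarith

/-! ### Reality of the Hamiltonians -/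

lemma deriv_eq_conj_deriv {f g : schwartzAlg} (h : ∀ x, f.1 x = conj (g.1 x)) (x : ℝ) :
    deriv f.1 x = conj (deriv g.1 x) := by
  rw [show f.1 = fun x => conj (g.1 x) from funext h]
  exact (hasDerivAt_schwartzAlg g x).star.deriv

/-- The symmetry `σ₃ Q_n* σ₃ = -Q_n`. -/
lemma conj_resolvent (ψ : 𝓢(ℝ, ℂ)) (n : ℕ) : ∀ x,
    (diagCoeff ψ n).1 x = -conj ((diagCoeff ψ n).1 x) ∧
      (upperCoeff ψ n).1 x = conj ((lowerCoeff ψ n).1 x) := by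
  induction n using Nat.strong_induction_on with
  | _ n ih =>
    intro x
    rcases n with _ | n
    · rw [diagCoeff, upperCoeff, lowerCoeff, coeff_zero_resDiag, coeff_zero_resUpper,
        coeff_zero_resLower]
      simp [Algebra.algebraMap_eq_smul_one, map_ofNat, neg_div]
    · have hn := n.lt_succ_self
      rw [diagCoeff_succ_apply, upperCoeff_succ_apply, lowerCoeff_succ_apply]
      constructor
      · simp only [map_mul, map_neg, Complex.conj_I, map_sum, map_add]
        rw [neg_neg, ← neg_mul]
        congr 1
        rw [Finset.sum_add_distrib, Finset.sum_add_distrib]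
        congr 1
        · refine Finset.sum_congr rfl fun j _ => ?_
          have h1 := (ih (j.val + 1) (by omega) x).1
          have h2 := (ih (n - j.val) (by omega) x).1
          linear_combination (diagCoeff ψ (n - j.val)).1 x * h1 - conj ((diagCoeff ψ (j.val + 1)).1 x) * h2
        -- conjugation exchanges the two factors, hence the reversal of the order of summation
        · rw [← Equiv.sum_comp Fin.revPerm]
          refine Finset.sum_congr rfl fun j _ => ?_
          have e1 : (Fin.revPerm j).val + 1 = n - j.val := by
            rw [Fin.revPerm_apply, Fin.val_rev]
            omega
          have e2 : n - (Fin.revPerm j).val = j.val + 1 := by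
            rw [Fin.revPerm_apply, Fin.val_rev]
            omega
          rw [e1, e2, (ih (j.val + 1) (by omega) x).2, (ih (n - j.val) (by omega) x).2,
            Complex.conj_conj, mul_comm]
      · rw [deriv_eq_conj_deriv (fun y => (ih n hn y).2) x]
        have h := (ih n hn x).1
        simp only [map_mul, map_neg, map_sub, Complex.conj_I, neg_neg, map_ofNat]
        linear_combination 2 * Complex.I * conj (ψ x) * h

lemma lowerCoeff_mem (ψ : 𝓢(ℝ, ℂ)) (n : ℕ) : lowerCoeff ψ n ∈ schwartzIdeal := by
  rcases n with _ | n
  · rw [lowerCoeff, coeff_zero_resLower]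
    exact schwartzIdeal.zero_mem
  · rw [lowerCoeff, coeff_succ_resLower, Algebra.smul_def]
    exact schwartzIdeal.neg_mem (schwartzIdeal.mul_mem_left _ (schwartzIdeal.sub_mem
      (dx_mem_schwartzIdeal _) (schwartzIdeal.mul_mem_left _ (schwartzIdeal.mul_mem_right _ (toAlg_mem ψ)))))

lemma variation_real (ψ v : 𝓢(ℝ, ℂ)) (n : ℕ) :
    ∫ x, (conj (v x) * (lowerCoeff ψ n).1 x + v x * (upperCoeff ψ n).1 x) =
      ((∫ x, 2 * (conj (v x) * (lowerCoeff ψ n).1 x).re : ℝ) : ℂ) := by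
  rw [← integral_complex_ofReal]
  congr 1
  ext x
  rw [(conj_resolvent ψ n x).2]
  have h := Complex.add_conj (conj (v x) * (lowerCoeff ψ n).1 x)
  rw [map_mul, Complex.conj_conj] at h
  exact h

/-- The Hamiltonian `H_m = -(i/2) ∫ ψ̄ r_m`. Taking the real part changes nothing, by
`ofReal_hamiltonian`. -/
def hamiltonian (m : ℕ) (ψ : 𝓢(ℝ, ℂ)) : ℝ := (-(Complex.I / 2 * logCoeff m ψ)).re

/-- The coefficients of `log a` vanish at `ψ = 0`, and their derivative along the line `t ψ` is purely
imaginary. -/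
lemma logCoeff_re (n : ℕ) (ψ : 𝓢(ℝ, ℂ)) : (logCoeff n ψ).re = 0 := by
  have hd : ∀ t : ℝ, HasDerivAt (fun t : ℝ => (logCoeff n (t • ψ)).re) 0 t := fun t => by
    have h := hasLineDerivAt_logCoeff n (t • ψ) ψ
    rw [variation_real, HasLineDerivAt] at h
    rw [← sub_self t] at h
    have h1 := HasDerivAt.comp_sub_const t t h
    have h2 := Complex.reCLM.hasFDerivAt.comp_hasDerivAt t h1
    simp only [Complex.reCLM_apply, Function.comp_def, Complex.re_mul_ofReal, Complex.I_re,
      zero_mul, ← add_smul, add_sub_cancel] at h2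
    exact h2
  have h := is_const_of_deriv_eq_zero (fun t => (hd t).differentiableAt) (fun t => (hd t).deriv) 1 0
  simp only [one_smul, zero_smul] at h
  rw [h]
  simp [logCoeff]

lemma ofReal_hamiltonian (m : ℕ) (ψ : 𝓢(ℝ, ℂ)) :
    (hamiltonian m ψ : ℂ) = -(Complex.I / 2 * logCoeff m ψ) := by
  refine Complex.ext (by simp [hamiltonian]) ?_
  have := logCoeff_re m ψ
  simp [Complex.mul_im, this]

lemma areIntegralsOfMotion_hamiltonian (ψ : 𝓢(ℝ, ℂ)) :
    AreIntegralsOfMotion ψ fun m => hamiltonian m ψ := by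
  refine ⟨_, isQuasimomentum_quasimomentum ψ, fun N => ?_⟩
  convert hasExpansion_quasimomentum ψ N using 1
  ext s
  split_ifs with h
  · rw [h, logCoeff_zero, mul_zero]
  · rw [ofReal_hamiltonian, neg_neg]

lemma hasLineDerivAt_hamiltonian (m : ℕ) (ψ v : 𝓢(ℝ, ℂ)) : HasLineDerivAt ℝ (hamiltonian m)
    (∫ x, (conj (v x) * (lowerCoeff ψ m).1 x).re) ψ v := by
  have h := hasLineDerivAt_logCoeff m ψ v
  rw [variation_real, HasLineDerivAt] at h
  have h1 := Complex.reCLM.hasFDerivAt.comp_hasDerivAt 0 (h.const_mul (Complex.I / 2)).neg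
  refine h1.congr_deriv ?_
  rw [integral_const_mul, Complex.reCLM_apply, ← mul_assoc, ← neg_mul, Complex.re_mul_ofReal,
    show -(Complex.I / 2 * Complex.I) = ((1 / 2 : ℝ) : ℂ) from by
      push_cast
      linear_combination (-1 / 2) * Complex.I_mul_I, Complex.ofReal_re]
  ring

/-! ### The flows -/

lemma hasDerivAt_laxCoeff (ψ : 𝓢(ℝ, ℂ)) (n : ℕ) (x : ℝ) (i k : Fin 2) :
    HasDerivAt (fun y => laxCoeff ψ n y i k)
      ((matY ψ x * laxCoeff ψ n x - laxCoeff ψ n x * matY ψ x - (Complex.I / 2) •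
        (sigma3 * laxCoeff ψ (n + 1) x - laxCoeff ψ (n + 1) x * sigma3)) i k) x := by
  have hD := hasDerivAt_schwartzAlg (diagCoeff ψ n) x
  have hU := hasDerivAt_schwartzAlg (upperCoeff ψ n) x
  have hL := hasDerivAt_schwartzAlg (lowerCoeff ψ n) x
  have e1 : (dx (diagCoeff ψ n)).1 x = conj (ψ x) * (lowerCoeff ψ n).1 x - ψ x * (upperCoeff ψ n).1 x := by
    rw [diagCoeff, deriv_coeff_resDiag]
    rfl
  have e2 := upperCoeff_succ_apply ψ n x
  have e3 := lowerCoeff_succ_apply ψ n x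
  rw [← dx_apply] at e2 e3
  rw [laxCoeff_eq ψ (n + 1), laxCoeff_eq ψ n x]
  simp only [laxCoeff_eq ψ n]
  fin_cases i <;> fin_cases k
  · refine hD.congr_deriv ?_
    rw [e1]
    simp [matY, sigma3]
    ring
  · refine hU.congr_deriv ?_
    simp [matY, sigma3]
    linear_combination Complex.I * e2 + ((dx (upperCoeff ψ n)).1 x + 2 * conj (ψ x) * (diagCoeff ψ n).1 x) * Complex.I_mul_I
  · refine hL.congr_deriv ?_
    simp [matY, sigma3]
    linear_combination -Complex.I * e3 + ((dx (lowerCoeff ψ n)).1 x - 2 * ψ x * (diagCoeff ψ n).1 x) * Complex.I_mul_I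
  · refine hD.neg.congr_deriv ?_
    rw [e1]
    simp [matY, sigma3]
    ring

/-- The recursion for the formal resolvent makes `V_m' + [V_m, V]` telescope. -/
lemma zero_curvature_sum (ψ : 𝓢(ℝ, ℂ)) (lam : ℂ) (x : ℝ) (m : ℕ) :
    ∑ k ∈ Finset.range m, lam ^ (m - 1 - k) • (matY ψ x * laxCoeff ψ k x - laxCoeff ψ k x * matY ψ x
      - (Complex.I / 2) • (sigma3 * laxCoeff ψ (k + 1) x - laxCoeff ψ (k + 1) x * sigma3)
      + (laxCoeff ψ k x * matV ψ lam x - matV ψ lam x * laxCoeff ψ k x)) =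
    -(Complex.I / 2) • (sigma3 * laxCoeff ψ m x - laxCoeff ψ m x * sigma3) := by
  induction m with
  | zero =>
    rw [laxCoeff]
    simp
  | succ m ih =>
    have h : ∀ k ∈ Finset.range m, ∀ M : Mat, lam ^ (m + 1 - 1 - k) • M = lam • lam ^ (m - 1 - k) • M :=
      fun k hk M => by
        rw [smul_smul, ← pow_succ']
        congr 2
        have := Finset.mem_range.1 hk
        omega
    rw [Finset.sum_range_succ, Finset.sum_congr rfl fun k hk => h k hk _, ← Finset.smul_sum, ih]
    simp only [add_tsub_cancel_right, tsub_self, pow_zero, one_smul, matV, mul_add, add_mul,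
      mul_smul_comm, smul_mul_assoc]
    module

/-- The zero curvature expression of the `m`-th flow does not depend on `λ`. -/
lemma zero_curvature (ψ : 𝓢(ℝ, ℂ)) (lam : ℂ) (x : ℝ) (m : ℕ) :
    Matrix.of (fun i k => deriv (fun y => hierarchyV m ψ lam y i k) x)
      + (hierarchyV m ψ lam x * matV ψ lam x - matV ψ lam x * hierarchyV m ψ lam x) =
    (-1 : ℂ) ^ m • !![0, -(Complex.I * (upperCoeff ψ m).1 x); Complex.I * (lowerCoeff ψ m).1 x, 0] := by
  have h1 : Matrix.of (fun i k => deriv (fun y => hierarchyV m ψ lam y i k) x) =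
      (-1 : ℂ) ^ m • ∑ k ∈ Finset.range m, lam ^ (m - 1 - k) •
        (matY ψ x * laxCoeff ψ k x - laxCoeff ψ k x * matY ψ x - (Complex.I / 2) •
        (sigma3 * laxCoeff ψ (k + 1) x - laxCoeff ψ (k + 1) x * sigma3)) := by
    ext i k
    simp only [hierarchyV, Matrix.of_apply, Matrix.smul_apply, Matrix.sum_apply, smul_eq_mul]
    exact ((HasDerivAt.fun_sum fun j _ => (hasDerivAt_laxCoeff ψ j x i k).const_mul _).const_mul _).deriv
  have h2 := zero_curvature_sum ψ lam x m
  simp only [smul_add, Finset.sum_add_distrib] at h2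
  have h3 : hierarchyV m ψ lam x * matV ψ lam x - matV ψ lam x * hierarchyV m ψ lam x =
      (-1 : ℂ) ^ m • ∑ k ∈ Finset.range m, lam ^ (m - 1 - k) •
        (laxCoeff ψ k x * matV ψ lam x - matV ψ lam x * laxCoeff ψ k x) := by
    simp only [hierarchyV, smul_mul_assoc, mul_smul_comm, Finset.sum_mul, Finset.mul_sum, smul_sub,
      Finset.sum_sub_distrib]
  rw [h1, h3, ← smul_add, h2, laxCoeff_eq]
  congr 1
  ext i k
  fin_cases i <;> fin_cases k
  · simp [sigma3]
  · simp [sigma3]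
    ring
  · simp [sigma3]
    ring
  · simp [sigma3]

/-- The velocity of the `m`-th flow is `X_m = (-1)ᵐ i (Q_m)₂₁`; the equation for the upper entry is the
complex conjugate of the one for the lower entry. -/
lemma isFlowVelocity_iff (m : ℕ) (ψ X : 𝓢(ℝ, ℂ)) :
    IsFlowVelocity m ψ X ↔ ∀ x, X x = (-1) ^ m * (Complex.I * (lowerCoeff ψ m).1 x) := by
  have hconj : conj ((-1 : ℂ) ^ m) = (-1) ^ m := by simp
  simp only [IsFlowVelocity, add_assoc, zero_curvature]
  constructor
  · intro h x
    have := congrFun (congrFun (h 0 x) 1) 0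
    simp [deltaV, matY] at this
    linear_combination -this
  · intro h _ x
    ext i k
    fin_cases i <;> fin_cases k
    · simp [deltaV, matY]
    · simp only [deltaV, matY, h x, (conj_resolvent ψ m x).2]
      simp
    · simp [deltaV, matY, h x]
    · simp [deltaV, matY]

lemma existsUnique_isFlowVelocity (m : ℕ) (ψ : 𝓢(ℝ, ℂ)) : ∃! X, IsFlowVelocity m ψ X := by
  obtain ⟨φ, hφ⟩ := lowerCoeff_mem ψ m
  simp only [isFlowVelocity_iff]
  refine ⟨((-1 : ℂ) ^ m * Complex.I) • φ, fun x => ?_, fun Y hY => ?_⟩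
  · rw [hφ]
    simp [mul_assoc]
  · ext x
    rw [hY, hφ]
    simp [mul_assoc]

/-- The flows are Hamiltonian, with the factor `4 (-1)ᵐ`. -/
lemma omegaVal_flow {m : ℕ} {ψ X : 𝓢(ℝ, ℂ)} (hX : IsFlowVelocity m ψ X) (v : 𝓢(ℝ, ℂ)) :
    omegaVal X v = ((4 * (-1) ^ m * lineDeriv ℝ (hamiltonian m) ψ v : ℝ) : ℂ) := by
  rw [(hasLineDerivAt_hamiltonian m ψ v).lineDeriv, omegaVal]
  rw [isFlowVelocity_iff] at hX
  have h : ∀ x, conj (X x) * v x - conj (v x) * X x =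
      ((-(2 * (-1) ^ m * (conj (v x) * (lowerCoeff ψ m).1 x).re) : ℝ) : ℂ) * Complex.I := fun x => by
    have h2 := Complex.add_conj (conj (v x) * (lowerCoeff ψ m).1 x)
    rw [map_mul, Complex.conj_conj] at h2
    rw [hX]
    push_cast at h2 ⊢
    simp only [map_mul, map_pow, map_neg, map_one, Complex.conj_I]
    linear_combination (-(-1) ^ m * Complex.I) * h2
  simp only [h]
  rw [integral_mul_const, integral_complex_ofReal, integral_neg, integral_const_mul]
  push_cast
  linear_combination (-4 * (-1) ^ m * ((∫ x, (conj (v x) * (lowerCoeff ψ m).1 x).re : ℝ) : ℂ)) * Complex.I_mul_I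

end NLSScattering

end

theorem theorem3p4 :
    -- the Jost solutions exist and are unique, and the formula makes sense in both half-planes
    (∀ (ψ : SchwartzMap ℝ ℂ) (lam : ℂ),
      (0 < lam.im → (∃! j, NLSScattering.IsJostColumn Filter.atBot 0 ψ lam j) ∧
        ∃! j, NLSScattering.IsJostColumn Filter.atTop 1 ψ lam j) ∧
      (lam.im < 0 → (∃! j, NLSScattering.IsJostColumn Filter.atTop 0 ψ lam j) ∧
        ∃! j, NLSScattering.IsJostColumn Filter.atBot 1 ψ lam j)) ∧
    (∀ lam : ℂ,
      (0 < lam.im → NLSScattering.KricheverPhongMeaningful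
        (NLSScattering.coeffA lam) (NLSScattering.Hplus lam)) ∧
      (lam.im < 0 → NLSScattering.KricheverPhongMeaningful
        (NLSScattering.coeffAStar lam) (NLSScattering.Hminus lam))) ∧
    -- the formula defines a closed two-form, which is computed explicitly
    ∃ ω : SchwartzMap ℝ ℂ → (SchwartzMap ℝ ℂ) [⋀^Fin 2]→L[ℝ] ℂ,
      (∀ ψ u v : SchwartzMap ℝ ℂ,
        NLSScattering.IsKricheverPhongValue ψ u v (ω ψ ![u, v])) ∧
      NLSScattering.IsClosedTwoForm ω ∧
      (∀ ψ u v : SchwartzMap ℝ ℂ, ω ψ ![u, v] = 2 * Complex.I *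
        ∫ x, ((starRingEnd ℂ) (u x) * v x - (starRingEnd ℂ) (v x) * u x)) ∧
      -- the flows of the hierarchy are Hamiltonian, up to a constant factor
      ∃ H : ℕ → SchwartzMap ℝ ℂ → ℝ,
        (∀ ψ : SchwartzMap ℝ ℂ, NLSScattering.AreIntegralsOfMotion ψ (fun m => H m ψ)) ∧
        ∀ m : ℕ, 1 ≤ m →
          (∀ ψ : SchwartzMap ℝ ℂ, ∃! X, NLSScattering.IsFlowVelocity m ψ X) ∧
          ∃ c : ℝ, c ≠ 0 ∧ ∀ ψ X : SchwartzMap ℝ ℂ, NLSScattering.IsFlowVelocity m ψ X →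
            ∀ v : SchwartzMap ℝ ℂ, LineDifferentiableAt ℝ (H m) ψ v ∧
              ω ψ ![X, v] = ((-c * lineDeriv ℝ (H m) ψ v : ℝ) : ℂ) := by
  open NLSScattering in
  refine ⟨fun ψ lam => ⟨fun hl => ⟨existsUnique_jostColumn_atBot ψ hl, existsUnique_jostColumn_atTop ψ hl⟩,
    fun hl => ?_⟩, fun lam => ⟨fun hl => kricheverPhongMeaningful_plus hl, fun hl =>
    kricheverPhongMeaningful_minus hl⟩, fun _ => omegaForm, isKricheverPhongValue_omegaVal,
    isClosedTwoForm_const _, fun _ _ _ => rfl, hamiltonian, areIntegralsOfMotion_hamiltonian,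
    fun m _ => ⟨existsUnique_isFlowVelocity m, -4 * (-1) ^ m,
      mul_ne_zero (by norm_num) (pow_ne_zero _ (by norm_num)), fun ψ X hX v =>
      ⟨(hasLineDerivAt_hamiltonian m ψ v).lineDifferentiableAt, ?_⟩⟩⟩
  · have hl' : 0 < (starRingEnd ℂ lam).im := by simpa using hl
    have h0 := existsUnique_jostColumn_conj (existsUnique_jostColumn_atTop ψ hl')
    have h1 := existsUnique_jostColumn_conj (existsUnique_jostColumn_atBot ψ hl')
    rw [sub_self] at h0
    rw [sub_zero] at h1
    exact ⟨h0, h1⟩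
  · refine (omegaVal_flow hX v).trans ?_
    congr 1
    ring
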